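/- Let $K$ be a field, $R=K[x_1,\dots,x_n]$ and $R'=R[y]$, both graded by total degree. Let $\prec$ be the degree reverse lexicographic (DRL) order on $R$ for some ordering of the variables, and $\prec^h$ its homogenization on $R'$ (compare total degrees first, then the parts in $x_1,\dots,x_n$ by $\prec$). Let $F=(f_1,\dots,f_m)$ be a finite sequence of non-constant polynomials of $R$. Write $f^{\rm top}$ for the part of $f$ of maximal total degree, $f^h\in R'$ for its homogenization by $y$, $g^{\rm deh}=g|_{y=1}$, and $g^{\rm top}=g|_{y=0}$ for $g\in R'$ homogeneous. Let $$D=d_{\rm reg}(\langle F^{\rm top}\rangle)=\min\{d: R_d\subset\langle F^{\rm top}\rangle\}$$ and assume $D<\infty$. Say that $F$ is affine cryptographic semi-regular if, for every $i$ and every homogeneous $g$ with $\deg g+\deg f_i<D$, $g f_i^{\rm top}\in\langle f_1^{\rm top},\dots,f_{i-1}^{\rm top}\rangle$ implies $g\in\langle f_1^{\rm top},\dots,f_{i-1}^{\rm top}\rangle$. Let $G_{\rm hom}$ and $G_{\rm top}$ be the reduced Gröbner bases of $\langle F^h\rangle$ (for $\prec^h$) and $\langle F^{\rm top}\rangle$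 (for $\prec$). A subscript $d$ (or $\le D$) selects the elements of degree $d$ (or $\le D$). By Buchberger's procedure on an input set we mean the following. A state consists of a set $B$ of polynomials and a set $P$ of pending critical pairs; initially $B$ is the input and $P$ the set of all pairs of distinct elements of $B$. The step degree of a pair $\{f,g\}$ is $\deg\operatorname{lcm}({\rm LM}(f),{\rm LM}(g))$. The allowed operations are: (a) drop a pending pair with coprime leading monomials; (b) (normal strategy) take a pending pair $\{f,g\}$ of lowest step degree, reduce its S-polynomial $S(f,g)$ modulo $B$ to a normal form $r$, remove the pair and, if $r\ne0$, add $r$ to $B$ and all pairs $\{h,r\}$, $h\in B$, to $P$; (c) (inter-reduction) replace some $f\in B$ by a normal form $r$ of $f$ modulo $B\smallsetminus\{f\}$, delete the pairs containing $f$ and, if $r\neq 0$, add all pairs of $r$ with the other elements (if $r=0$, $f$ is just removed). A Buchberger-like algorithm is a deterministic choice of an allowed operation in each state that stops only when $P$ is empty and that, on every finite set of non-zero polynomials of $R$, stops with a Gröbner basis of the generated ideal. Its solving degree on $F$ is the highest step degree of its operations on input $F$ (an inter-reduction of $f$ counting with $\deg f$, an operation (a) with $0$), and its solving degree in the strict sense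 is the highest degree of the S-polynomials $S(f,g)$ generated in operations (b). A degree fall is an operation (b) with $r\neq0$ for which $\deg r$ is less than the step degree (for $F$), respectively $y\mid{\rm LM}(r)$ (for $F^h$). Then the following hold; affine cryptographic semi-regularity is needed only for (1) and (3)(i). 1. If $F$ is affine cryptographic semi-regular, then ${\rm LM}(G_{\rm hom})_d={\rm LM}(G_{\rm top})_d$ for every $d<D$. 2. $\langle{\rm LM}((G_{\rm hom})_{\le D})\rangle_{R'}\cap R_D=R_D$. For each $g\in(G_{\rm hom})_D$ with $g^{\rm top}\ne0$, the top part consists of one term: $g^{\rm top}={\rm LT}(g)$. 3. Consider finite sequences of allowed operations of Buchberger's procedure, on input $F^h$ with respect to $\prec^h$ and on input $F$ with respect to $\prec$. (i) If $F$ is affine cryptographic semi-regular, then in a sequence of operations (a), (b) of step degrees $<D$ there is no degree fall, neither on input $F^h$ nor on input $F$. (ii) Dehomogenization of all polynomials involved is a bijection from the sequences of operations (a), (b) on input $F^h$ with step degrees $\le D$ and no degree fall onto the sequences of operations (a), (b) on input $F$ with step degrees $\le D$ and no degree fall. (iii) After any sequence of operations on input $F$ that leaves no pending pair of step degree $\le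 D$, every monomial of degree $\ge D$ is divisible by the leading monomial of an element of $B$. 4. If $D\ge\max_i\deg f_i$, then every element of the reduced Gröbner basis of $\langle F\rangle$ with respect to $\prec$ has degree at most $D$. Moreover, there is a Buchberger-like algorithm with respect to $\prec$, the same for all such $F$, whose solving degree on $F$ is at most $2D-1$, and at most $2D-2$ in the strict sense, for every such $F$ with $D\geq\max_i\deg f_i$. -/

import Mathlib

open MvPolynomial Relation

namespace SemiRegGB

noncomputable section

/-! ### Monomial orders -/

section Orders

/-- The monomial order `a ≼ b ↔ φ a ≤ φ b` obtained from an injective additive map `φ` on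
exponents, with non-negative values in an ordered monoid. -/
def orderOfHom {τ S : Type*} [Finite τ] [AddCommMonoid S] [LinearOrder S]
    [IsOrderedCancelAddMonoid S] (φ : (τ →₀ ℕ) →+ S) (hφ : Function.Injective φ)
    (h0 : ∀ a, 0 ≤ φ a) : MonomialOrder τ where
  syn := AddMonoidHom.mrange φ
  addCommMonoidSyn := inferInstanceAs (AddCommMonoid (AddMonoidHom.mrange φ))
  linearOrderSyn := inferInstanceAs (LinearOrder (AddMonoidHom.mrange φ))
  isOrderedAddMonoid_syn := inferInstanceAs (IsOrderedAddMonoid (AddMonoidHom.mrange φ))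
  toSyn :=
    { toFun := φ.mrangeRestrict
      invFun := fun x => x.2.choose
      left_inv := fun a => hφ (φ.mrangeRestrict a).2.choose_spec
      right_inv := fun x => Subtype.ext x.2.choose_spec
      map_add' := fun a b => map_add φ.mrangeRestrict a b }
  toSyn_monotone := by
    intro a b hab
    obtain ⟨c, rfl⟩ := exists_add_of_le hab
    change φ a ≤ φ (a + c)
    rw [map_add]
    exact le_add_of_nonneg_right (h0 c)
  wellFoundedLT_syn := by
    refine ⟨?_⟩
    rw [wellFounded_iff_isEmpty_descending_chain]
    refine ⟨fun ⟨u, hu⟩ => ?_⟩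
    choose v hv using fun k => (u k).2
    obtain ⟨i, j, hij, hle⟩ := wellQuasiOrdered_le v
    obtain ⟨c, hc⟩ := exists_add_of_le hle
    have hanti : StrictAnti u := strictAnti_nat_of_succ_lt hu
    have h1 : (u j : S) < u i := hanti hij
    rw [← hv i, ← hv j, hc, map_add] at h1
    exact absurd h1 (not_lt.mpr (le_add_of_nonneg_right (h0 c)))

theorem orderOfHom_lt_iff {τ S : Type*} [Finite τ] [AddCommMonoid S] [LinearOrder S]
    [IsOrderedCancelAddMonoid S] (φ : (τ →₀ ℕ) →+ S) (hφ : Function.Injective φ)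
    (h0 : ∀ a, 0 ≤ φ a) (a b : τ →₀ ℕ) :
    (orderOfHom φ hφ h0).toSyn a < (orderOfHom φ hφ h0).toSyn b ↔ φ a < φ b := Iff.rfl

/-- The key of the degree reverse lexicographic order: the total degree, then the exponents read
from the last variable on, with the opposite order on each exponent. -/
def drlKey (σ : Type*) [LinearOrder σ] :
    (σ →₀ ℕ) →+ ℕ ×ₗ Lex (σᵒᵈ → ℕᵒᵈ) where
  toFun a := toLex (a.degree, toLex fun i => OrderDual.toDual (a (OrderDual.ofDual i)))
  map_zero' := by simp only [map_zero]; rfl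
  map_add' a b := by simp only [map_add]; rfl

/-- The degree reverse lexicographic order on the monomials in the variables `σ`, where `i < j`
means that the variable `x_i` is larger than `x_j`. -/
def drl (σ : Type*) [Finite σ] [LinearOrder σ] : MonomialOrder σ :=
  orderOfHom (drlKey σ)
    (fun a b h => by
      have h2 : (drlKey σ a).2 = (drlKey σ b).2 := congrArg Prod.snd h
      ext i
      exact congrFun h2 (OrderDual.toDual i))
    (fun a => by
      rcases Nat.eq_zero_or_pos a.degree with h | h
      · rw [(Finsupp.degree_eq_zero_iff a).mp h, map_zero]
      · exact le_of_lt (Prod.Lex.toLex_lt_toLex.mpr (Or.inl h)))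

theorem drl_lt_iff {σ : Type*} [Finite σ] [LinearOrder σ] (a b : σ →₀ ℕ) :
    (drl σ).toSyn a < (drl σ).toSyn b ↔
      a.degree < b.degree ∨
        a.degree = b.degree ∧ ∃ i, (∀ j, i < j → a j = b j) ∧ b i < a i := by
  refine (orderOfHom_lt_iff _ _ _ a b).trans (Prod.Lex.toLex_lt_toLex.trans ?_)
  exact Iff.rfl

/-- The homogenization of a monomial order: compare the total degrees, then the parts in the
original variables. The homogenizing variable `y` is `none : Option σ`. -/
def homogenizedOrder {σ : Type*} [Finite σ] (m : MonomialOrder σ) : MonomialOrder (Option σ) :=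
  orderOfHom (S := ℕ ×ₗ m.syn)
    { toFun := fun a => toLex (a.degree, m.toSyn a.some)
      map_zero' := by simp only [map_zero, Finsupp.some_zero]; rfl
      map_add' := fun a b => by simp only [map_add, Finsupp.some_add]; rfl }
    (fun a b h => by
      have h1 : a.degree = b.degree := congrArg Prod.fst h
      have h2 : a.some = b.some := m.toSyn.injective (congrArg Prod.snd h)
      have hdeg : ∀ c : Option σ →₀ ℕ, c.degree = c none + c.some.degree := fun c => by
        have := Fintype.ofFinite σ
        simp [Finsupp.degree_eq_sum, Fintype.sum_option]
      ext o
      cases o with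
      | none => rw [hdeg a, hdeg b, h2] at h1; omega
      | some i => exact DFunLike.congr_fun h2 i)
    (fun a => by
      rcases Nat.eq_zero_or_pos a.degree with h | h
      · rw [(Finsupp.degree_eq_zero_iff a).mp h, map_zero]
      · exact le_of_lt (Prod.Lex.toLex_lt_toLex.mpr (Or.inl h)))

theorem homogenizedOrder_lt_iff {σ : Type*} [Finite σ] (m : MonomialOrder σ)
    (a b : Option σ →₀ ℕ) :
    (homogenizedOrder m).toSyn a < (homogenizedOrder m).toSyn b ↔
      a.degree < b.degree ∨ a.degree = b.degree ∧ m.toSyn a.some < m.toSyn b.some :=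
  (orderOfHom_lt_iff _ _ _ a b).trans Prod.Lex.toLex_lt_toLex

end Orders

/-! ### Top parts, homogenization, semi-regularity -/

section Polynomials

variable {σ K : Type*} [Field K]

/-- The sum of the terms of `f` of maximal total degree. -/
def topPart (f : MvPolynomial σ K) : MvPolynomial σ K :=
  homogeneousComponent f.totalDegree f

/-- `f^h = ∑ c_t t y^(deg f - deg t)`, in the variables `Option σ`, with `y = X none`. -/
def homogenize (f : MvPolynomial σ K) : MvPolynomial (Option σ) K :=
  ∑ a ∈ f.support,
    monomial (a.embDomain Function.Embedding.some
      + Finsupp.single none (f.totalDegree - a.degree)) (coeff a f)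

/-- Substitution `y = 1`. -/
def dehomogenize : MvPolynomial (Option σ) K →ₐ[K] MvPolynomial σ K :=
  aeval fun o => o.elim 1 X

/-- Substitution `y = 0`: the top part of a homogeneous polynomial in `K[x][y]`. -/
def homTopPart : MvPolynomial (Option σ) K →ₐ[K] MvPolynomial σ K :=
  aeval fun o => o.elim 0 X

/-- The degree of regularity of a homogeneous ideal `I` of `R`: the least `d` with `R_d = I_d` if
`R / I` vanishes in all large degrees, and `∞` otherwise. -/
def degReg (I : Ideal (MvPolynomial σ K)) : ℕ∞ :=
  open Classical in
  if ∃ N, ∀ d ≥ N, ∀ p : MvPolynomial σ K, p.IsHomogeneous d → p ∈ I then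
    ((sInf {d : ℕ | ∀ p : MvPolynomial σ K, p.IsHomogeneous d → p ∈ I} : ℕ) : ℕ∞)
  else ⊤

/-- `d`-regularity of a sequence of homogeneous polynomials. -/
def IsDRegular {k : ℕ} (f : Fin k → MvPolynomial σ K) (d : ℕ∞) : Prop :=
  ∀ (i : Fin k) (e : ℕ) (g : MvPolynomial σ K), g.IsHomogeneous e →
    ((e + (f i).totalDegree : ℕ) : ℕ∞) < d →
    g * f i ∈ Ideal.span (f '' {j | j < i}) → g ∈ Ideal.span (f '' {j | j < i})

/-- Cryptographic semi-regularity of a sequence of homogeneous polynomials. -/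
def IsCryptoSemiRegular {k : ℕ} (f : Fin k → MvPolynomial σ K) : Prop :=
  IsDRegular f (degReg (Ideal.span (Set.range f)))

/-- Affine cryptographic semi-regularity. -/
def IsAffineCryptoSemiRegular {k : ℕ} (f : Fin k → MvPolynomial σ K) : Prop :=
  IsCryptoSemiRegular fun i => topPart (f i)

end Polynomials

/-! ### Gröbner bases -/

section Groebner

variable {τ K : Type*} [Field K] (m : MonomialOrder τ)

/-- `G` is a Gröbner basis of `I`. -/
def IsGroebnerBasis (G : Set (MvPolynomial τ K)) (I : Ideal (MvPolynomial τ K)) : Prop :=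
  G ⊆ I ∧ ∀ f ∈ I, f ≠ 0 → ∃ g ∈ G, g ≠ 0 ∧ m.degree g ≤ m.degree f

/-- `G` is a reduced Gröbner basis of `I`: its elements are monic, and no monomial of one element
is divisible by the leading monomial of another one. -/
def IsReducedGroebnerBasis (G : Set (MvPolynomial τ K)) (I : Ideal (MvPolynomial τ K)) : Prop :=
  IsGroebnerBasis m G I ∧ (∀ g ∈ G, m.Monic g) ∧
    ∀ g ∈ G, ∀ h ∈ G, h ≠ g → ∀ a ∈ g.support, ¬ m.degree h ≤ a

variable {m}

theorem IsReducedGroebnerBasis.mem_iff {G : Set (MvPolynomial τ K)} {I : Ideal (MvPolynomial τ K)}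
    (hG : IsReducedGroebnerBasis m G I) (g : MvPolynomial τ K) :
    g ∈ G ↔ g ∈ I ∧ m.Monic g ∧
      (∀ f ∈ I, f ≠ 0 → m.degree f ≤ m.degree g → m.degree f = m.degree g) ∧
      ∀ a ∈ g.support, a ≠ m.degree g → ∀ f ∈ I, f ≠ 0 → ¬ m.degree f ≤ a := by
  classical
  obtain ⟨⟨hGI, hGB⟩, hmon, hred⟩ := hG
  have key : ∀ g ∈ G, g ∈ I ∧ m.Monic g ∧
      (∀ f ∈ I, f ≠ 0 → m.degree f ≤ m.degree g → m.degree f = m.degree g) ∧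
      ∀ a ∈ g.support, a ≠ m.degree g → ∀ f ∈ I, f ≠ 0 → ¬ m.degree f ≤ a := by
    intro g hg
    refine ⟨hGI hg, hmon g hg, ?_, ?_⟩
    · intro f hf hf0 hle
      obtain ⟨h, hh, -, hhf⟩ := hGB f hf hf0
      by_cases e : h = g
      · exact le_antisymm hle (e ▸ hhf)
      · exact absurd (hhf.trans hle)
          (hred g hg h hh e _ (m.degree_mem_support (hmon g hg).ne_zero))
    · intro a ha hag f hf hf0 hle
      obtain ⟨h, hh, -, hhf⟩ := hGB f hf hf0
      by_cases e : h = g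
      · subst e
        have h1 := m.toSyn_monotone (hhf.trans hle)
        have h2 := m.le_degree ha
        exact hag (m.toSyn.injective (le_antisymm h2 h1))
      · exact hred g hg h hh e a ha (hhf.trans hle)
  refine ⟨key g, ?_⟩
  rintro ⟨hgI, hgm, hgmin, hgt⟩
  obtain ⟨h, hh, h0, hle⟩ := hGB g hgI hgm.ne_zero
  obtain ⟨hhI, hhm, hhmin, hht⟩ := key h hh
  have hdeg := hgmin h hhI h0 hle
  have hsub : g - h = 0 := by
    by_contra hne
    have hI : g - h ∈ I := I.sub_mem hgI hhI
    have hs := m.degree_mem_support hne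
    have hc : coeff (m.degree (g - h)) (g - h) ≠ 0 := mem_support_iff.mp hs
    have hnd : m.degree (g - h) ≠ m.degree g := by
      intro e
      rw [e, coeff_sub, hgm.coeff_degree, ← hdeg, hhm.coeff_degree, sub_self] at hc
      exact hc rfl
    rcases Finset.mem_union.mp (support_sub τ g h hs) with h1 | h1
    · exact hgt _ h1 hnd _ hI hne le_rfl
    · exact hht _ h1 (hdeg ▸ hnd) _ hI hne le_rfl
  rw [sub_eq_zero.mp hsub]
  exact hh

variable (m)

/-- Every ideal has exactly one reduced Gröbner basis. -/
theorem existsUnique_isReducedGroebnerBasis [Finite τ] (I : Ideal (MvPolynomial τ K)) :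
    ∃! G : Set (MvPolynomial τ K), IsReducedGroebnerBasis m G I := by
  classical
  refine existsUnique_of_exists_of_unique ?_ fun G G' hG hG' => by
    ext g
    rw [hG.mem_iff, hG'.mem_iff]
  refine ⟨{g | g ∈ I ∧ m.Monic g ∧
      (∀ f ∈ I, f ≠ 0 → m.degree f ≤ m.degree g → m.degree f = m.degree g) ∧
      ∀ a ∈ g.support, a ≠ m.degree g → ∀ f ∈ I, f ≠ 0 → ¬ m.degree f ≤ a},
    ⟨fun g hg => hg.1, ?_⟩, fun g hg => hg.2.1, ?_⟩
  · intro f hf hf0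
    -- a minimal leading exponent below that of `f`
    obtain ⟨p, ⟨hpI, hp0, hpf⟩, hpmin⟩ :=
      WellFounded.has_min (InvImage.wf (m.degree (R := K)) (wellFounded_lt (α := τ →₀ ℕ)))
        {p | p ∈ I ∧ p ≠ 0 ∧ m.degree p ≤ m.degree f} ⟨f, hf, hf0, le_rfl⟩
    have hmin : ∀ q ∈ I, q ≠ 0 → m.degree q ≤ m.degree p → m.degree q = m.degree p := by
      intro q hq hq0 hle
      by_contra hne
      exact hpmin q ⟨hq, hq0, hle.trans hpf⟩ (lt_of_le_of_ne hle hne)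
    obtain ⟨c, r, hsum, -, hr⟩ := m.div_set (B := {b : MvPolynomial τ K | b ∈ I ∧ b ≠ 0})
      (fun b hb => (m.leadingCoeff_ne_zero_iff.mpr hb.2).isUnit)
      (monomial (m.degree p) (1 : K) - C (m.leadingCoeff p)⁻¹ * p)
    set t := monomial (m.degree p) (1 : K) - C (m.leadingCoeff p)⁻¹ * p with ht
    have hlc : m.leadingCoeff p ≠ 0 := m.leadingCoeff_ne_zero_iff.mpr hp0
    have hrI : t - r ∈ I := by
      rw [hsum, add_sub_cancel_right, Finsupp.linearCombination_apply]
      exact I.sum_mem fun b _ => I.mul_mem_left _ b.2.1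
    -- the wanted element
    set g := monomial (m.degree p) (1 : K) - r with hg
    have hgI : g ∈ I := by
      have : g = (t - r) + C (m.leadingCoeff p)⁻¹ * p := by rw [hg, ht]; ring
      rw [this]
      exact I.add_mem hrI (I.mul_mem_left _ hpI)
    have hrp : coeff (m.degree p) r = 0 := by
      by_contra hne
      exact hr _ (mem_support_iff.mpr hne) p ⟨hpI, hp0⟩ le_rfl
    have hgc : coeff (m.degree p) g = 1 := by
      rw [hg, coeff_sub, coeff_monomial, if_pos rfl, hrp, sub_zero]
    have hg0 : g ≠ 0 := by
      intro e
      rw [e, coeff_zero] at hgc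
      exact zero_ne_one hgc
    have hsupp : ∀ a ∈ g.support, a ≠ m.degree p → a ∈ r.support := by
      intro a ha hne
      rw [mem_support_iff, hg, coeff_sub, coeff_monomial, if_neg (Ne.symm hne), zero_sub,
        neg_ne_zero] at ha
      exact mem_support_iff.mpr ha
    have hdeg : m.degree g = m.degree p := by
      by_contra hne
      exact hr _ (hsupp _ (m.degree_mem_support hg0) hne) g ⟨hgI, hg0⟩ le_rfl
    refine ⟨g, ⟨hgI, ?_, ?_, ?_⟩, hg0, hdeg ▸ hpf⟩
    · rw [MonomialOrder.Monic, MonomialOrder.leadingCoeff, hdeg, hgc]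
    · rw [hdeg]; exact hmin
    · intro a ha hne q hq hq0
      exact hr a (hsupp a ha (hdeg ▸ hne)) q ⟨hq, hq0⟩
  · rintro g ⟨hgI, hgm, hgmin, hgt⟩ h ⟨hhI, hhm, hhmin, hht⟩ hne a ha hle
    by_cases hag : a = m.degree g
    · subst hag
      have hdeg := hgmin h hhI hhm.ne_zero hle
      apply hne
      by_contra hne'
      have hsub : h - g ≠ 0 := sub_ne_zero.mpr hne'
      have hI : h - g ∈ I := I.sub_mem hhI hgI
      have hs := m.degree_mem_support hsub
      have hc : coeff (m.degree (h - g)) (h - g) ≠ 0 := mem_support_iff.mp hs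
      have hnd : m.degree (h - g) ≠ m.degree g := by
        intro e
        rw [e, coeff_sub, hgm.coeff_degree, ← hdeg, hhm.coeff_degree, sub_self] at hc
        exact hc rfl
      rcases Finset.mem_union.mp (support_sub τ h g hs) with h1 | h1
      · exact hht _ h1 (hdeg ▸ hnd) _ hI hsub le_rfl
      · exact hgt _ h1 hnd _ hI hsub le_rfl
    · exact hgt a ha hag h hhI hhm.ne_zero hle

/-- The reduced Gröbner basis of `I`. -/
def reducedGroebnerBasis [Finite τ] (I : Ideal (MvPolynomial τ K)) : Set (MvPolynomial τ K) :=
  (existsUnique_isReducedGroebnerBasis m I).choose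

theorem reducedGroebnerBasis_spec [Finite τ] (I : Ideal (MvPolynomial τ K)) :
    IsReducedGroebnerBasis m (reducedGroebnerBasis m I) I :=
  (existsUnique_isReducedGroebnerBasis m I).choose_spec.1

/-- The maximal degree of the elements of the reduced Gröbner basis of `I`. -/
def maxGBDegree [Finite τ] (I : Ideal (MvPolynomial τ K)) : ℕ∞ :=
  ⨆ g ∈ reducedGroebnerBasis m I, (g.totalDegree : ℕ∞)

/-- The (exponents of the) leading monomials of degree `d` of the elements of `G`. -/
def leadingExponents (G : Set (MvPolynomial τ K)) (d : ℕ) : Set (τ →₀ ℕ) :=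
  {a | a.degree = d ∧ ∃ g ∈ G, m.degree g = a}

end Groebner

/-! ### Buchberger-like algorithms -/

section Buchberger

variable {τ K : Type*} [Field K]

/-- One reduction step modulo `B`: one term of `f` is cancelled by a multiple of some `b ∈ B`. -/
def ReducesTo (m : MonomialOrder τ) (B : Set (MvPolynomial τ K)) (f f' : MvPolynomial τ K) : Prop :=
  ∃ b ∈ B, b ≠ 0 ∧ ∃ a ∈ f.support, m.degree b ≤ a ∧
    f' = f - monomial (a - m.degree b) (coeff a f / m.leadingCoeff b) * b

/-- `r` is a normal form of `f` modulo `B`. -/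
def IsNormalForm (m : MonomialOrder τ) (B : Set (MvPolynomial τ K)) (f r : MvPolynomial τ K) :
    Prop :=
  ReflTransGen (ReducesTo m B) f r ∧ ∀ a ∈ r.support, ∀ b ∈ B, b ≠ 0 → ¬ m.degree b ≤ a

variable (τ K) in
/-- The data of Buchberger's procedure: the current polynomials and the pending critical pairs. -/
structure BState where
  basis : Set (MvPolynomial τ K)
  pairs : Set (Sym2 (MvPolynomial τ K))

variable (τ K) in
/-- The operations of Buchberger's procedure: drop a critical pair by Buchberger's coprimality
criterion; treat a critical pair `{f, g}` whose S-polynomial has the computed normal form `r`;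
replace an element `f` by a computed normal form `r` modulo the other elements. -/
inductive BAction where
  | discard (f g : MvPolynomial τ K)
  | spair (f g r : MvPolynomial τ K)
  | interreduce (f r : MvPolynomial τ K)

/-- The degree of the critical pair `{f, g}`: the degree of the lcm of the leading monomials. -/
def pairDegree (m : MonomialOrder τ) (f g : MvPolynomial τ K) : ℕ :=
  (m.degree f ⊔ m.degree g).degree

open Classical in
/-- The effect of an operation. -/
def BState.apply (s : BState τ K) : BAction τ K → BState τ K
  | .discard f g => ⟨s.basis, s.pairs \ {s(f, g)}⟩
  | .spair f g r =>
      if r = 0 then ⟨s.basis, s.pairs \ {s(f, g)}⟩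
      else ⟨insert r s.basis, s.pairs \ {s(f, g)} ∪ (fun h => s(h, r)) '' s.basis⟩
  | .interreduce f r =>
      if r = 0 then ⟨s.basis \ {f}, {p ∈ s.pairs | f ∉ p}⟩
      else ⟨insert r (s.basis \ {f}),
        {p ∈ s.pairs | f ∉ p} ∪ (fun h => s(h, r)) '' (s.basis \ {f})⟩

/-- The operations that are allowed in a state. Critical pairs are selected by the normal strategy:
only a pending pair of lowest degree may be treated. -/
def BState.Legal (m : MonomialOrder τ) (s : BState τ K) : BAction τ K → Prop
  | .discard f g => s(f, g) ∈ s.pairs ∧ m.degree f ⊓ m.degree g = 0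
  | .spair f g r => s(f, g) ∈ s.pairs ∧
      (∀ f' g', s(f', g') ∈ s.pairs → pairDegree m f g ≤ pairDegree m f' g') ∧
      IsNormalForm m s.basis (m.sPolynomial f g) r
  | .interreduce f r => f ∈ s.basis ∧ IsNormalForm m (s.basis \ {f}) f r

/-- The initial state: the input `F` and all its critical pairs. -/
def BState.init (F : Set (MvPolynomial τ K)) : BState τ K :=
  ⟨F, {p | ∃ f ∈ F, ∃ g ∈ F, f ≠ g ∧ p = s(f, g)}⟩

/-- The step degree: the degree of the treated critical pair. An inter-reduction of `f` counts with
the degree of `f`; dropping a pair involves no computation. -/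
def BAction.stepDegree (m : MonomialOrder τ) : BAction τ K → ℕ
  | .discard _ _ => 0
  | .spair f g _ => pairDegree m f g
  | .interreduce f _ => f.totalDegree

/-- The degree of the S-polynomial that is generated by an operation (`0` if there is none). -/
def BAction.sPolyDegree (m : MonomialOrder τ) : BAction τ K → ℕ
  | .spair f g _ => (m.sPolynomial f g).totalDegree
  | _ => 0

/-- The operation is not an inter-reduction. -/
def BAction.OnPairs : BAction τ K → Prop
  | .interreduce _ _ => False
  | _ => True

/-- There is no degree fall: a new polynomial has the degree of the treated critical pair. -/
def BAction.NoFall (m : MonomialOrder τ) : BAction τ K → Prop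
  | .spair f g r => r ≠ 0 → r.totalDegree = pairDegree m f g
  | _ => True

/-- For homogeneous polynomials, where `y = X none`: the leading monomial of a new polynomial is
not divisible by `y`. -/
def BAction.NoFallHom {σ : Type*} (m : MonomialOrder (Option σ)) : BAction (Option σ) K → Prop
  | .spair _ _ r => r ≠ 0 → m.degree r none = 0
  | _ => True

/-- Apply a map to all polynomials of an operation. -/
def BAction.map {τ' : Type*} (φ : MvPolynomial τ K → MvPolynomial τ' K) :
    BAction τ K → BAction τ' K
  | .discard f g => .discard (φ f) (φ g)
  | .spair f g r => .spair (φ f) (φ g) (φ r)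
  | .interreduce f r => .interreduce (φ f) (φ r)

/-- A finite sequence of operations that are allowed, one after the other, from the state `s` on. -/
def IsRun (m : MonomialOrder τ) : BState τ K → List (BAction τ K) → Prop
  | _, [] => True
  | s, a :: l => s.Legal m a ∧ IsRun m (s.apply a) l

/-- The state after a sequence of operations. -/
def finalState (s : BState τ K) (l : List (BAction τ K)) : BState τ K :=
  l.foldl BState.apply s

variable (K) in
/-- A deterministic Buchberger-like procedure with normal strategy: in every state it performs an
allowed operation, and it may stop only when no critical pair is pending. -/
structure BuchbergerProcedure (m : MonomialOrder τ) where
  next : BState τ K → Option (BAction τ K)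
  legal : ∀ s a, next s = some a → s.Legal m a
  halt : ∀ s, next s = none → s.pairs = ∅

namespace BuchbergerProcedure

variable {m : MonomialOrder τ} (A : BuchbergerProcedure K m)

/-- The state after `k` operations on input `F` (constant after the procedure has stopped). -/
def state (F : Set (MvPolynomial τ K)) : ℕ → BState τ K
  | 0 => BState.init F
  | k + 1 => (A.next (state F k)).elim (state F k) (state F k).apply

/-- The procedure is an algorithm for Gröbner bases: on every finite set of non-zero polynomials it
stops, with a Gröbner basis of the ideal that the set generates. -/
def ComputesGroebnerBases : Prop :=
  ∀ F : Set (MvPolynomial τ K), F.Finite → 0 ∉ F →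
    ∃ k, A.next (A.state F k) = none ∧ IsGroebnerBasis m (A.state F k).basis (Ideal.span F)

/-- The solving degree on input `F`: the highest step degree of the execution. -/
def solvingDegree (F : Set (MvPolynomial τ K)) : ℕ∞ :=
  ⨆ k, (A.next (A.state F k)).elim 0 fun a => (a.stepDegree m : ℕ∞)

/-- The solving degree in the strict sense: the highest degree of an S-polynomial generated during
the execution. -/
def strictSolvingDegree (F : Set (MvPolynomial τ K)) : ℕ∞ :=
  ⨆ k, (A.next (A.state F k)).elim 0 fun a => (a.sPolyDegree m : ℕ∞)

end BuchbergerProcedure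

end Buchberger

end

end SemiRegGB

open SemiRegGB

open MvPolynomial Relation

namespace SemiRegGB

noncomputable section

/-! ### Representations with bounded leading monomials -/

section BoundedSpan

variable {τ K : Type*} [Field K] {m : MonomialOrder τ}

/-! The only property of DRL that enters is that it refines the comparison of total degrees
(`IsGraded`). Hence a polynomial and its top part have the same leading monomial, and the leading
monomial of `f^h` is that of `f`, free of `y`.

Buchberger's theory is truncated by degree through representations `∑ c x^a b`, `b ∈ B`, whose
summands have bounded leading monomials (`boundedSpan`). A pair is resolved when its S-polynomial
has a representation strictly below the lcm. Every allowed operation, inter-reduction included,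
keeps all non-pending pairs resolved and all inputs represented without exceeding their own leading
monomials (`BState.Invariant.apply`). So once no pair of degree at most `D` is pending, the leading
monomial of every nonzero combination of the inputs formed within degree `D` is divisible by one
from the basis (`BState.Invariant.exists_degree_le`).

A monomial `x^a` of degree `D` lies in `⟨F^top⟩`, say `x^a = ∑ c_i f_i^top` with homogeneous `c_i`.
Then `∑ c_i f_i` is formed within degree `D` and has top part `x^a`, and its homogenization lies in
`⟨F^h⟩` and has leading monomial `x^a` (`exists_of_degree_eq_degReg`). This gives (2), (3)(iii) and
the degree bound for the reduced basis in (4).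

Semi-regularity says that below degree `D` the syzygies of `F^top` are generated by Koszul syzygies.
These lift to `F^h` (`exists_syzygy_lift`), so an element of `⟨F^h⟩` of degree below `D` whose top
part vanishes is `y` times an element of `⟨F^h⟩`. Dividing by `y` until the top part survives gives
(1). For (3)(i), a degree fall produces a normal form `y p` with `p ∈ ⟨F^h⟩` of degree one less than
the step; under the normal strategy the basis already reduces the leading monomial of `p`, a
contradiction.

For (3)(ii), reductions of `f` and of its homogenization to degree `d` match step by step, and the
S-polynomial of `f^h, g^h` is that of `f, g` homogenized to the degree of the pair. A normal form `r
≠ 0` becomes `y^(d - deg r) r^h`, which is `r^h` exactly when no degree falls.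

For the solving degree in (4), inter-reduction comes first, then the coprimality criterion. When a
pair of degree above `D` is treated, all leading monomials have degree at most `D` and all tails
have degree below `D`. Two leading monomials that are not coprime then have an lcm of degree at most
`2D - 1`, and in the extremal case the cancellation of the lcm leaves terms of degree at most `2D -
2`. -/

theorem exists_of_mem_support_monomial_mul {u a : τ →₀ ℕ} {c : K} {p : MvPolynomial τ K}
    (h : a ∈ (monomial u c * p).support) : ∃ v ∈ p.support, a = u + v := by
  classical
  rw [mem_support_iff, coeff_monomial_mul'] at h
  split_ifs at h with hle
  · exact ⟨a - u, mem_support_iff.mpr (right_ne_zero_of_mul h), (add_tsub_cancel_of_le hle).symm⟩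
  · exact absurd rfl h

theorem toSyn_mono_add (m : MonomialOrder τ) {a b : τ →₀ ℕ} (u : τ →₀ ℕ)
    (h : m.toSyn a ≤ m.toSyn b) : m.toSyn (u + a) ≤ m.toSyn (u + b) := by
  rw [map_add, map_add]
  exact add_le_add_right h _

theorem toSyn_strictMono_add (m : MonomialOrder τ) {a b : τ →₀ ℕ} (u : τ →₀ ℕ)
    (h : m.toSyn a < m.toSyn b) : m.toSyn (u + a) < m.toSyn (u + b) := by
  rw [map_add, map_add]
  exact add_lt_add_right h _

/-- The linear combinations of multiples `x^a b`, `b ∈ B`, with leading exponents in `S`. -/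
def boundedSpan (m : MonomialOrder τ) (B : Set (MvPolynomial τ K)) (S : Set m.syn) :
    Submodule K (MvPolynomial τ K) :=
  Submodule.span K {p | ∃ b ∈ B, ∃ a, m.toSyn (a + m.degree b) ∈ S ∧ p = monomial a 1 * b}

theorem monomial_mul_mem_boundedSpan {B : Set (MvPolynomial τ K)} {S : Set m.syn}
    {b : MvPolynomial τ K} (hb : b ∈ B) {a : τ →₀ ℕ} (ha : m.toSyn (a + m.degree b) ∈ S) (c : K) :
    monomial a c * b ∈ boundedSpan m B S := by
  have : monomial a c * b = c • (monomial a 1 * b) := by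
    rw [← smul_mul_assoc, smul_monomial, smul_eq_mul, mul_one]
  rw [this]
  exact Submodule.smul_mem _ _ (Submodule.subset_span ⟨b, hb, a, ha, rfl⟩)

theorem boundedSpan_mono {B B' : Set (MvPolynomial τ K)} {S S' : Set m.syn} (hB : B ⊆ B')
    (hS : S ⊆ S') : boundedSpan m B S ≤ boundedSpan m B' S' := by
  refine Submodule.span_mono ?_
  rintro p ⟨b, hb, a, ha, rfl⟩
  exact ⟨b, hB hb, a, hS ha, rfl⟩

theorem mul_mem_boundedSpan {B : Set (MvPolynomial τ K)} {S S' : Set m.syn} (u : τ →₀ ℕ) (c : K)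
    (hS : ∀ v, m.toSyn v ∈ S → m.toSyn (u + v) ∈ S') {p : MvPolynomial τ K}
    (hp : p ∈ boundedSpan m B S) : monomial u c * p ∈ boundedSpan m B S' := by
  induction hp using Submodule.span_induction with
  | mem p hp =>
    obtain ⟨b, hb, a, ha, rfl⟩ := hp
    rw [← mul_assoc, monomial_mul, mul_one]
    exact monomial_mul_mem_boundedSpan hb (by rw [add_assoc]; exact hS _ ha) _
  | zero => rw [mul_zero]; exact zero_mem _
  | add p q _ _ hp hq => rw [mul_add]; exact add_mem hp hq
  | smul k p _ hp => rw [mul_smul_comm]; exact Submodule.smul_mem _ _ hp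

/-- This transports representations, and thus resolved pairs, when the basis is changed by
inter-reduction. -/
theorem boundedSpan_le_of_forall_mem {B B' : Set (MvPolynomial τ K)} {S : Set m.syn}
    (hS : IsLowerSet S) (h : ∀ b ∈ B, b ∈ boundedSpan m B' (Set.Iic (m.toSyn (m.degree b)))) :
    boundedSpan m B S ≤ boundedSpan m B' S := by
  refine Submodule.span_le.mpr ?_
  rintro p ⟨b, hb, a, ha, rfl⟩
  exact mul_mem_boundedSpan a 1 (fun v hv => hS (toSyn_mono_add m a hv) ha) (h b hb)

theorem support_subset_of_mem_boundedSpan {B : Set (MvPolynomial τ K)} {S : Set m.syn}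
    (hS : IsLowerSet S) {p : MvPolynomial τ K} (hp : p ∈ boundedSpan m B S) :
    ∀ a ∈ p.support, m.toSyn a ∈ S := by
  classical
  induction hp using Submodule.span_induction with
  | mem p hp =>
    obtain ⟨b, hb, a, ha, rfl⟩ := hp
    intro c hc
    obtain ⟨v, hv, rfl⟩ := exists_of_mem_support_monomial_mul hc
    exact hS (toSyn_mono_add m a (m.le_degree hv)) ha
  | zero => simp
  | add p q _ _ hp hq =>
    intro a ha
    rcases Finset.mem_union.mp (support_add ha) with h | h
    exacts [hp a h, hq a h]
  | smul k p _ hp => exact fun a ha => hp a (support_smul ha)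

/-- A finite sum has a largest leading exponent among its summands. The alternative `p = 0` covers
the empty sum, for which `S` may be empty. -/
theorem exists_mem_boundedSpan_Iic {B : Set (MvPolynomial τ K)} {S : Set m.syn}
    {p : MvPolynomial τ K} (hp : p ∈ boundedSpan m B S) :
    p = 0 ∨ ∃ t, m.toSyn t ∈ S ∧ p ∈ boundedSpan m B (Set.Iic (m.toSyn t)) := by
  induction hp using Submodule.span_induction with
  | mem p hp =>
    obtain ⟨b, hb, a, ha, rfl⟩ := hp
    exact Or.inr ⟨_, ha, monomial_mul_mem_boundedSpan hb (Set.mem_Iic.mpr le_rfl) _⟩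
  | zero => exact Or.inl rfl
  | add p q _ _ hp hq =>
    rcases hp with rfl | ⟨t, ht, hp⟩
    · rwa [zero_add]
    rcases hq with rfl | ⟨u, hu, hq⟩
    · rw [add_zero]; exact Or.inr ⟨t, ht, hp⟩
    rcases le_total (m.toSyn t) (m.toSyn u) with h | h
    · exact Or.inr ⟨u, hu, add_mem (boundedSpan_mono le_rfl (Set.Iic_subset_Iic.mpr h) hp) hq⟩
    · exact Or.inr ⟨t, ht, add_mem hp (boundedSpan_mono le_rfl (Set.Iic_subset_Iic.mpr h) hq)⟩
  | smul k p _ hp =>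
    rcases hp with rfl | ⟨t, ht, hp⟩
    · exact Or.inl (smul_zero _)
    · exact Or.inr ⟨t, ht, Submodule.smul_mem _ _ hp⟩

theorem mem_boundedSpan_univ_of_mem_span {F : Set (MvPolynomial τ K)} {p : MvPolynomial τ K}
    (hp : p ∈ Ideal.span F) : p ∈ boundedSpan m F Set.univ := by
  induction hp using Submodule.span_induction with
  | mem p hp =>
    have := monomial_mul_mem_boundedSpan (m := m) (S := Set.univ) hp (a := 0) trivial 1
    rwa [monomial_zero', C_1, one_mul] at this
  | zero => exact zero_mem _
  | add p q _ _ hp hq => exact add_mem hp hq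
  | smul k p _ hp =>
    rw [smul_eq_mul, k.as_sum, Finset.sum_mul]
    exact sum_mem fun a _ => mul_mem_boundedSpan (S := Set.univ) a _ (fun _ _ => Set.mem_univ _) hp

theorem boundedSpan_le_span (B : Set (MvPolynomial τ K)) (S : Set m.syn) :
    boundedSpan m B S ≤ (Ideal.span B).restrictScalars K := by
  refine Submodule.span_le.mpr ?_
  rintro p ⟨b, hb, a, -, rfl⟩
  exact Ideal.mul_mem_left _ _ (Ideal.subset_span hb)

/-! ### Reduction -/

/-- The subtracted multiple has the cancelled monomial as its leading monomial, so it stays within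
any lower set that contains the monomials of `f`. -/
theorem ReducesTo.bounded {B : Set (MvPolynomial τ K)} {S : Set m.syn} (hS : IsLowerSet S)
    {f f' : MvPolynomial τ K} (h : ReducesTo m B f f') (hf : ∀ a ∈ f.support, m.toSyn a ∈ S) :
    f - f' ∈ boundedSpan m B S ∧ ∀ a ∈ f'.support, m.toSyn a ∈ S := by
  classical
  obtain ⟨b, hb, -, a, ha, hle, rfl⟩ := h
  have key : monomial (a - m.degree b) (coeff a f / m.leadingCoeff b) * b ∈ boundedSpan m B S :=
    monomial_mul_mem_boundedSpan hb (by rw [tsub_add_cancel_of_le hle]; exact hf a ha) _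
  refine ⟨by rwa [sub_sub_cancel], fun c hc => ?_⟩
  rcases Finset.mem_union.mp (support_sub τ _ _ hc) with h | h
  exacts [hf c h, support_subset_of_mem_boundedSpan hS key c h]

theorem ReducesTo.bounded_chain {B : Set (MvPolynomial τ K)} {S : Set m.syn} (hS : IsLowerSet S)
    {f f' : MvPolynomial τ K} (h : ReflTransGen (ReducesTo m B) f f')
    (hf : ∀ a ∈ f.support, m.toSyn a ∈ S) :
    f - f' ∈ boundedSpan m B S ∧ ∀ a ∈ f'.support, m.toSyn a ∈ S := by
  induction h with
  | refl => exact ⟨by rw [sub_self]; exact zero_mem _, hf⟩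
  | tail _ h ih =>
    obtain ⟨h1, h2⟩ := h.bounded hS ih.2
    refine ⟨?_, h2⟩
    have := add_mem ih.1 h1
    rwa [sub_add_sub_cancel] at this

theorem IsNormalForm.bounded {B : Set (MvPolynomial τ K)} {S : Set m.syn} (hS : IsLowerSet S)
    {f r : MvPolynomial τ K} (h : IsNormalForm m B f r) (hf : ∀ a ∈ f.support, m.toSyn a ∈ S) :
    f - r ∈ boundedSpan m B S ∧ ∀ a ∈ r.support, m.toSyn a ∈ S :=
  ReducesTo.bounded_chain hS h.1 hf

theorem IsNormalForm.not_degree_le {B : Set (MvPolynomial τ K)} {f r b : MvPolynomial τ K}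
    (h : IsNormalForm m B f r) (hr : r ≠ 0) (hb : b ∈ B) (hb0 : b ≠ 0) :
    ¬ m.degree b ≤ m.degree r :=
  h.2 _ (m.degree_mem_support hr) b hb hb0

theorem IsNormalForm.notMem {B : Set (MvPolynomial τ K)} {f r : MvPolynomial τ K}
    (h : IsNormalForm m B f r) (hr : r ≠ 0) : r ∉ B :=
  fun hb => h.not_degree_le hr hb hr le_rfl

theorem IsNormalForm.toSyn_degree_le {B : Set (MvPolynomial τ K)} {f r : MvPolynomial τ K}
    (h : IsNormalForm m B f r) : m.toSyn (m.degree r) ≤ m.toSyn (m.degree f) := by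
  by_cases hr : r = 0
  · rw [hr, m.degree_zero, map_zero]; exact m.zero_le _
  · exact (h.bounded (isLowerSet_Iic _) fun a ha => m.le_degree ha).2 _ (m.degree_mem_support hr)

theorem IsNormalForm.mem_boundedSpan {B : Set (MvPolynomial τ K)} {f r : MvPolynomial τ K}
    (h : IsNormalForm m B f r) :
    f ∈ boundedSpan m (insert r B) (Set.Iic (m.toSyn (m.degree f))) := by
  have h1 := (h.bounded (isLowerSet_Iic _) fun a ha => m.le_degree ha).1
  have h2 : r ∈ boundedSpan m (insert r B) (Set.Iic (m.toSyn (m.degree f))) := by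
    have := monomial_mul_mem_boundedSpan (m := m) (S := Set.Iic (m.toSyn (m.degree f)))
      (Set.mem_insert r B) (a := 0) (by rw [zero_add]; exact h.toSyn_degree_le) 1
    rwa [monomial_zero', C_1, one_mul] at this
  have := add_mem (boundedSpan_mono (Set.subset_insert r B) le_rfl h1) h2
  rwa [sub_add_cancel] at this

theorem toSyn_lt_of_mem_support_sPolynomial {f g : MvPolynomial τ K} {a : τ →₀ ℕ}
    (ha : a ∈ (m.sPolynomial f g).support) :
    m.toSyn a < m.toSyn (m.degree f ⊔ m.degree g) :=
  (m.le_degree ha).trans_lt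
    (m.degree_sPolynomial_lt_sup_degree (by rintro h; rw [h] at ha; simp at ha))

theorem self_mem_boundedSpan {B : Set (MvPolynomial τ K)} {b : MvPolynomial τ K} (hb : b ∈ B) :
    b ∈ boundedSpan m B (Set.Iic (m.toSyn (m.degree b))) := by
  have := monomial_mul_mem_boundedSpan (m := m) (S := Set.Iic (m.toSyn (m.degree b)))
    hb (a := 0) (by rw [zero_add]; exact Set.mem_Iic.mpr le_rfl) 1
  rwa [monomial_zero', C_1, one_mul] at this

/-- Buchberger's coprimality criterion. -/
theorem sPolynomial_mem_boundedSpan_of_coprime {B : Set (MvPolynomial τ K)}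
    {f g : MvPolynomial τ K} (hf : f ∈ B) (hg : g ∈ B) (h : m.degree f ⊓ m.degree g = 0) :
    m.sPolynomial f g ∈ boundedSpan m B (Set.Iio (m.toSyn (m.degree f ⊔ m.degree g))) := by
  have hdisj : ∀ i, min (m.degree f i) (m.degree g i) = 0 := fun i => DFunLike.congr_fun h i
  have h1 : m.degree f - m.degree g = m.degree f := by
    ext i; have := hdisj i; rw [Finsupp.tsub_apply]; omega
  have h2 : m.degree g - m.degree f = m.degree g := by
    ext i; have := hdisj i; rw [Finsupp.tsub_apply]; omega
  have hsup : m.degree f ⊔ m.degree g = m.degree f + m.degree g := by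
    ext i
    have := hdisj i
    rw [Finsupp.sup_apply, Finsupp.add_apply]
    omega
  have tail : ∀ p q : MvPolynomial τ K, q ∈ B →
      (p - monomial (m.degree p) (m.leadingCoeff p)) * q ∈
        boundedSpan m B (Set.Iio (m.toSyn (m.degree p + m.degree q))) := by
    classical
    intro p q hq
    rw [(p - monomial (m.degree p) (m.leadingCoeff p)).as_sum, Finset.sum_mul]
    refine sum_mem fun a ha => monomial_mul_mem_boundedSpan hq ?_ _
    have hne : a ≠ m.degree p := by
      rintro rfl
      rw [mem_support_iff, coeff_sub, coeff_monomial, if_pos rfl] at ha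
      exact ha (sub_self _)
    have hap : a ∈ p.support := by
      rw [mem_support_iff, coeff_sub, coeff_monomial, if_neg hne.symm, sub_zero] at ha
      exact mem_support_iff.mpr ha
    rw [Set.mem_Iio, add_comm a, add_comm (m.degree p)]
    exact toSyn_strictMono_add m _
      (lt_of_le_of_ne (m.le_degree hap) (m.toSyn.injective.ne hne))
  -- For coprime leading monomials, `LT(g) f - LT(f) g` equals `(f - LT(f)) g - (g - LT(g)) f`, and
  -- multiplying the tails lowers the leading monomials strictly below the lcm.
  have heq : m.sPolynomial f g =
      (f - monomial (m.degree f) (m.leadingCoeff f)) * g -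
        (g - monomial (m.degree g) (m.leadingCoeff g)) * f := by
    rw [MonomialOrder.sPolynomial, h1, h2]; ring
  rw [heq, hsup]
  refine sub_mem (tail f g hg) ?_
  rw [add_comm]
  exact tail g f hf

/-! ### The truncated Buchberger criterion -/

/-- The order refines the comparison of total degrees. -/
def IsGraded (m : MonomialOrder τ) : Prop :=
  ∀ a b, m.toSyn a ≤ m.toSyn b → a.degree ≤ b.degree

theorem IsGraded.degree_degree (hm : IsGraded m) (f : MvPolynomial τ K) :
    (m.degree f).degree = f.totalDegree := by
  by_cases hf : f = 0
  · rw [hf, m.degree_zero, map_zero, totalDegree_zero]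
  refine le_antisymm (le_totalDegree (m.degree_mem_support hf)) ?_
  exact Finset.sup_le fun a ha => hm _ _ (m.le_degree ha)

/-- Fix one `b` whose leading monomial divides `x^t`. Any other multiple with leading exponent `t`
differs from a scalar multiple of the corresponding multiple of `b` by a monomial times an
S-polynomial, which is represented below `t`. So modulo lower representations only the coefficient
of `x^t` matters. -/
theorem mem_boundedSpan_Iio_of_coeff_eq_zero {B : Set (MvPolynomial τ K)} {t : τ →₀ ℕ}
    (h0 : 0 ∉ B)
    (hB : ∀ f ∈ B, ∀ g ∈ B, f ≠ g → m.degree f ≤ t → m.degree g ≤ t →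
      m.sPolynomial f g ∈ boundedSpan m B (Set.Iio (m.toSyn (m.degree f ⊔ m.degree g))))
    {p : MvPolynomial τ K} (hp : p ∈ boundedSpan m B (Set.Iic (m.toSyn t)))
    (hc : coeff t p = 0) : p ∈ boundedSpan m B (Set.Iio (m.toSyn t)) := by
  classical
  by_cases hex : ∃ b ∈ B, m.degree b ≤ t
  · obtain ⟨b, hb, hbt⟩ := hex
    have hlb : m.leadingCoeff b ≠ 0 :=
      m.leadingCoeff_ne_zero_iff.mpr (fun h => h0 (h ▸ hb))
    suffices H : ∀ p ∈ boundedSpan m B (Set.Iic (m.toSyn t)),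
        p - coeff t p • (monomial (t - m.degree b) (m.leadingCoeff b)⁻¹ * b) ∈
          boundedSpan m B (Set.Iio (m.toSyn t)) by
      have := H p hp
      rwa [hc, zero_smul, sub_zero] at this
    intro p hp
    induction hp using Submodule.span_induction with
    | mem p hp =>
      obtain ⟨f, hf, a, ha, rfl⟩ := hp
      rcases lt_or_eq_of_le (Set.mem_Iic.mp ha) with hlt | heq
      · have : coeff t (monomial a 1 * f) = 0 := by
          by_contra hne
          obtain ⟨v, hv, rfl⟩ := exists_of_mem_support_monomial_mul (mem_support_iff.mpr hne)
          exact absurd hlt (not_lt.mpr (toSyn_mono_add m a (m.le_degree hv)))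
        rw [this, zero_smul, sub_zero]
        exact monomial_mul_mem_boundedSpan hf hlt 1
      · obtain rfl := m.toSyn.injective heq
        have hlf : m.leadingCoeff f ≠ 0 :=
          m.leadingCoeff_ne_zero_iff.mpr (fun h => h0 (h ▸ hf))
        rw [coeff_monomial_mul, one_mul]
        change _ - m.leadingCoeff f • _ ∈ _
        have hft : m.degree f ≤ a + m.degree f := le_add_self
        set t := a + m.degree f with ht
        have hat : a = t - m.degree f := by rw [ht, add_tsub_cancel_right]
        have hsup : m.degree f ⊔ m.degree b ≤ t := sup_le hft hbt
        have e : ∀ u : τ →₀ ℕ, u ≤ m.degree f ⊔ m.degree b →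
            t - (m.degree f ⊔ m.degree b) + (m.degree f ⊔ m.degree b - u) = t - u := by
          intro u hu
          rw [tsub_add_tsub_cancel hsup hu]
        have key : monomial a 1 * f -
            m.leadingCoeff f • (monomial (t - m.degree b) (m.leadingCoeff b)⁻¹ * b) =
            monomial (t - (m.degree f ⊔ m.degree b)) (m.leadingCoeff b)⁻¹ *
              m.sPolynomial f b := by
          rw [m.sPolynomial_def, mul_sub, ← mul_assoc, ← mul_assoc, monomial_mul, monomial_mul,
            e _ le_sup_left, e _ le_sup_right, inv_mul_cancel₀ hlb, ← hat, ← smul_mul_assoc,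
            smul_monomial, smul_eq_mul, mul_comm (m.leadingCoeff f)]
        rw [key]
        -- The assumption concerns pairs of distinct elements only; an S-polynomial of an element
        -- with itself is zero.
        by_cases hfb : f = b
        · rw [hfb, m.sPolynomial_self, mul_zero]; exact zero_mem _
        refine mul_mem_boundedSpan _ _ (fun v hv => ?_) (hB f hf b hb hfb hft hbt)
        have := toSyn_strictMono_add m (t - (m.degree f ⊔ m.degree b)) (Set.mem_Iio.mp hv)
        rwa [tsub_add_cancel_of_le hsup] at this
    | zero => rw [coeff_zero, zero_smul, sub_zero]; exact zero_mem _
    | add p q _ _ hp hq =>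
      rw [coeff_add, add_smul, add_sub_add_comm]
      exact add_mem hp hq
    | smul k p _ hp =>
      rw [coeff_smul, smul_assoc, ← smul_sub]
      exact Submodule.smul_mem _ _ hp
  -- If no leading monomial divides `x^t`, no summand can have leading exponent `t`.
  · refine Submodule.span_mono ?_ hp
    rintro q ⟨f, hf, a, ha, rfl⟩
    refine ⟨f, hf, a, lt_of_le_of_ne ha fun h => hex ⟨f, hf, ?_⟩, rfl⟩
    rw [← m.toSyn.injective h]
    exact le_add_self

/-- Descent on the bound `t` of the representation: if `x^t` cancels, the previous lemma lowers the
bound; if not, `x^t` is the leading monomial of `p`, and some summand must reach it. Only pairs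
whose lcm divides the current `x^t` are used, which is why the criterion can be truncated at `D`. -/
theorem exists_degree_le_of_mem_boundedSpan (hm : IsGraded m) {B : Set (MvPolynomial τ K)}
    {D : ℕ} (h0 : 0 ∉ B)
    (hB : ∀ f ∈ B, ∀ g ∈ B, f ≠ g → pairDegree m f g ≤ D →
      m.sPolynomial f g ∈ boundedSpan m B (Set.Iio (m.toSyn (m.degree f ⊔ m.degree g))))
    (t : τ →₀ ℕ) (htD : t.degree ≤ D) {p : MvPolynomial τ K}
    (hp : p ∈ boundedSpan m B (Set.Iic (m.toSyn t))) (hp0 : p ≠ 0) :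
    ∃ b ∈ B, m.degree b ≤ m.degree p := by
  induction hs : m.toSyn t using WellFoundedLT.induction generalizing t with
  | ind s ih =>
    subst hs
    by_cases hc : coeff t p = 0
    · have hlt := mem_boundedSpan_Iio_of_coeff_eq_zero h0
        (fun f hf g hg hfg hft hgt => hB f hf g hg hfg
          ((Finsupp.degree_mono (sup_le hft hgt)).trans htD)) hp hc
      rcases exists_mem_boundedSpan_Iic hlt with h | ⟨u, hu, hpu⟩
      · exact absurd h hp0
      · exact ih _ hu u ((hm _ _ (le_of_lt hu)).trans htD) hpu rfl
    · have htp : m.degree p = t := by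
        refine m.toSyn.injective (le_antisymm ?_ (m.le_degree (mem_support_iff.mpr hc)))
        exact support_subset_of_mem_boundedSpan (isLowerSet_Iic _) hp _ (m.degree_mem_support hp0)
      by_contra hno
      push Not at hno
      have : p ∈ boundedSpan m B (Set.Iio (m.toSyn t)) := by
        refine Submodule.span_mono ?_ hp
        rintro q ⟨f, hf, a, ha, rfl⟩
        refine ⟨f, hf, a, lt_of_le_of_ne ha fun h => hno f hf ?_, rfl⟩
        rw [htp, ← m.toSyn.injective h]
        exact le_add_self
      exact lt_irrefl _ (support_subset_of_mem_boundedSpan (isLowerSet_Iio _) this t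
        (mem_support_iff.mpr hc))

end BoundedSpan

/-! ### The invariant of Buchberger's procedure -/

section Invariant

variable {τ K : Type*} [Field K] {m : MonomialOrder τ}

/-- Always cancelling the largest reducible monomial makes the largest reducible monomial decrease.
-/
theorem exists_isNormalForm (m : MonomialOrder τ) (B : Set (MvPolynomial τ K))
    (f : MvPolynomial τ K) : ∃ r, IsNormalForm m B f r := by
  classical
  -- The strict bound `s` on the reducible monomials drives the induction; `⊤` imposes no
  -- restriction at the start.
  suffices H : ∀ (s : WithTop m.syn) (f : MvPolynomial τ K),
      (∀ a ∈ f.support, (∃ b ∈ B, b ≠ 0 ∧ m.degree b ≤ a) →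
        ((m.toSyn a : m.syn) : WithTop m.syn) < s) →
      ∃ r, IsNormalForm m B f r from H ⊤ f fun _ _ _ => WithTop.coe_lt_top _
  intro s
  induction s using WellFoundedLT.induction with
  | ind s ih =>
    intro f hf
    by_cases hex : ∃ a ∈ f.support, ∃ b ∈ B, b ≠ 0 ∧ m.degree b ≤ a
    · obtain ⟨a, ha, hmax⟩ := Finset.exists_max_image
        (f.support.filter fun a => ∃ b ∈ B, b ≠ 0 ∧ m.degree b ≤ a) m.toSyn
        (by obtain ⟨a, h1, h2⟩ := hex; exact ⟨a, Finset.mem_filter.mpr ⟨h1, h2⟩⟩)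
      obtain ⟨haf, b, hb, hb0, hba⟩ := Finset.mem_filter.mp ha
      have hlb : m.leadingCoeff b ≠ 0 := m.leadingCoeff_ne_zero_iff.mpr hb0
      have hstep : ReducesTo m B f
          (f - monomial (a - m.degree b) (coeff a f / m.leadingCoeff b) * b) :=
        ⟨b, hb, hb0, a, haf, hba, rfl⟩
      obtain ⟨r, hr⟩ := ih (m.toSyn a) (hf a haf ⟨b, hb, hb0, hba⟩)
        (f - monomial (a - m.degree b) (coeff a f / m.leadingCoeff b) * b) (by
          intro c hc hred
          rw [WithTop.coe_lt_coe]
          refine lt_of_le_of_ne ?_ ?_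
          · rcases Finset.mem_union.mp (support_sub τ _ _ hc) with h | h
            · exact hmax c (Finset.mem_filter.mpr ⟨h, hred⟩)
            · obtain ⟨v, hv, rfl⟩ := exists_of_mem_support_monomial_mul h
              have := toSyn_mono_add m (a - m.degree b) (m.le_degree hv)
              rwa [tsub_add_cancel_of_le hba] at this
          · intro h
            obtain rfl := m.toSyn.injective h
            rw [mem_support_iff, coeff_sub] at hc
            nth_rewrite 2 [← tsub_add_cancel_of_le hba] at hc
            rw [coeff_monomial_mul] at hc
            exact hc (by rw [← MonomialOrder.leadingCoeff, div_mul_cancel₀ _ hlb, sub_self]))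
      exact ⟨r, hr.1.head hstep, hr.2⟩
    · exact ⟨f, .refl, fun a ha b hb hb0 hle => hex ⟨a, ha, b, hb, hb0, hle⟩⟩

/-- The S-polynomial of `f` and `g` has a representation below the lcm of the leading monomials. -/
def IsResolved (m : MonomialOrder τ) (B : Set (MvPolynomial τ K)) (f g : MvPolynomial τ K) : Prop :=
  m.sPolynomial f g ∈ boundedSpan m B (Set.Iio (m.toSyn (m.degree f ⊔ m.degree g)))

theorem IsResolved.symm {B : Set (MvPolynomial τ K)} {f g : MvPolynomial τ K}
    (h : IsResolved m B f g) : IsResolved m B g f := by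
  rw [IsResolved, m.sPolynomial_antisymm, sup_comm]
  exact neg_mem h

theorem IsResolved.of_sym2_eq {B : Set (MvPolynomial τ K)} {f g f' g' : MvPolynomial τ K}
    (h : IsResolved m B f g) (e : s(f', g') = s(f, g)) : IsResolved m B f' g' := by
  rcases Sym2.eq_iff.mp e with ⟨rfl, rfl⟩ | ⟨rfl, rfl⟩
  exacts [h, h.symm]

theorem IsResolved.of_forall_mem {B B' : Set (MvPolynomial τ K)} {f g : MvPolynomial τ K}
    (h : IsResolved m B f g)
    (hB : ∀ b ∈ B, b ∈ boundedSpan m B' (Set.Iic (m.toSyn (m.degree b)))) : IsResolved m B' f g :=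
  boundedSpan_le_of_forall_mem (isLowerSet_Iio _) hB h

theorem IsNormalForm.isResolved {B : Set (MvPolynomial τ K)} {f g r : MvPolynomial τ K}
    (h : IsNormalForm m B (m.sPolynomial f g) r) :
    m.sPolynomial f g - r ∈ boundedSpan m B (Set.Iio (m.toSyn (m.degree f ⊔ m.degree g))) ∧
      ∀ a ∈ r.support, m.toSyn a < m.toSyn (m.degree f ⊔ m.degree g) :=
  h.bounded (isLowerSet_Iio _) fun _ ha => toSyn_lt_of_mem_support_sPolynomial ha

theorem IsNormalForm.sub_mem_span {B : Set (MvPolynomial τ K)} {f r : MvPolynomial τ K}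
    (h : IsNormalForm m B f r) : f - r ∈ Ideal.span B :=
  boundedSpan_le_span B Set.univ
    (h.bounded isLowerSet_univ fun _ _ => Set.mem_univ _).1

theorem sPolynomial_mem {I : Ideal (MvPolynomial τ K)} {f g : MvPolynomial τ K} (hf : f ∈ I)
    (hg : g ∈ I) : m.sPolynomial f g ∈ I :=
  I.sub_mem (I.mul_mem_left _ hf) (I.mul_mem_left _ hg)

/-- What every state of Buchberger's procedure on input `F` satisfies. -/
structure BState.Invariant (m : MonomialOrder τ) (F : Set (MvPolynomial τ K))
    (s : BState τ K) : Prop where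
  zero_notMem : 0 ∉ s.basis
  of_mem_pairs : ∀ f g, s(f, g) ∈ s.pairs → f ∈ s.basis ∧ g ∈ s.basis ∧ f ≠ g
  resolved : ∀ f ∈ s.basis, ∀ g ∈ s.basis, f ≠ g → s(f, g) ∈ s.pairs ∨ IsResolved m s.basis f g
  input_mem : ∀ f ∈ F, f ∈ boundedSpan m s.basis (Set.Iic (m.toSyn (m.degree f)))
  subset_span : s.basis ⊆ Ideal.span F

theorem BState.invariant_init {F : Set (MvPolynomial τ K)} (h0 : 0 ∉ F) :
    (BState.init F).Invariant m F where
  zero_notMem := h0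
  of_mem_pairs f g h := by
    obtain ⟨f', hf', g', hg', hne, e⟩ := h
    rcases Sym2.eq_iff.mp e with ⟨rfl, rfl⟩ | ⟨rfl, rfl⟩
    exacts [⟨hf', hg', hne⟩, ⟨hg', hf', hne.symm⟩]
  resolved f hf g hg hne := Or.inl ⟨f, hf, g, hg, hne, rfl⟩
  input_mem f hf := self_mem_boundedSpan hf
  subset_span := Ideal.subset_span

theorem BState.Invariant.remove {F : Set (MvPolynomial τ K)} {s : BState τ K}
    (h : s.Invariant m F) {f g : MvPolynomial τ K} (hfg : IsResolved m s.basis f g) :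
    BState.Invariant m F ⟨s.basis, s.pairs \ {s(f, g)}⟩ where
  zero_notMem := h.zero_notMem
  of_mem_pairs f' g' h' := h.of_mem_pairs f' g' h'.1
  resolved f' hf' g' hg' hne := by
    by_cases e : s(f', g') = s(f, g)
    · exact Or.inr (hfg.of_sym2_eq e)
    · exact (h.resolved f' hf' g' hg' hne).imp_left fun h => ⟨h, e⟩
  input_mem := h.input_mem
  subset_span := h.subset_span

theorem BState.Invariant.insert {F : Set (MvPolynomial τ K)} {s : BState τ K}
    (h : s.Invariant m F) {f g r : MvPolynomial τ K} (hf : f ∈ s.basis) (hg : g ∈ s.basis)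
    (hr : r ≠ 0) (hnf : IsNormalForm m s.basis (m.sPolynomial f g) r) :
    BState.Invariant m F ⟨insert r s.basis,
      s.pairs \ {s(f, g)} ∪ (fun h => s(h, r)) '' s.basis⟩ where
  zero_notMem h' := h'.elim (fun e => hr e.symm) h.zero_notMem
  of_mem_pairs f' g' h' := by
    rcases h' with h' | ⟨b, hb, e⟩
    · obtain ⟨h1, h2, h3⟩ := h.of_mem_pairs f' g' h'.1
      exact ⟨Or.inr h1, Or.inr h2, h3⟩
    · have hbr : b ≠ r := fun e => hnf.notMem hr (e ▸ hb)
      rcases Sym2.eq_iff.mp e with ⟨rfl, rfl⟩ | ⟨rfl, rfl⟩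
      exacts [⟨Or.inr hb, Or.inl rfl, hbr⟩, ⟨Or.inl rfl, Or.inr hb, hbr.symm⟩]
  resolved f' hf' g' hg' hne := by
    rcases hf' with rfl | hf' <;> rcases hg' with rfl | hg'
    · exact absurd rfl hne
    · exact Or.inl (Or.inr ⟨g', hg', Sym2.eq_swap⟩)
    · exact Or.inl (Or.inr ⟨f', hf', rfl⟩)
    by_cases e : s(f', g') = s(f, g)
    · refine Or.inr (IsResolved.of_sym2_eq ?_ e)
      obtain ⟨h1, h2⟩ := hnf.isResolved
      have h3 := monomial_mul_mem_boundedSpan (m := m)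
        (S := Set.Iio (m.toSyn (m.degree f ⊔ m.degree g))) (Set.mem_insert r s.basis) (a := 0)
        (by rw [zero_add]; exact h2 _ (m.degree_mem_support hr)) 1
      rw [monomial_zero', C_1, one_mul] at h3
      have := add_mem (boundedSpan_mono (Set.subset_insert r s.basis) le_rfl h1) h3
      rwa [sub_add_cancel] at this
    · exact (h.resolved f' hf' g' hg' hne).imp (fun h => Or.inl ⟨h, e⟩)
        (boundedSpan_mono (Set.subset_insert _ _) le_rfl ·)
  input_mem f hf := boundedSpan_mono (Set.subset_insert _ _) le_rfl (h.input_mem f hf)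
  subset_span := by
    refine Set.insert_subset ?_ h.subset_span
    have h1 := Ideal.span_le.mpr h.subset_span hnf.sub_mem_span
    have h2 := (Ideal.span F).sub_mem
      (sPolynomial_mem (m := m) (h.subset_span hf) (h.subset_span hg)) h1
    rwa [sub_sub_cancel] at h2

theorem BState.Invariant.interreduce {F : Set (MvPolynomial τ K)} {s : BState τ K}
    (h : s.Invariant m F) {f r : MvPolynomial τ K} (hf : f ∈ s.basis)
    (hnf : IsNormalForm m (s.basis \ {f}) f r) :
    (s.apply (.interreduce f r)).Invariant m F := by
  -- The replaced element is represented by its normal form and the other elements without exceeding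
  -- its own leading monomial, so every old representation survives.
  have hspan : ∀ b ∈ s.basis, b ∈ boundedSpan m (s.apply (.interreduce f r)).basis
      (Set.Iic (m.toSyn (m.degree b))) := by
    intro b hb
    by_cases hbf : b = f
    · subst hbf
      by_cases hr : r = 0
      · have := (hnf.bounded (isLowerSet_Iic _) fun a ha => m.le_degree ha).1
        simp only [BState.apply, if_pos hr]
        rwa [hr, sub_zero] at this
      · simp only [BState.apply, if_neg hr]
        exact hnf.mem_boundedSpan
    · refine self_mem_boundedSpan ?_
      simp only [BState.apply]
      split_ifs
      exacts [⟨hb, hbf⟩, Or.inr ⟨hb, hbf⟩]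
  have hinput : ∀ p ∈ F, p ∈ boundedSpan m (s.apply (.interreduce f r)).basis
      (Set.Iic (m.toSyn (m.degree p))) := fun p hp =>
    boundedSpan_le_of_forall_mem (isLowerSet_Iic _) hspan (h.input_mem p hp)
  have hold : ∀ f' ∈ s.basis \ {f}, ∀ g' ∈ s.basis \ {f}, f' ≠ g' →
      s(f', g') ∈ {p ∈ s.pairs | f ∉ p} ∨
        IsResolved m (s.apply (.interreduce f r)).basis f' g' := by
    intro f' hf' g' hg' hne
    refine (h.resolved f' hf'.1 g' hg'.1 hne).imp (fun h' => ⟨h', fun hmem => ?_⟩)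
      (fun h' => h'.of_forall_mem hspan)
    rcases Sym2.mem_iff.mp hmem with rfl | rfl
    exacts [hf'.2 rfl, hg'.2 rfl]
  have hpairs : ∀ f' g', s(f', g') ∈ {p ∈ s.pairs | f ∉ p} →
      f' ∈ s.basis \ {f} ∧ g' ∈ s.basis \ {f} ∧ f' ≠ g' := by
    intro f' g' h'
    obtain ⟨h1, h2, h3⟩ := h.of_mem_pairs f' g' h'.1
    refine ⟨⟨h1, ?_⟩, ⟨h2, ?_⟩, h3⟩
    · rintro rfl; exact h'.2 (Sym2.mem_mk_left _ _)
    · rintro rfl; exact h'.2 (Sym2.mem_mk_right _ _)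
  have hsub : s.basis \ {f} ⊆ Ideal.span F := fun b hb => h.subset_span hb.1
  by_cases hr : r = 0
  · simp only [BState.apply, if_pos hr] at hinput hold ⊢
    exact ⟨fun h' => h.zero_notMem h'.1, hpairs, hold, hinput, hsub⟩
  · simp only [BState.apply, if_neg hr] at hinput hold ⊢
    refine ⟨fun h' => h'.elim (fun e => hr e.symm) fun h' => h.zero_notMem h'.1, ?_, ?_, hinput,
      Set.insert_subset ?_ hsub⟩
    · rintro f' g' (h' | ⟨b, hb, e⟩)
      · obtain ⟨h1, h2, h3⟩ := hpairs f' g' h'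
        exact ⟨Or.inr h1, Or.inr h2, h3⟩
      · have hbr : b ≠ r := fun e => hnf.notMem hr (e ▸ hb)
        rcases Sym2.eq_iff.mp e with ⟨rfl, rfl⟩ | ⟨rfl, rfl⟩
        exacts [⟨Or.inr hb, Or.inl rfl, hbr⟩, ⟨Or.inl rfl, Or.inr hb, hbr.symm⟩]
    · intro f' hf' g' hg' hne
      rcases hf' with rfl | hf' <;> rcases hg' with rfl | hg'
      · exact absurd rfl hne
      · exact Or.inl (Or.inr ⟨g', hg', Sym2.eq_swap⟩)
      · exact Or.inl (Or.inr ⟨f', hf', rfl⟩)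
      · exact (hold f' hf' g' hg' hne).imp_left Or.inl
    · have h1 := Ideal.span_le.mpr hsub hnf.sub_mem_span
      have h2 := (Ideal.span F).sub_mem (h.subset_span hf) h1
      rwa [sub_sub_cancel] at h2

theorem BState.Invariant.apply {F : Set (MvPolynomial τ K)} {s : BState τ K}
    (h : s.Invariant m F) {a : BAction τ K} (ha : s.Legal m a) : (s.apply a).Invariant m F := by
  cases a with
  | discard f g =>
    obtain ⟨hf, hg, -⟩ := h.of_mem_pairs f g ha.1
    exact h.remove (sPolynomial_mem_boundedSpan_of_coprime hf hg ha.2)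
  | spair f g r =>
    obtain ⟨hp, -, hnf⟩ := ha
    obtain ⟨hf, hg, -⟩ := h.of_mem_pairs f g hp
    by_cases hr : r = 0
    · simp only [BState.apply, if_pos hr]
      refine h.remove ?_
      have := hnf.isResolved.1
      rwa [hr, sub_zero] at this
    · simp only [BState.apply, if_neg hr]
      exact h.insert hf hg hr hnf
  | interreduce f r => exact h.interreduce ha.1 ha.2

theorem BState.Invariant.finalState {F : Set (MvPolynomial τ K)} {l : List (BAction τ K)} :
    ∀ {s : BState τ K}, s.Invariant m F → IsRun m s l → (finalState s l).Invariant m F := by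
  induction l with
  | nil => exact fun h _ => h
  | cons a l ih => exact fun h hl => ih (h.apply hl.1) hl.2

theorem isRun_append {l₁ l₂ : List (BAction τ K)} : ∀ {s : BState τ K},
    IsRun m s (l₁ ++ l₂) ↔ IsRun m s l₁ ∧ IsRun m (finalState s l₁) l₂ := by
  induction l₁ with
  | nil => exact fun {s} => (iff_of_eq (true_and _)).symm
  | cons a l ih =>
    intro s
    exact (and_congr_right fun _ => ih).trans and_assoc.symm

/-- When no pair of degree at most `D` is pending, the basis is a Gröbner basis up to degree `D`. -/
theorem BState.Invariant.exists_degree_le (hm : IsGraded m) {F : Set (MvPolynomial τ K)}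
    {s : BState τ K} (h : s.Invariant m F) {D : ℕ}
    (hD : ∀ f g, s(f, g) ∈ s.pairs → D < pairDegree m f g) {p : MvPolynomial τ K}
    (hp : p ∈ boundedSpan m F {t | (m.toSyn.symm t).degree ≤ D}) (hp0 : p ≠ 0) :
    ∃ b ∈ s.basis, m.degree b ≤ m.degree p := by
  rcases exists_mem_boundedSpan_Iic hp with h0 | ⟨t, ht, hpt⟩
  · exact absurd h0 hp0
  · rw [Set.mem_ofPred_eq, AddEquiv.symm_apply_apply] at ht
    refine exists_degree_le_of_mem_boundedSpan hm h.zero_notMem (fun f hf g hg hne hd => ?_) t ht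
      (boundedSpan_le_of_forall_mem (isLowerSet_Iic _) h.input_mem hpt) hp0
    exact (h.resolved f hf g hg hne).resolve_left fun h' => absurd hd (not_le.mpr (hD f g h'))

theorem BState.Invariant.isGroebnerBasis (hm : IsGraded m) {F : Set (MvPolynomial τ K)}
    {s : BState τ K} (h : s.Invariant m F) (hs : s.pairs = ∅) :
    IsGroebnerBasis m s.basis (Ideal.span F) := by
  refine ⟨h.subset_span, fun p hp hp0 => ?_⟩
  rcases exists_mem_boundedSpan_Iic (mem_boundedSpan_univ_of_mem_span (m := m) hp) with
    h0 | ⟨t, -, hpt⟩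
  · exact absurd h0 hp0
  -- With no pair pending, the truncated criterion applies at every degree; the degree of the bound
  -- `t` of a representation of `p` is large enough.
  · obtain ⟨b, hb, hle⟩ := h.exists_degree_le hm (D := t.degree)
      (by rw [hs]; exact fun f g h => absurd h (Set.notMem_empty _))
      (boundedSpan_mono le_rfl (fun v hv => by
        have := hm (m.toSyn.symm v) t (by rwa [AddEquiv.apply_symm_apply])
        exact this) hpt) hp0
    exact ⟨b, hb, fun e => h.zero_notMem (e ▸ hb), hle⟩

end Invariant

/-! ### An inter-reducing Buchberger algorithm: termination and solving degree -/

section Algorithm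

variable {τ K : Type*} [Field K] {m : MonomialOrder τ}

/-- No monomial of `f` is divisible by the leading monomial of another element of `B`. -/
def IsReducedIn (m : MonomialOrder τ) (B : Set (MvPolynomial τ K)) (f : MvPolynomial τ K) : Prop :=
  ∀ a ∈ f.support, ∀ b ∈ B \ {f}, b ≠ 0 → ¬ m.degree b ≤ a

/-- Inter-reductions come first, then the coprimality criterion, then the S-polynomials. -/
def BState.Preferred (m : MonomialOrder τ) (s : BState τ K) : BAction τ K → Prop
  | .interreduce f _ => ¬ IsReducedIn m s.basis f
  | .discard _ _ => True
  | .spair _ _ _ => (∀ f ∈ s.basis, IsReducedIn m s.basis f) ∧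
      ∀ f g, s(f, g) ∈ s.pairs → m.degree f ⊓ m.degree g ≠ 0

theorem BState.exists_legal_preferred (m : MonomialOrder τ) (s : BState τ K) (hs : s.pairs ≠ ∅) :
    ∃ a, s.Legal m a ∧ s.Preferred m a := by
  by_cases h1 : ∀ f ∈ s.basis, IsReducedIn m s.basis f
  · by_cases h2 : ∀ f g, s(f, g) ∈ s.pairs → m.degree f ⊓ m.degree g ≠ 0
    · have hne : ∃ d f g, s(f, g) ∈ s.pairs ∧ pairDegree m f g = d := by
        obtain ⟨p, hp⟩ := Set.nonempty_iff_ne_empty.mpr hs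
        induction p using Sym2.ind with
        | _ f g => exact ⟨_, f, g, hp, rfl⟩
      classical
      obtain ⟨f, g, hfg, hd⟩ := Nat.find_spec hne
      obtain ⟨r, hr⟩ := exists_isNormalForm m s.basis (m.sPolynomial f g)
      refine ⟨.spair f g r, ⟨hfg, fun f' g' h' => ?_, hr⟩, h1, h2⟩
      rw [hd]
      exact Nat.find_min' hne ⟨f', g', h', rfl⟩
    · push Not at h2
      obtain ⟨f, g, h, h'⟩ := h2
      exact ⟨.discard f g, ⟨h, h'⟩, trivial⟩
  · push Not at h1
    obtain ⟨f, hf, h⟩ := h1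
    obtain ⟨r, hr⟩ := exists_isNormalForm m (s.basis \ {f}) f
    exact ⟨.interreduce f r, ⟨hf, hr⟩, h⟩

variable (K) in
open Classical in
/-- Buchberger's algorithm with inter-reduction whenever possible. -/
def interreducingProcedure (m : MonomialOrder τ) : BuchbergerProcedure K m where
  next s := if h : s.pairs = ∅ then none else some (s.exists_legal_preferred m h).choose
  legal s a h := by
    split_ifs at h with h'
    cases h
    exact (s.exists_legal_preferred m h').choose_spec.1
  halt s h := by
    by_contra h'
    rw [dif_neg h'] at h
    cases h

theorem interreducingProcedure_preferred {s : BState τ K} {a : BAction τ K}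
    (h : (interreducingProcedure K m).next s = some a) : s.Preferred m a := by
  simp only [interreducingProcedure] at h
  split_ifs at h with h'
  cases h
  exact (s.exists_legal_preferred m h').choose_spec.2

theorem BuchbergerProcedure.state_succ_of_next (A : BuchbergerProcedure K m)
    {F : Set (MvPolynomial τ K)} {k : ℕ} {a : BAction τ K} (h : A.next (A.state F k) = some a) :
    A.state F (k + 1) = (A.state F k).apply a := by
  simp only [BuchbergerProcedure.state, h, Option.elim]

/-- A property of states that holds initially and is preserved holds at all times. -/
theorem BuchbergerProcedure.state_induction (A : BuchbergerProcedure K m)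
    {F : Set (MvPolynomial τ K)} {P : BState τ K → Prop} (h0 : P (BState.init F))
    (h : ∀ s a, P s → A.next s = some a → P (s.apply a)) (k : ℕ) : P (A.state F k) := by
  induction k with
  | zero => exact h0
  | succ k ih =>
    cases e : A.next (A.state F k) with
    | none => simpa only [BuchbergerProcedure.state, e, Option.elim] using ih
    | some a => rw [A.state_succ_of_next e]; exact h _ a ih e

/-! ### Termination -/

/-- The ideal generated by the leading monomials of `B`. -/
def leadIdeal (m : MonomialOrder τ) (B : Set (MvPolynomial τ K)) : Ideal (MvPolynomial τ K) :=
  Ideal.span ((fun a => monomial a (1 : K)) '' (m.degree '' B))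

theorem monomial_mem_leadIdeal {B : Set (MvPolynomial τ K)} {a : τ →₀ ℕ} :
    monomial a 1 ∈ leadIdeal m B ↔ ∃ b ∈ B, m.degree b ≤ a := by
  classical
  rw [leadIdeal, mem_ideal_span_monomial_image]
  simp [support_monomial]

theorem leadIdeal_le {B B' : Set (MvPolynomial τ K)}
    (h : ∀ b ∈ B, ∃ b' ∈ B', m.degree b' ≤ m.degree b) : leadIdeal m B ≤ leadIdeal m B' := by
  refine Ideal.span_le.mpr ?_
  rintro _ ⟨_, ⟨b, hb, rfl⟩, rfl⟩
  exact monomial_mem_leadIdeal.mpr (h b hb)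

theorem leadIdeal_lt {B B' : Set (MvPolynomial τ K)}
    (h : ∀ b ∈ B, ∃ b' ∈ B', m.degree b' ≤ m.degree b) {r : MvPolynomial τ K} (hr : r ∈ B')
    (hB : ∀ b ∈ B, ¬ m.degree b ≤ m.degree r) : leadIdeal m B < leadIdeal m B' := by
  refine lt_of_le_of_ne (leadIdeal_le h) fun e => ?_
  have h1 : monomial (m.degree r) 1 ∈ leadIdeal m B' :=
    monomial_mem_leadIdeal.mpr ⟨r, hr, le_rfl⟩
  rw [← e] at h1
  obtain ⟨b, hb, hle⟩ := monomial_mem_leadIdeal.mp h1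
  exact hB b hb hle

/-- The quantity that decreases in each step of the algorithm. -/
def BState.measure (m : MonomialOrder τ) (s : BState τ K) :
    (Ideal (MvPolynomial τ K))ᵒᵈ ×ₗ ℕ ×ₗ ℕ ×ₗ ℕ :=
  toLex (OrderDual.toDual (leadIdeal m s.basis), toLex (s.basis.ncard,
    toLex ({f ∈ s.basis | ¬ IsReducedIn m s.basis f}.ncard, s.pairs.ncard)))

theorem BState.measure_lt_of_leadIdeal {s s' : BState τ K}
    (h : leadIdeal m s.basis < leadIdeal m s'.basis) : s'.measure m < s.measure m :=
  Prod.Lex.toLex_lt_toLex.mpr (Or.inl h)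

theorem BState.measure_lt_of_ncard {s s' : BState τ K}
    (h : leadIdeal m s.basis ≤ leadIdeal m s'.basis) (h' : s'.basis.ncard < s.basis.ncard) :
    s'.measure m < s.measure m :=
  Prod.Lex.toLex_lt_toLex'.mpr ⟨h, fun _ => Prod.Lex.toLex_lt_toLex.mpr (Or.inl h')⟩

theorem BState.measure_lt_of_reduced {s s' : BState τ K}
    (h : leadIdeal m s.basis ≤ leadIdeal m s'.basis) (h' : s'.basis.ncard ≤ s.basis.ncard)
    (hr : {f ∈ s'.basis | ¬ IsReducedIn m s'.basis f}.ncard <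
      {f ∈ s.basis | ¬ IsReducedIn m s.basis f}.ncard) :
    s'.measure m < s.measure m :=
  Prod.Lex.toLex_lt_toLex'.mpr ⟨h, fun _ => Prod.Lex.toLex_lt_toLex'.mpr
    ⟨h', fun _ => Prod.Lex.toLex_lt_toLex.mpr (Or.inl hr)⟩⟩

theorem BState.measure_lt_of_pairs {B : Set (MvPolynomial τ K)}
    {P P' : Set (Sym2 (MvPolynomial τ K))} (h : P'.ncard < P.ncard) :
    BState.measure m ⟨B, P'⟩ < BState.measure m ⟨B, P⟩ :=
  Prod.Lex.toLex_lt_toLex'.mpr ⟨le_rfl, fun _ => Prod.Lex.toLex_lt_toLex'.mpr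
    ⟨le_rfl, fun _ => Prod.Lex.toLex_lt_toLex'.mpr ⟨le_rfl, fun _ => h⟩⟩⟩

/-- If no leading monomial of `B` divides that of `f`, every cancelled multiple lies strictly below
it, so the leading term survives the reduction. -/
theorem IsNormalForm.degree_eq {B : Set (MvPolynomial τ K)} {f r : MvPolynomial τ K}
    (h : IsNormalForm m B f r) (hf : f ≠ 0) (hB : ∀ b ∈ B, ¬ m.degree b ≤ m.degree f) :
    r ≠ 0 ∧ m.degree r = m.degree f := by
  have h1 := (h.bounded (isLowerSet_Iic (m.toSyn (m.degree f))) fun a ha => m.le_degree ha).1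
  have h2 : f - r ∈ boundedSpan m B (Set.Iio (m.toSyn (m.degree f))) := by
    refine Submodule.span_mono ?_ h1
    rintro q ⟨b, hb, a, ha, rfl⟩
    refine ⟨b, hb, a, lt_of_le_of_ne ha fun e => hB b hb ?_, rfl⟩
    rw [← m.toSyn.injective e]
    exact le_add_self
  have h3 : coeff (m.degree f) (f - r) = 0 := by
    by_contra hne
    exact lt_irrefl _
      (support_subset_of_mem_boundedSpan (isLowerSet_Iio _) h2 _ (mem_support_iff.mpr hne))
  rw [coeff_sub, sub_eq_zero] at h3
  have h4 : coeff (m.degree f) r ≠ 0 := h3 ▸ mem_support_iff.mp (m.degree_mem_support hf)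
  refine ⟨fun e => h4 (by rw [e, coeff_zero]), m.toSyn.injective ?_⟩
  exact le_antisymm h.toSyn_degree_le (m.le_degree (mem_support_iff.mpr h4))

/-- Suppose another leading monomial divides that of `f`. Then `f` is superfluous for the leading
ideal: either it disappears, or a nonzero normal form contributes a new leading monomial. Otherwise
the leading monomial is kept, and the number of elements that are not reduced drops. -/
theorem BState.measure_interreduce_lt {s : BState τ K} (hfin : s.basis.Finite) (h0 : 0 ∉ s.basis)
    {f r : MvPolynomial τ K} (hf : f ∈ s.basis) (hnf : IsNormalForm m (s.basis \ {f}) f r)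
    (hred : ¬ IsReducedIn m s.basis f) :
    (s.apply (.interreduce f r)).measure m < s.measure m := by
  have hne0 : ∀ b ∈ s.basis, b ≠ 0 := fun b hb e => h0 (e ▸ hb)
  by_cases hex : ∃ b ∈ s.basis \ {f}, m.degree b ≤ m.degree f
  · obtain ⟨b, hb, hbf⟩ := hex
    have hdom : ∀ c ∈ s.basis, ∃ b' ∈ s.basis \ {f}, m.degree b' ≤ m.degree c := by
      intro c hc
      by_cases e : c = f
      · exact ⟨b, hb, e ▸ hbf⟩
      · exact ⟨c, ⟨hc, e⟩, le_rfl⟩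
    by_cases hr : r = 0
    · refine measure_lt_of_ncard ?_ ?_ <;> simp only [BState.apply, if_pos hr]
      · exact leadIdeal_le hdom
      · exact Set.ncard_sdiff_singleton_lt_of_mem hf hfin
    · refine measure_lt_of_leadIdeal ?_
      simp only [BState.apply, if_neg hr]
      refine leadIdeal_lt (fun c hc => ?_) (Set.mem_insert r _) fun c hc hle => ?_
      · obtain ⟨b', hb', hle⟩ := hdom c hc
        exact ⟨b', Or.inr hb', hle⟩
      · obtain ⟨b', hb', hle'⟩ := hdom c hc
        exact hnf.not_degree_le hr hb' (hne0 b' hb'.1) (hle'.trans hle)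
  · push Not at hex
    obtain ⟨hr, hdeg⟩ := hnf.degree_eq (hne0 f hf) hex
    have hrB : r ∉ s.basis \ {f} := hnf.notMem hr
    have hcard : (insert r (s.basis \ {f})).ncard = s.basis.ncard := by
      rw [Set.ncard_insert_of_notMem hrB hfin.sdiff, Set.ncard_sdiff_singleton_add_one hf hfin]
    refine measure_lt_of_reduced ?_ ?_ ?_ <;> simp only [BState.apply, if_neg hr]
    · refine leadIdeal_le fun c hc => ?_
      by_cases e : c = f
      · exact ⟨r, Or.inl rfl, by rw [hdeg, e]⟩
      · exact ⟨c, Or.inr ⟨hc, e⟩, le_rfl⟩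
    · exact hcard.le
    · refine Set.ncard_lt_ncard ⟨?_, fun h => ?_⟩ (hfin.subset (Set.sep_subset _ _))
      -- Reducedness of the other elements depends only on the leading monomials of the basis, which
      -- have not changed; the new element is reduced.
      · rintro g ⟨hg, hgred⟩
        rcases hg with rfl | hg
        · exact absurd (fun a ha b hb hb0 => hnf.2 a ha b (hb.1.resolve_left hb.2) hb0) hgred
        · refine ⟨hg.1, fun hgred' => hgred fun a ha b hb hb0 hle => ?_⟩
          rcases hb.1 with rfl | hb'
          · exact hgred' a ha f ⟨hf, fun e => hg.2 e.symm⟩ (hne0 f hf) (hdeg ▸ hle)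
          · exact hgred' a ha b ⟨hb'.1, hb.2⟩ hb0 hle
      -- Strictness comes from `f`, which was counted before: now it has either left the basis or
      -- equals its normal form and is reduced.
      · obtain ⟨hf', hfred⟩ := h ⟨hf, hred⟩
        rcases hf' with rfl | hf'
        · exact hred hnf.2
        · exact hf'.2 rfl

/-- A nonzero normal form of an S-polynomial enlarges the leading ideal, and a pair that is dropped
or reduces to zero only shrinks the set of pending pairs. New pairs arise only together with a
decrease in an earlier component of the measure. -/
theorem BState.measure_apply_lt {F : Set (MvPolynomial τ K)} {s : BState τ K}
    (hinv : s.Invariant m F) (hB : s.basis.Finite) (hP : s.pairs.Finite) {a : BAction τ K}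
    (ha : s.Legal m a) (hpref : s.Preferred m a) : (s.apply a).measure m < s.measure m := by
  have hne0 : ∀ b ∈ s.basis, b ≠ 0 := fun b hb e => hinv.zero_notMem (e ▸ hb)
  cases a with
  | discard f g => exact measure_lt_of_pairs (Set.ncard_sdiff_singleton_lt_of_mem ha.1 hP)
  | spair f g r =>
    obtain ⟨hp, -, hnf⟩ := ha
    by_cases hr : r = 0
    · simp only [BState.apply, if_pos hr]
      exact measure_lt_of_pairs (Set.ncard_sdiff_singleton_lt_of_mem hp hP)
    · refine measure_lt_of_leadIdeal ?_
      simp only [BState.apply, if_neg hr]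
      exact leadIdeal_lt (fun c hc => ⟨c, Or.inr hc, le_rfl⟩) (Set.mem_insert r _)
        fun c hc => hnf.not_degree_le hr hc (hne0 c hc)
  | interreduce f r => exact measure_interreduce_lt hB hinv.zero_notMem ha.1 ha.2 hpref

theorem BState.finite_init {F : Set (MvPolynomial τ K)} (hF : F.Finite) :
    (BState.init F).basis.Finite ∧ (BState.init F).pairs.Finite := by
  refine ⟨hF, ((hF.prod hF).image fun p => s(p.1, p.2)).subset ?_⟩
  rintro _ ⟨f, hf, g, hg, -, rfl⟩
  exact ⟨(f, g), ⟨hf, hg⟩, rfl⟩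

theorem BState.finite_apply {s : BState τ K} (h : s.basis.Finite ∧ s.pairs.Finite)
    (a : BAction τ K) : (s.apply a).basis.Finite ∧ (s.apply a).pairs.Finite := by
  obtain ⟨hB, hP⟩ := h
  cases a with
  | discard f g => exact ⟨hB, hP.sdiff⟩
  | spair f g r =>
    simp only [BState.apply]
    split_ifs
    exacts [⟨hB, hP.sdiff⟩, ⟨hB.insert r, hP.sdiff.union (hB.image _)⟩]
  | interreduce f r =>
    simp only [BState.apply]
    split_ifs
    exacts [⟨hB.sdiff, hP.subset (Set.sep_subset _ _)⟩,
      ⟨hB.sdiff.insert r, (hP.subset (Set.sep_subset _ _)).union (hB.sdiff.image _)⟩]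

theorem BuchbergerProcedure.invariant_state (A : BuchbergerProcedure K m)
    {F : Set (MvPolynomial τ K)} (h0 : 0 ∉ F) (k : ℕ) : (A.state F k).Invariant m F :=
  A.state_induction (P := fun s => s.Invariant m F) (BState.invariant_init h0)
    (fun s a hs ha => hs.apply (A.legal s a ha)) k

theorem interreducingProcedure_computesGroebnerBases [Finite τ] (hm : IsGraded m) :
    (interreducingProcedure K m).ComputesGroebnerBases := by
  intro F hF h0
  have hinv := (interreducingProcedure K m).invariant_state h0
  have hfin := (interreducingProcedure K m).state_induction
    (P := fun s => s.basis.Finite ∧ s.pairs.Finite) (BState.finite_init hF)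
    (fun s a hs _ => BState.finite_apply hs a)
  by_contra hno
  push Not at hno
  have hnext : ∀ k, (interreducingProcedure K m).next
      ((interreducingProcedure K m).state F k) ≠ none := fun k hk =>
    hno k hk ((hinv k).isGroebnerBasis hm ((interreducingProcedure K m).halt _ hk))
  have hdec : ∀ k, ((interreducingProcedure K m).state F (k + 1)).measure m <
      ((interreducingProcedure K m).state F k).measure m := by
    intro k
    obtain ⟨a, ha⟩ := Option.ne_none_iff_exists'.mp (hnext k)
    rw [BuchbergerProcedure.state_succ_of_next _ ha]
    exact BState.measure_apply_lt (hinv k) (hfin k).1 (hfin k).2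
      ((interreducingProcedure K m).legal _ a ha) (interreducingProcedure_preferred ha)
  -- The component of ideals, ordered by reverse inclusion, is well-founded because the polynomial
  -- ring in finitely many variables is Noetherian.
  have hwf : WellFounded ((· < ·) : (Ideal (MvPolynomial τ K))ᵒᵈ ×ₗ ℕ ×ₗ ℕ ×ₗ ℕ → _ → Prop) :=
    wellFounded_lt
  rw [wellFounded_iff_isEmpty_descending_chain] at hwf
  exact hwf.elim ⟨fun k => ((interreducingProcedure K m).state F k).measure m, hdec⟩

/-! ### Solving degrees -/

theorem degree_sup_add_degree_inf (a b : τ →₀ ℕ) :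
    (a ⊔ b).degree + (a ⊓ b).degree = a.degree + b.degree := by
  rw [← map_add, ← map_add]
  congr 1
  ext i
  exact max_add_min (a i) (b i)

theorem eq_of_le_of_degree_le {a b : τ →₀ ℕ} (h : a ≤ b) (hd : b.degree ≤ a.degree) : a = b := by
  obtain ⟨c, rfl⟩ := exists_add_of_le h
  rw [map_add] at hd
  rw [(Finsupp.degree_eq_zero_iff c).mp (by omega), add_zero]

theorem totalDegree_sPolynomial_le (hm : IsGraded m) (f g : MvPolynomial τ K) :
    (m.sPolynomial f g).totalDegree ≤ pairDegree m f g :=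
  Finset.sup_le fun _ ha => hm _ _ (toSyn_lt_of_mem_support_sPolynomial ha).le

theorem IsNormalForm.totalDegree_le (hm : IsGraded m) {B : Set (MvPolynomial τ K)}
    {f r : MvPolynomial τ K} (h : IsNormalForm m B f r) : r.totalDegree ≤ f.totalDegree := by
  rw [← hm.degree_degree, ← hm.degree_degree]
  exact hm _ _ h.toSyn_degree_le

/-- All monomials of degree `D` are leading monomials of combinations of `F` up to degree `D`. -/
def IsFullInDegree (m : MonomialOrder τ) (F : Set (MvPolynomial τ K)) (D : ℕ) : Prop :=
  ∀ a : τ →₀ ℕ, a.degree = D →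
    ∃ p ∈ boundedSpan m F {t | (m.toSyn.symm t).degree ≤ D}, p ≠ 0 ∧ m.degree p = a

/-- A monomial of degree at least `D` has a divisor of degree exactly `D`, to which the truncated
criterion applies. The bound on the degree of the leading monomial found is what later limits the
degrees of an inter-reduced basis. -/
theorem BState.Invariant.exists_degree_le_of_isFull (hm : IsGraded m)
    {F : Set (MvPolynomial τ K)} {s : BState τ K} (h : s.Invariant m F) {D : ℕ}
    (hF : IsFullInDegree m F D)
    (hD : ∀ f g, s(f, g) ∈ s.pairs → D < pairDegree m f g) {a : τ →₀ ℕ} (ha : D ≤ a.degree) :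
    ∃ b ∈ s.basis, b ≠ 0 ∧ m.degree b ≤ a ∧ (m.degree b).degree ≤ D := by
  obtain ⟨c, hca, hc⟩ := Finsupp.exists_le_degree_eq a D ha
  obtain ⟨p, hp, hp0, rfl⟩ := hF c hc
  obtain ⟨b, hb, hle⟩ := h.exists_degree_le hm hD hp hp0
  exact ⟨b, hb, fun e => h.zero_notMem (e ▸ hb), hle.trans hca,
    (Finsupp.degree_mono hle).trans hc.le⟩

theorem BState.Invariant.spair_degree_le (hm : IsGraded m) {F : Set (MvPolynomial τ K)}
    {s : BState τ K} (h : s.Invariant m F) {D : ℕ} (hF : IsFullInDegree m F D) (hD0 : 0 < D)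
    {f g r : MvPolynomial τ K} (hleg : s.Legal m (.spair f g r))
    (hpref : s.Preferred m (.spair f g r)) :
    pairDegree m f g ≤ 2 * D - 1 ∧ (m.sPolynomial f g).totalDegree ≤ 2 * D - 2 := by
  classical
  obtain ⟨hfg, hmin, -⟩ := hleg
  obtain ⟨hred, hcop⟩ := hpref
  obtain ⟨hf, hg, hne⟩ := h.of_mem_pairs f g hfg
  have hne0 : ∀ b ∈ s.basis, b ≠ 0 := fun b hb e => h.zero_notMem (e ▸ hb)
  have hS := totalDegree_sPolynomial_le hm f g
  -- Coprime pairs have already been dropped, so the gcd contributes at least `1` to `deg lcm + deg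
  -- gcd = deg LM(f) + deg LM(g)`.
  have hinf : 0 < (m.degree f ⊓ m.degree g).degree :=
    Nat.pos_of_ne_zero fun e => hcop f g hfg ((Finsupp.degree_eq_zero_iff _).mp e)
  have hsum := degree_sup_add_degree_inf (m.degree f) (m.degree g)
  change pairDegree m f g + _ = _ at hsum
  rcases le_or_gt (pairDegree m f g) D with hle | hlt
  -- In low degree it suffices that `D ≥ 2`, since then `D ≤ 2D - 2`. An lcm of degree at most `1`
  -- with a nontrivial gcd would equal the leading monomial of `f`, against inter-reducedness.
  · have h2 : 2 ≤ pairDegree m f g := by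
      by_contra hlt
      have h3 : (m.degree f ⊓ m.degree g).degree ≤ (m.degree f).degree :=
        Finsupp.degree_mono inf_le_left
      have h4 : m.degree f = m.degree f ⊔ m.degree g :=
        eq_of_le_of_degree_le le_sup_left (by change pairDegree m f g ≤ _; omega)
      exact hred f hf _ (m.degree_mem_support (hne0 f hf)) g ⟨hg, hne.symm⟩ (hne0 g hg)
        (h4 ▸ le_sup_right)
    omega
  -- By the normal strategy no pair of degree at most `D` is pending any more, so every monomial of
  -- degree at least `D` is reducible.
  · have hfull := fun {a : τ →₀ ℕ} => h.exists_degree_le_of_isFull hm hF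
      (fun f' g' h' => hlt.trans_le (hmin f' g' h')) (a := a)
    have hdeg : ∀ b ∈ s.basis, (m.degree b).degree ≤ D := by
      intro b hb
      by_contra hlt
      push Not at hlt
      obtain ⟨c, hc, hc0, hle, hcD⟩ := hfull hlt.le
      refine hred b hb _ (m.degree_mem_support (hne0 b hb)) c ⟨hc, ?_⟩ hc0 hle
      rintro rfl
      omega
    have htail : ∀ b ∈ s.basis, ∀ a ∈ b.support, a ≠ m.degree b → a.degree < D := by
      intro b hb a ha hab
      by_contra hlt
      push Not at hlt
      obtain ⟨c, hc, hc0, hle, hcD⟩ := hfull hlt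
      refine hred b hb a ha c ⟨hc, ?_⟩ hc0 hle
      rintro rfl
      exact hab (eq_of_le_of_degree_le hle (hm _ _ (m.le_degree ha))).symm
    have hfD := hdeg f hf
    have hgD := hdeg g hg
    refine ⟨by omega, ?_⟩
    by_cases hp : pairDegree m f g ≤ 2 * D - 2
    · exact hS.trans hp
    -- An lcm of degree `2D - 1` forces both leading monomials to have degree exactly `D`. The
    -- cofactors have degree `D - 1`, and the lcm itself cancels, so only products of a cofactor
    -- with a tail of degree below `D` remain.
    · have hfD' : (m.degree f).degree = D := by omega
      have hgD' : (m.degree g).degree = D := by omega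
      have hpD : pairDegree m f g = 2 * D - 1 := by omega
      have hsup : ∀ u : τ →₀ ℕ, u ≤ m.degree f ⊔ m.degree g →
          (m.degree f ⊔ m.degree g - u).degree + u.degree = 2 * D - 1 := by
        intro u hu
        rw [← map_add, tsub_add_cancel_of_le hu]
        exact hpD
      refine Finset.sup_le fun a ha => ?_
      have hne : a ≠ m.degree f ⊔ m.degree g := fun e =>
        (toSyn_lt_of_mem_support_sPolynomial ha).ne (congrArg m.toSyn e)
      change a.degree ≤ _
      rw [m.sPolynomial_def] at ha
      have aux : ∀ b ∈ s.basis, m.degree b ≤ m.degree f ⊔ m.degree g → (m.degree b).degree = D →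
          ∀ v ∈ b.support, a = m.degree f ⊔ m.degree g - m.degree b + v → a.degree ≤ 2 * D - 2 := by
        rintro b hb hbs hbD v hv rfl
        have hvb : v ≠ m.degree b := by
          rintro rfl
          exact hne (tsub_add_cancel_of_le hbs)
        have h1 := htail b hb v hv hvb
        have h2 := hsup _ hbs
        rw [map_add]
        omega
      rcases Finset.mem_union.mp (support_sub τ _ _ ha) with h1 | h1
      · obtain ⟨v, hv, e⟩ := exists_of_mem_support_monomial_mul h1
        exact aux f hf le_sup_left hfD' v hv e
      · obtain ⟨v, hv, e⟩ := exists_of_mem_support_monomial_mul h1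
        exact aux g hg le_sup_right hgD' v hv e

theorem BState.Invariant.action_degree_le (hm : IsGraded m) {F : Set (MvPolynomial τ K)}
    {s : BState τ K} (h : s.Invariant m F) {D : ℕ} (hF : IsFullInDegree m F D) (hD0 : 0 < D)
    (hdeg : ∀ b ∈ s.basis, b.totalDegree ≤ 2 * D - 1) {a : BAction τ K} (hleg : s.Legal m a)
    (hpref : s.Preferred m a) :
    a.stepDegree m ≤ 2 * D - 1 ∧ a.sPolyDegree m ≤ 2 * D - 2 ∧
      ∀ b ∈ (s.apply a).basis, b.totalDegree ≤ 2 * D - 1 := by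
  cases a with
  | discard f g => exact ⟨Nat.zero_le _, Nat.zero_le _, hdeg⟩
  | spair f g r =>
    obtain ⟨h1, h2⟩ := h.spair_degree_le hm hF hD0 hleg hpref
    refine ⟨h1, h2, ?_⟩
    have h3 := (hleg.2.2.totalDegree_le hm).trans h2
    simp only [BState.apply]
    split_ifs
    · exact hdeg
    · rintro b (rfl | hb)
      exacts [h3.trans (by omega), hdeg b hb]
  | interreduce f r =>
    refine ⟨hdeg f hleg.1, Nat.zero_le _, ?_⟩
    have h3 := (hleg.2.totalDegree_le hm).trans (hdeg f hleg.1)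
    simp only [BState.apply]
    split_ifs
    · exact fun b hb => hdeg b hb.1
    · rintro b (rfl | hb)
      exacts [h3, hdeg b hb.1]

theorem interreducingProcedure_solvingDegree_le (hm : IsGraded m) {F : Set (MvPolynomial τ K)}
    (h0 : 0 ∉ F) {D : ℕ} (hD0 : 0 < D) (hF : IsFullInDegree m F D)
    (hdeg : ∀ f ∈ F, f.totalDegree ≤ D) :
    (interreducingProcedure K m).solvingDegree F ≤ ((2 * D - 1 : ℕ) : ℕ∞) ∧
      (interreducingProcedure K m).strictSolvingDegree F ≤ ((2 * D - 2 : ℕ) : ℕ∞) := by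
  -- Inter-reductions count with the degree of the replaced element, so a degree bound for the whole
  -- basis is carried along. The input satisfies it because `D ≤ 2D - 1` for `D > 0`.
  have hinv := (interreducingProcedure K m).state_induction (F := F)
    (P := fun s => s.Invariant m F ∧ ∀ b ∈ s.basis, b.totalDegree ≤ 2 * D - 1)
    ⟨BState.invariant_init h0, fun f hf => (hdeg f hf).trans (by omega)⟩
    (fun s a hs ha => ⟨hs.1.apply ((interreducingProcedure K m).legal s a ha),
      (hs.1.action_degree_le hm hF hD0 hs.2 ((interreducingProcedure K m).legal s a ha)
        (interreducingProcedure_preferred ha)).2.2⟩)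
  constructor <;> refine iSup_le fun k => ?_ <;>
    cases e : (interreducingProcedure K m).next ((interreducingProcedure K m).state F k) with
    | none => exact zero_le
    | some a =>
      have := (hinv k).1.action_degree_le hm hF hD0 (hinv k).2
        ((interreducingProcedure K m).legal _ a e) (interreducingProcedure_preferred e)
      first
        | exact Nat.cast_le.mpr this.1
        | exact Nat.cast_le.mpr this.2.1

end Algorithm

/-! ### Degree-refining orders -/

section Graded

theorem isGraded_drl (σ : Type*) [Finite σ] [LinearOrder σ] : IsGraded (drl σ) := by
  intro a b h
  by_contra hlt
  exact absurd ((drl_lt_iff b a).mpr (Or.inl (not_le.mp hlt))) (not_lt.mpr h)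

theorem isGraded_homogenizedOrder {σ : Type*} [Finite σ] (m : MonomialOrder σ) :
    IsGraded (homogenizedOrder m) := by
  intro a b h
  by_contra hlt
  exact absurd ((homogenizedOrder_lt_iff m b a).mpr (Or.inl (not_le.mp hlt))) (not_lt.mpr h)

end Graded

/-! ### Homogenization to a prescribed degree -/

section Homogenization

variable {σ K : Type*} [Field K]

/-- The exponent of the homogeneous monomial of degree `d` that dehomogenizes to `x^a`. -/
def homExp (d : ℕ) (a : σ →₀ ℕ) : Option σ →₀ ℕ :=
  a.embDomain Function.Embedding.some + Finsupp.single none (d - a.degree)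

theorem homExp_some (d : ℕ) (a : σ →₀ ℕ) : (homExp d a).some = a := by
  rw [homExp, Finsupp.some_add, Finsupp.some_embDomain_some, Finsupp.some_single_none, add_zero]

theorem homExp_none (d : ℕ) (a : σ →₀ ℕ) : homExp d a none = d - a.degree := by
  rw [homExp, Finsupp.add_apply, Finsupp.embDomain_some_none, Finsupp.single_eq_same, zero_add]

theorem degree_embDomain (a : σ →₀ ℕ) :
    (a.embDomain Function.Embedding.some : Option σ →₀ ℕ).degree = a.degree := by
  rw [Finsupp.embDomain_eq_mapDomain, Finsupp.degree_mapDomain]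

theorem ext_some_none {a b : Option σ →₀ ℕ} (h : a.some = b.some) (h' : a none = b none) :
    a = b := by
  ext o
  cases o with
  | none => exact h'
  | some i => exact DFunLike.congr_fun h i

theorem embDomain_some_add_single (a : Option σ →₀ ℕ) :
    a.some.embDomain Function.Embedding.some + Finsupp.single none (a none) = a := by
  refine ext_some_none ?_ ?_
  · rw [Finsupp.some_add, Finsupp.some_embDomain_some, Finsupp.some_single_none, add_zero]
  · rw [Finsupp.add_apply, Finsupp.embDomain_some_none, Finsupp.single_eq_same, zero_add]

theorem degree_eq_some_add_none (a : Option σ →₀ ℕ) : a.degree = a.some.degree + a none := by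
  conv_lhs => rw [← embDomain_some_add_single a]
  rw [map_add, degree_embDomain, Finsupp.degree_single]

theorem degree_homExp {d : ℕ} {a : σ →₀ ℕ} (h : a.degree ≤ d) : (homExp d a).degree = d := by
  rw [degree_eq_some_add_none, homExp_some, homExp_none]
  omega

theorem homExp_of_degree_eq {d : ℕ} {a : σ →₀ ℕ} (h : d ≤ a.degree) :
    homExp d a = a.embDomain Function.Embedding.some := by
  rw [homExp, tsub_eq_zero_of_le h, Finsupp.single_zero, add_zero]

theorem homExp_degree_some (a : Option σ →₀ ℕ) : homExp a.degree a.some = a := by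
  refine ext_some_none (homExp_some _ _) ?_
  rw [homExp_none, degree_eq_some_add_none]
  omega

theorem homExp_injective (d : ℕ) : Function.Injective (homExp (σ := σ) d) := fun a b h => by
  rw [← homExp_some d a, h, homExp_some]

theorem le_iff_some_none {a b : Option σ →₀ ℕ} : a ≤ b ↔ a.some ≤ b.some ∧ a none ≤ b none :=
  ⟨fun h => ⟨fun i => h (some i), h none⟩, fun h o => by
    cases o with
    | none => exact h.2
    | some i => exact h.1 i⟩

theorem embDomain_le_homExp {d : ℕ} {a b : σ →₀ ℕ} :
    a.embDomain Function.Embedding.some ≤ homExp d b ↔ a ≤ b := by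
  rw [le_iff_some_none, Finsupp.some_embDomain_some, homExp_some, Finsupp.embDomain_some_none]
  exact and_iff_left (Nat.zero_le _)

theorem embDomain_le_embDomain {a b : σ →₀ ℕ} :
    (a.embDomain Function.Embedding.some : Option σ →₀ ℕ) ≤ b.embDomain Function.Embedding.some ↔
      a ≤ b := by
  rw [le_iff_some_none, Finsupp.some_embDomain_some, Finsupp.some_embDomain_some,
    Finsupp.embDomain_some_none, Finsupp.embDomain_some_none]
  exact and_iff_left le_rfl

/-- The linear map that sends `f` of degree at most `d` to the homogeneous polynomial of degree `d`
that dehomogenizes to `f`. -/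
def homTo (d : ℕ) : MvPolynomial σ K →ₗ[K] MvPolynomial (Option σ) K :=
  (basisMonomials σ K).constr K fun a => monomial (homExp d a) 1

theorem homTo_monomial (d : ℕ) (a : σ →₀ ℕ) (c : K) :
    homTo d (monomial a c) = monomial (homExp d a) c := by
  have h : monomial a c = c • basisMonomials σ K a := by
    rw [coe_basisMonomials, smul_monomial, smul_eq_mul, mul_one]
  rw [h, map_smul, homTo, Module.Basis.constr_basis, smul_monomial, smul_eq_mul, mul_one]

theorem homTo_eq_sum (d : ℕ) (f : MvPolynomial σ K) :
    homTo d f = ∑ a ∈ f.support, monomial (homExp d a) (coeff a f) := by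
  conv_lhs => rw [f.as_sum, map_sum]
  exact Finset.sum_congr rfl fun a _ => homTo_monomial d a _

theorem homogenize_eq_homTo (f : MvPolynomial σ K) : homogenize f = homTo f.totalDegree f :=
  (homTo_eq_sum _ f).symm

theorem coeff_homTo (d : ℕ) (f : MvPolynomial σ K) (a : σ →₀ ℕ) :
    coeff (homExp d a) (homTo d f) = coeff a f := by
  classical
  rw [homTo_eq_sum, coeff_sum]
  simp only [coeff_monomial, (homExp_injective d).eq_iff]
  rw [Finset.sum_ite_eq' f.support a fun b => coeff b f]
  exact ite_eq_left_iff.mpr fun h => (notMem_support_iff.mp h).symm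

theorem exists_of_mem_support_homTo {d : ℕ} {f : MvPolynomial σ K} {a : Option σ →₀ ℕ}
    (h : a ∈ (homTo d f).support) : ∃ b ∈ f.support, a = homExp d b := by
  classical
  rw [homTo_eq_sum] at h
  obtain ⟨b, hb, hab⟩ := Finset.mem_biUnion.mp (support_sum h)
  exact ⟨b, hb, Finset.mem_singleton.mp (support_monomial_subset hab)⟩

theorem mem_support_homTo {d : ℕ} {f : MvPolynomial σ K} {a : σ →₀ ℕ} :
    homExp d a ∈ (homTo d f).support ↔ a ∈ f.support := by
  rw [mem_support_iff, mem_support_iff, coeff_homTo]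

theorem homTo_injective (d : ℕ) : Function.Injective (homTo (σ := σ) (K := K) d) := fun f g h => by
  ext a
  rw [← coeff_homTo d f, h, coeff_homTo]

theorem homTo_eq_zero {d : ℕ} {f : MvPolynomial σ K} : homTo d f = 0 ↔ f = 0 :=
  (homTo d).map_eq_zero_iff (homTo_injective d)

theorem dehomogenize_monomial (a : Option σ →₀ ℕ) (c : K) :
    dehomogenize (monomial a c) = monomial a.some c := by
  rw [dehomogenize, aeval_monomial, Finsupp.prod_option_index _ _ (fun _ => pow_zero _)
    (fun _ _ _ => pow_add _ _ _)]
  simp only [Option.elim, one_pow, one_mul]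
  rw [monomial_eq, algebraMap_eq]

theorem homTopPart_monomial (a : Option σ →₀ ℕ) (c : K) :
    homTopPart (monomial a c) = if a none = 0 then monomial a.some c else 0 := by
  rw [homTopPart, aeval_monomial, Finsupp.prod_option_index _ _ (fun _ => pow_zero _)
    (fun _ _ _ => pow_add _ _ _)]
  simp only [Option.elim]
  split_ifs with h
  · rw [h, pow_zero, one_mul, monomial_eq, algebraMap_eq]
  · rw [zero_pow h, zero_mul, mul_zero]

theorem dehomogenize_homTo (d : ℕ) (f : MvPolynomial σ K) : dehomogenize (homTo d f) = f := by
  rw [homTo_eq_sum, map_sum]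
  conv_rhs => rw [f.as_sum]
  exact Finset.sum_congr rfl fun a _ => by rw [dehomogenize_monomial, homExp_some]

theorem homTo_dehomogenize {d : ℕ} {p : MvPolynomial (Option σ) K} (hp : p.IsHomogeneous d) :
    homTo d (dehomogenize p) = p := by
  conv_lhs => rw [p.as_sum, map_sum, map_sum]
  conv_rhs => rw [p.as_sum]
  refine Finset.sum_congr rfl fun a ha => ?_
  have h : a.degree = d := by
    by_contra hne
    exact mem_support_iff.mp ha (hp.coeff_eq_zero hne)
  rw [dehomogenize_monomial, homTo_monomial, ← h, homExp_degree_some]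

/-- This form speaks of `Finsupp.degree`, whereas the definition of homogeneity uses the weight `1`.
-/
theorem isHomogeneous_iff_degree {τ : Type*} {p : MvPolynomial τ K} {d : ℕ} :
    p.IsHomogeneous d ↔ ∀ a ∈ p.support, a.degree = d := by
  constructor
  · intro hp a ha
    by_contra hne
    exact mem_support_iff.mp ha (hp.coeff_eq_zero hne)
  · intro h a ha
    have := h a (mem_support_iff.mpr ha)
    rwa [Finsupp.degree_eq_weight_one] at this

theorem isHomogeneous_homTo {d : ℕ} {f : MvPolynomial σ K} (hf : f.totalDegree ≤ d) :
    (homTo d f).IsHomogeneous d := by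
  rw [isHomogeneous_iff_degree]
  intro a ha
  obtain ⟨b, hb, rfl⟩ := exists_of_mem_support_homTo ha
  exact degree_homExp ((le_totalDegree hb).trans hf)

/-- Within one degree, dehomogenization loses nothing: the exponent of `y` is determined by the part
in `x`. -/
theorem eq_of_dehomogenize_eq {d : ℕ} {p q : MvPolynomial (Option σ) K} (hp : p.IsHomogeneous d)
    (hq : q.IsHomogeneous d) (h : dehomogenize p = dehomogenize q) : p = q := by
  rw [← homTo_dehomogenize hp, h, homTo_dehomogenize hq]

theorem totalDegree_dehomogenize_le {d : ℕ} {p : MvPolynomial (Option σ) K}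
    (hp : p.IsHomogeneous d) : (dehomogenize p).totalDegree ≤ d := by
  refine Finset.sup_le fun a ha => ?_
  rw [← mem_support_homTo (d := d), homTo_dehomogenize hp] at ha
  have := isHomogeneous_iff_degree.mp hp _ ha
  rw [degree_eq_some_add_none, homExp_some] at this
  change a.degree ≤ d
  omega

theorem homTo_mul {d e : ℕ} {f g : MvPolynomial σ K} (hf : f.totalDegree ≤ d)
    (hg : g.totalDegree ≤ e) : homTo (d + e) (f * g) = homTo d f * homTo e g := by
  refine eq_of_dehomogenize_eq
    (isHomogeneous_homTo ((totalDegree_mul _ _).trans (add_le_add hf hg)))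
    ((isHomogeneous_homTo hf).mul (isHomogeneous_homTo hg)) ?_
  rw [dehomogenize_homTo, map_mul, dehomogenize_homTo, dehomogenize_homTo]

theorem homTopPart_homTo {d : ℕ} {f : MvPolynomial σ K} (hf : f.totalDegree ≤ d) :
    homTopPart (homTo d f) = homogeneousComponent d f := by
  classical
  rw [homTo_eq_sum, map_sum, homogeneousComponent_apply, Finset.sum_filter]
  refine Finset.sum_congr rfl fun a ha => ?_
  rw [homTopPart_monomial, homExp_none, homExp_some]
  have := (le_totalDegree ha).trans hf
  change a.degree ≤ d at this
  by_cases h : a.degree = d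
  · rw [if_pos (by omega), if_pos h]
  · rw [if_neg (by omega), if_neg h]

theorem homTopPart_homogenize (f : MvPolynomial σ K) : homTopPart (homogenize f) = topPart f := by
  rw [homogenize_eq_homTo, homTopPart_homTo le_rfl, topPart]

theorem isHomogeneous_homogenize (f : MvPolynomial σ K) :
    (homogenize f).IsHomogeneous f.totalDegree := by
  rw [homogenize_eq_homTo]; exact isHomogeneous_homTo le_rfl

theorem dehomogenize_homogenize (f : MvPolynomial σ K) : dehomogenize (homogenize f) = f := by
  rw [homogenize_eq_homTo, dehomogenize_homTo]

theorem homogenize_injective : Function.Injective (homogenize (σ := σ) (K := K)) :=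
  Function.LeftInverse.injective dehomogenize_homogenize

theorem homogenize_eq_zero {f : MvPolynomial σ K} : homogenize f = 0 ↔ f = 0 := by
  rw [homogenize_eq_homTo, homTo_eq_zero]

theorem homTopPart_rename (f : MvPolynomial σ K) : homTopPart (rename some f) = f := by
  rw [homTopPart, aeval_rename]
  exact aeval_X_left_apply f

theorem X_none_dvd_of_homTopPart_eq_zero {p : MvPolynomial (Option σ) K} (h : homTopPart p = 0) :
    X none ∣ p := by
  -- Modulo `y`, a polynomial is congruent to its `y`-free part; this version is multiplicative and
  -- can be checked on generators.
  suffices H : ∀ p : MvPolynomial (Option σ) K, X none ∣ p - rename some (homTopPart p) by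
    have := H p
    rwa [h, map_zero, sub_zero] at this
  intro p
  induction p using MvPolynomial.induction_on with
  | C c =>
    rw [homTopPart, aeval_C, algebraMap_eq, rename_C, sub_self]
    exact dvd_zero _
  | add p q hp hq =>
    rw [map_add, map_add, add_sub_add_comm]
    exact dvd_add hp hq
  | mul_X p i hp =>
    cases i with
    | none =>
      have : homTopPart (X none : MvPolynomial (Option σ) K) = 0 := by
        rw [homTopPart, aeval_X]; rfl
      rw [map_mul, this, mul_zero, map_zero, sub_zero]
      exact dvd_mul_left _ _
    | some i =>
      have : homTopPart (X (some i) : MvPolynomial (Option σ) K) = X i := by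
        rw [homTopPart, aeval_X]; rfl
      rw [map_mul, this, map_mul, rename_X, ← sub_mul]
      exact hp.mul_right _

end Homogenization

/-! ### Leading terms of homogenizations -/

section LeadingTerms

variable {σ K : Type*} [Field K] [Finite σ] {m : MonomialOrder σ}

theorem toSyn_homExp_le_iff {d : ℕ} {a b : σ →₀ ℕ} (ha : a.degree ≤ d) (hb : b.degree ≤ d) :
    (homogenizedOrder m).toSyn (homExp d a) ≤ (homogenizedOrder m).toSyn (homExp d b) ↔
      m.toSyn a ≤ m.toSyn b := by
  rw [← not_lt, ← not_lt, homogenizedOrder_lt_iff, degree_homExp ha, degree_homExp hb,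
    homExp_some, homExp_some]
  simp

/-- Among monomials of degree `d`, the homogenized order is the given order on the parts in `x`. -/
theorem degree_homTo {d : ℕ} {f : MvPolynomial σ K} (hf : f.totalDegree ≤ d) (hf0 : f ≠ 0) :
    (homogenizedOrder m).degree (homTo d f) = homExp d (m.degree f) := by
  refine (homogenizedOrder m).toSyn.injective (le_antisymm ?_ ?_)
  · rw [MonomialOrder.degree_le_iff]
    intro c hc
    obtain ⟨b, hb, rfl⟩ := exists_of_mem_support_homTo hc
    exact (toSyn_homExp_le_iff ((le_totalDegree hb).trans hf)
      ((le_totalDegree (m.degree_mem_support hf0)).trans hf)).mpr (m.le_degree hb)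
  · exact (homogenizedOrder m).le_degree (mem_support_homTo.mpr (m.degree_mem_support hf0))

/-- Gradedness makes the leading monomial of `f` one of full degree, so no factor `y` is needed. -/
theorem degree_homogenize (hm : IsGraded m) (f : MvPolynomial σ K) :
    (homogenizedOrder m).degree (homogenize f) =
      (m.degree f).embDomain Function.Embedding.some := by
  by_cases hf : f = 0
  · rw [homogenize_eq_zero.mpr hf, hf, MonomialOrder.degree_zero, MonomialOrder.degree_zero,
      Finsupp.embDomain_zero]
  · rw [homogenize_eq_homTo, degree_homTo le_rfl hf, homExp_of_degree_eq]
    rw [hm.degree_degree]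

theorem leadingCoeff_homTo {d : ℕ} {f : MvPolynomial σ K} (hf : f.totalDegree ≤ d) :
    (homogenizedOrder m).leadingCoeff (homTo d f) = m.leadingCoeff f := by
  by_cases hf0 : f = 0
  · rw [hf0, map_zero, MonomialOrder.leadingCoeff_zero, MonomialOrder.leadingCoeff_zero]
  · rw [MonomialOrder.leadingCoeff, degree_homTo hf hf0, coeff_homTo]
    rfl

theorem leadingCoeff_homogenize (f : MvPolynomial σ K) :
    (homogenizedOrder m).leadingCoeff (homogenize f) = m.leadingCoeff f := by
  rw [homogenize_eq_homTo, leadingCoeff_homTo le_rfl]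

end LeadingTerms

/-! ### Correspondence of affine and homogeneous computations -/

section Correspondence

variable {σ K : Type*} [Field K]

theorem totalDegree_le_iff {τ : Type*} {f : MvPolynomial τ K} {d : ℕ} :
    f.totalDegree ≤ d ↔ ∀ a ∈ f.support, a.degree ≤ d :=
  Finset.sup_le_iff

theorem isLowerSet_degree_le {τ : Type*} {m : MonomialOrder τ} (hm : IsGraded m) (d : ℕ) :
    IsLowerSet {t : m.syn | (m.toSyn.symm t).degree ≤ d} := by
  intro s t hts hs
  refine (hm _ _ ?_).trans hs
  rwa [AddEquiv.apply_symm_apply, AddEquiv.apply_symm_apply]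

theorem ReducesTo.totalDegree_le {τ : Type*} {m : MonomialOrder τ} (hm : IsGraded m)
    {B : Set (MvPolynomial τ K)} {f f' : MvPolynomial τ K} (h : ReducesTo m B f f') {d : ℕ}
    (hf : f.totalDegree ≤ d) : f'.totalDegree ≤ d := by
  rw [totalDegree_le_iff] at hf ⊢
  have := (h.bounded (isLowerSet_degree_le hm d) fun a ha => by
    change (m.toSyn.symm (m.toSyn a)).degree ≤ d
    rw [AddEquiv.symm_apply_apply]; exact hf a ha).2
  intro a ha
  have h1 := this a ha
  change (m.toSyn.symm (m.toSyn a)).degree ≤ d at h1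
  rwa [AddEquiv.symm_apply_apply] at h1

theorem homExp_tsub {d : ℕ} {a b : σ →₀ ℕ} (hba : b ≤ a) :
    homExp (d - b.degree) (a - b) = homExp d a - b.embDomain Function.Embedding.some := by
  have h : (a - b).degree + b.degree = a.degree := by
    rw [← map_add, tsub_add_cancel_of_le hba]
  refine ext_some_none ?_ ?_
  · rw [homExp_some]
    ext i
    have h1 := DFunLike.congr_fun (homExp_some d a) i
    have h2 := DFunLike.congr_fun (Finsupp.some_embDomain_some b) i
    rw [Finsupp.some_apply] at h1 h2
    rw [Finsupp.some_apply, Finsupp.tsub_apply, Finsupp.tsub_apply, h1, h2]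
  · rw [homExp_none, Finsupp.tsub_apply, homExp_none, Finsupp.embDomain_some_none]
    omega

theorem embDomain_sup (a b : σ →₀ ℕ) :
    (a ⊔ b).embDomain Function.Embedding.some =
      (a.embDomain Function.Embedding.some ⊔ b.embDomain Function.Embedding.some :
        Option σ →₀ ℕ) := by
  ext o
  cases o <;> simp

theorem embDomain_inf (a b : σ →₀ ℕ) :
    (a ⊓ b).embDomain Function.Embedding.some =
      (a.embDomain Function.Embedding.some ⊓ b.embDomain Function.Embedding.some :
        Option σ →₀ ℕ) := by
  ext o
  cases o <;> simp

theorem pairDegree_comm {τ : Type*} (m : MonomialOrder τ) (f g : MvPolynomial τ K) :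
    pairDegree m f g = pairDegree m g f := by
  rw [pairDegree, sup_comm, pairDegree]

/-- The homogenization of all polynomials of a state. -/
def BState.homogenized (s : BState σ K) : BState (Option σ) K :=
  ⟨homogenize '' s.basis, Sym2.map homogenize '' s.pairs⟩

theorem BState.homogenized_init (F : Set (MvPolynomial σ K)) :
    (BState.init F).homogenized = BState.init (homogenize '' F) := by
  simp only [BState.homogenized, BState.init, BState.mk.injEq, true_and]
  ext p
  constructor
  · rintro ⟨_, ⟨f, hf, g, hg, hne, rfl⟩, rfl⟩
    exact ⟨_, ⟨f, hf, rfl⟩, _, ⟨g, hg, rfl⟩, homogenize_injective.ne hne, rfl⟩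
  · rintro ⟨_, ⟨f, hf, rfl⟩, _, ⟨g, hg, rfl⟩, hne, rfl⟩
    exact ⟨s(f, g), ⟨f, hf, g, hg, fun e => hne (congrArg _ e), rfl⟩, rfl⟩

theorem BState.homogenized_apply (s : BState σ K) {a : BAction σ K} (ha : a.OnPairs) :
    s.homogenized.apply (a.map homogenize) = (s.apply a).homogenized := by
  have hinj : Function.Injective (Sym2.map (homogenize (σ := σ) (K := K))) :=
    Sym2.map.injective homogenize_injective
  have hdiff : ∀ f g : MvPolynomial σ K, Sym2.map homogenize '' (s.pairs \ {s(f, g)}) =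
      Sym2.map homogenize '' s.pairs \ {s(homogenize f, homogenize g)} := by
    intro f g
    rw [Set.image_sdiff hinj, Set.image_singleton, Sym2.map_mk]
  cases a with
  | discard f g => simp only [BAction.map, BState.apply, BState.homogenized, hdiff]
  | spair f g r =>
    by_cases hr : r = 0
    · simp only [BAction.map, BState.apply, BState.homogenized, if_pos hr,
        if_pos (homogenize_eq_zero.mpr hr), hdiff]
    · have hr' : ¬ homogenize r = 0 := fun e => hr (homogenize_eq_zero.mp e)
      simp only [BAction.map, BState.apply, BState.homogenized, if_neg hr, if_neg hr',
        Set.image_insert_eq, Set.image_union, hdiff, Set.image_image, Sym2.map_mk]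
  | interreduce f r => exact absurd ha id

theorem exists_of_mem_homogenized_pairs {s : BState σ K} {f' g' : MvPolynomial (Option σ) K}
    (h : s(f', g') ∈ s.homogenized.pairs) :
    ∃ f g, f' = homogenize f ∧ g' = homogenize g ∧ s(f, g) ∈ s.pairs := by
  obtain ⟨p, hp, e⟩ := h
  induction p using Sym2.ind with
  | _ f g =>
    rw [Sym2.map_mk] at e
    rcases Sym2.eq_iff.mp e with ⟨rfl, rfl⟩ | ⟨rfl, rfl⟩
    exacts [⟨f, g, rfl, rfl, hp⟩, ⟨g, f, rfl, rfl, Sym2.eq_swap ▸ hp⟩]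

theorem map_dehomogenize_map_homogenize (l : List (BAction σ K)) :
    (l.map (BAction.map homogenize)).map (BAction.map dehomogenize) = l := by
  rw [List.map_map]
  convert List.map_id l using 2
  funext a
  cases a <;> simp only [Function.comp, BAction.map, dehomogenize_homogenize, id]

variable [Finite σ] {m : MonomialOrder σ}

/-- The degree `d` splits into the degree of `b` and a rest for the cofactor. The factor `b` becomes
`b^h` because its leading monomial has full degree, and all missing powers of `y` go to the
cofactor. -/
theorem homTo_monomial_mul (hm : IsGraded m) {d : ℕ} {a : σ →₀ ℕ} (ha : a.degree ≤ d)
    {b : MvPolynomial σ K} (hba : m.degree b ≤ a) (c : K) :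
    homTo d (monomial (a - m.degree b) c * b) =
      monomial (homExp d a - (homogenizedOrder m).degree (homogenize b)) c * homogenize b := by
  have hb := hm.degree_degree b
  have h : (a - m.degree b).degree + (m.degree b).degree = a.degree := by
    rw [← map_add, tsub_add_cancel_of_le hba]
  have hd : d = (d - (m.degree b).degree) + b.totalDegree := by omega
  have h1 : (monomial (a - m.degree b) c).totalDegree ≤ d - (m.degree b).degree :=
    (totalDegree_monomial_le _ _).trans (by change (a - m.degree b).degree ≤ _; omega)
  conv_lhs => rw [hd]
  rw [homTo_mul h1 le_rfl, homTo_monomial, homExp_tsub hba, degree_homogenize hm,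
    homogenize_eq_homTo]

theorem homTo_reduce (hm : IsGraded m) {d : ℕ} {f b : MvPolynomial σ K}
    (hf : f.totalDegree ≤ d) {a : σ →₀ ℕ} (ha : a ∈ f.support) (hba : m.degree b ≤ a) :
    homTo d (f - monomial (a - m.degree b) (coeff a f / m.leadingCoeff b) * b) =
      homTo d f - monomial (homExp d a - (homogenizedOrder m).degree (homogenize b))
        (coeff (homExp d a) (homTo d f) / (homogenizedOrder m).leadingCoeff (homogenize b)) *
          homogenize b := by
  rw [map_sub, homTo_monomial_mul hm ((le_totalDegree ha).trans hf) hba, coeff_homTo,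
    leadingCoeff_homogenize]

theorem ReducesTo.homTo (hm : IsGraded m) {B : Set (MvPolynomial σ K)} {d : ℕ}
    {f f' : MvPolynomial σ K} (hf : f.totalDegree ≤ d) (h : ReducesTo m B f f') :
    ReducesTo (homogenizedOrder m) (homogenize '' B) (homTo d f) (homTo d f') := by
  obtain ⟨b, hb, hb0, a, ha, hba, rfl⟩ := h
  refine ⟨homogenize b, ⟨b, hb, rfl⟩, fun e => hb0 (homogenize_eq_zero.mp e), homExp d a,
    mem_support_homTo.mpr ha, ?_, homTo_reduce hm hf ha hba⟩
  rw [degree_homogenize hm]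
  exact embDomain_le_homExp.mpr hba

/-- Leading monomials of the `b^h` are free of `y`, so divisibility is decided by the parts in `x`;
hence the homogeneous side has no additional and no fewer reductions. -/
theorem ReducesTo.exists_of_homTo (hm : IsGraded m) {B : Set (MvPolynomial σ K)} {d : ℕ}
    {f : MvPolynomial σ K} {q : MvPolynomial (Option σ) K} (hf : f.totalDegree ≤ d)
    (h : ReducesTo (homogenizedOrder m) (homogenize '' B) (SemiRegGB.homTo d f) q) :
    ∃ f', q = SemiRegGB.homTo d f' ∧ f'.totalDegree ≤ d ∧ ReducesTo m B f f' := by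
  obtain ⟨_, ⟨b, hb, rfl⟩, hb0, a, ha, hba, rfl⟩ := h
  obtain ⟨c, hc, rfl⟩ := exists_of_mem_support_homTo ha
  rw [degree_homogenize hm] at hba
  have hred : ReducesTo m B f (f - monomial (c - m.degree b) (coeff c f / m.leadingCoeff b) * b) :=
    ⟨b, hb, fun e => hb0 (homogenize_eq_zero.mpr e), c, hc, embDomain_le_homExp.mp hba, rfl⟩
  exact ⟨_, (homTo_reduce hm hf hc (embDomain_le_homExp.mp hba)).symm, hred.totalDegree_le hm hf,
    hred⟩

theorem IsNormalForm.homTo (hm : IsGraded m) {B : Set (MvPolynomial σ K)} {d : ℕ}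
    {f r : MvPolynomial σ K} (hf : f.totalDegree ≤ d) (h : IsNormalForm m B f r) :
    IsNormalForm (homogenizedOrder m) (homogenize '' B) (homTo d f) (homTo d r) := by
  obtain ⟨h1, h2⟩ := h
  constructor
  · suffices H : ReflTransGen (ReducesTo (homogenizedOrder m) (homogenize '' B))
        (SemiRegGB.homTo d f) (SemiRegGB.homTo d r) ∧ r.totalDegree ≤ d from H.1
    clear h2
    induction h1 with
    | refl => exact ⟨.refl, hf⟩
    | tail _ h ih => exact ⟨ih.1.tail (h.homTo hm ih.2), h.totalDegree_le hm ih.2⟩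
  · rintro a ha _ ⟨b, hb, rfl⟩ hb0 hle
    obtain ⟨c, hc, rfl⟩ := exists_of_mem_support_homTo ha
    rw [degree_homogenize hm] at hle
    exact h2 c hc b hb (fun e => hb0 (homogenize_eq_zero.mpr e)) (embDomain_le_homExp.mp hle)

theorem IsNormalForm.exists_of_homTo (hm : IsGraded m) {B : Set (MvPolynomial σ K)} {d : ℕ}
    {f : MvPolynomial σ K} {q : MvPolynomial (Option σ) K} (hf : f.totalDegree ≤ d)
    (h : IsNormalForm (homogenizedOrder m) (homogenize '' B) (SemiRegGB.homTo d f) q) :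
    ∃ r, q = SemiRegGB.homTo d r ∧ r.totalDegree ≤ d ∧ IsNormalForm m B f r := by
  obtain ⟨h1, h2⟩ := h
  obtain ⟨r, rfl, hr, hfr⟩ : ∃ r, q = SemiRegGB.homTo d r ∧ r.totalDegree ≤ d ∧
      ReflTransGen (ReducesTo m B) f r := by
    clear h2
    induction h1 with
    | refl => exact ⟨f, rfl, hf, .refl⟩
    | tail _ h ih =>
      obtain ⟨r, rfl, hr, hfr⟩ := ih
      obtain ⟨r', rfl, hr', h'⟩ := ReducesTo.exists_of_homTo hm hr h
      exact ⟨r', rfl, hr', hfr.tail h'⟩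
  refine ⟨r, rfl, hr, hfr, fun a ha b hb hb0 hle => ?_⟩
  refine h2 (homExp d a) (mem_support_homTo.mpr ha) _ ⟨b, hb, rfl⟩
    (fun e => hb0 (homogenize_eq_zero.mp e)) ?_
  rw [degree_homogenize hm]
  exact embDomain_le_homExp.mpr hle

theorem pairDegree_homogenize (hm : IsGraded m) (f g : MvPolynomial σ K) :
    pairDegree (homogenizedOrder m) (homogenize f) (homogenize g) = pairDegree m f g := by
  rw [pairDegree, degree_homogenize hm, degree_homogenize hm, ← embDomain_sup, degree_embDomain]
  rfl

theorem sPolynomial_homogenize (hm : IsGraded m) (f g : MvPolynomial σ K) :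
    (homogenizedOrder m).sPolynomial (homogenize f) (homogenize g) =
      homTo (pairDegree m f g) (m.sPolynomial f g) := by
  have h : homExp (pairDegree m f g) (m.degree f ⊔ m.degree g) =
      (homogenizedOrder m).degree (homogenize f) ⊔ (homogenizedOrder m).degree (homogenize g) := by
    rw [homExp_of_degree_eq (by exact le_rfl), degree_homogenize hm, degree_homogenize hm,
      embDomain_sup]
  rw [MonomialOrder.sPolynomial_def, MonomialOrder.sPolynomial_def, map_sub,
    homTo_monomial_mul hm (by exact le_rfl) le_sup_left,
    homTo_monomial_mul hm (by exact le_rfl) le_sup_right, h, leadingCoeff_homogenize,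
    leadingCoeff_homogenize]

/-- No condition on degree falls is made here: the normal form is homogenized to the degree of the
pair, possibly with a factor `y`. This allows a falling affine step to be compared with a
homogeneous one in `noFall_of_noFallHom`. -/
theorem BState.legal_spair_homTo (hm : IsGraded m) {s : BState σ K} {f g r : MvPolynomial σ K}
    (h : s.Legal m (.spair f g r)) :
    s.homogenized.Legal (homogenizedOrder m)
      (.spair (homogenize f) (homogenize g) (homTo (pairDegree m f g) r)) := by
  obtain ⟨hp, hmin, hnf⟩ := h
  refine ⟨⟨_, hp, rfl⟩, fun f' g' h' => ?_, ?_⟩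
  · obtain ⟨p, hp', e⟩ := h'
    induction p using Sym2.ind with
    | _ f'' g'' =>
      have h1 := hmin f'' g'' hp'
      rw [Sym2.map_mk] at e
      rcases Sym2.eq_iff.mp e with ⟨rfl, rfl⟩ | ⟨rfl, rfl⟩
      · rwa [pairDegree_homogenize hm, pairDegree_homogenize hm]
      · rw [pairDegree_homogenize hm, pairDegree_homogenize hm]
        exact h1.trans_eq (pairDegree_comm m f'' g'')
  · rw [sPolynomial_homogenize hm]
    exact hnf.homTo hm (totalDegree_sPolynomial_le hm f g)

theorem BState.legal_homogenize (hm : IsGraded m) {s : BState σ K} {a : BAction σ K}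
    (h : s.Legal m a) (ha : a.OnPairs) (hfall : a.NoFall m) :
    s.homogenized.Legal (homogenizedOrder m) (a.map homogenize) ∧
      (a.map homogenize).OnPairs ∧ (a.map homogenize).NoFallHom (homogenizedOrder m) ∧
      (a.map homogenize).stepDegree (homogenizedOrder m) = a.stepDegree m := by
  cases a with
  | discard f g =>
    refine ⟨⟨⟨_, h.1, rfl⟩, ?_⟩, trivial, trivial, rfl⟩
    rw [degree_homogenize hm, degree_homogenize hm, ← embDomain_inf, h.2, Finsupp.embDomain_zero]
  | spair f g r =>
    refine ⟨?_, trivial, fun hr => ?_, pairDegree_homogenize hm f g⟩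
    · have h1 := legal_spair_homTo hm h
      by_cases hr : r = 0
      · rwa [hr, map_zero, ← homogenize_eq_zero.mpr rfl, ← hr] at h1
      · rwa [← hfall hr, ← homogenize_eq_homTo] at h1
    · rw [degree_homogenize hm, Finsupp.embDomain_some_none]
  | interreduce f r => exact absurd ha id

theorem BState.exists_of_legal_homogenized (hm : IsGraded m) {s : BState σ K}
    {a' : BAction (Option σ) K} (h : s.homogenized.Legal (homogenizedOrder m) a')
    (ha : a'.OnPairs) (hfall : a'.NoFallHom (homogenizedOrder m)) :
    ∃ a : BAction σ K, a' = a.map homogenize ∧ s.Legal m a ∧ a.OnPairs ∧ a.NoFall m := by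
  cases a' with
  | discard f' g' =>
    obtain ⟨f, g, rfl, rfl, hp⟩ := exists_of_mem_homogenized_pairs h.1
    refine ⟨.discard f g, rfl, ⟨hp, ?_⟩, trivial, trivial⟩
    have := h.2
    rw [degree_homogenize hm, degree_homogenize hm, ← embDomain_inf] at this
    exact Finsupp.embDomain_eq_zero.mp this
  | spair f' g' q =>
    obtain ⟨hp', hmin, hnf⟩ := h
    obtain ⟨f, g, rfl, rfl, hp⟩ := exists_of_mem_homogenized_pairs hp'
    rw [sPolynomial_homogenize hm] at hnf
    obtain ⟨r, rfl, hr, hnf⟩ :=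
      IsNormalForm.exists_of_homTo hm (totalDegree_sPolynomial_le hm f g) hnf
    -- The exponent of `y` in the leading monomial is the pair degree minus `deg r`; if it vanishes,
    -- homogenizing to the pair degree is the ordinary homogenization.
    have hdeg : r ≠ 0 → r.totalDegree = pairDegree m f g := by
      intro hr0
      have h1 := hfall (fun e => hr0 (homTo_eq_zero.mp e))
      rw [degree_homTo hr hr0, homExp_none, hm.degree_degree] at h1
      omega
    refine ⟨.spair f g r, ?_, ⟨hp, fun f'' g'' h'' => ?_, hnf⟩, trivial, hdeg⟩
    · rw [BAction.map, homogenize_eq_homTo r]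
      by_cases hr0 : r = 0
      · rw [hr0, map_zero, map_zero]
      · rw [hdeg hr0]
    · have := hmin _ _ ⟨_, h'', rfl⟩
      rwa [pairDegree_homogenize hm, pairDegree_homogenize hm] at this
  | interreduce f r => exact absurd ha id

theorem IsRun.homogenize (hm : IsGraded m) {l : List (BAction σ K)} : ∀ {s : BState σ K},
    IsRun m s l → (∀ a ∈ l, a.OnPairs ∧ a.NoFall m) →
    IsRun (homogenizedOrder m) s.homogenized (l.map (BAction.map SemiRegGB.homogenize)) ∧
      finalState s.homogenized (l.map (BAction.map SemiRegGB.homogenize)) =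
        (finalState s l).homogenized ∧
      ∀ a ∈ l, (a.map SemiRegGB.homogenize).OnPairs ∧
        (a.map SemiRegGB.homogenize).NoFallHom (homogenizedOrder m) ∧
        (a.map SemiRegGB.homogenize).stepDegree (homogenizedOrder m) = a.stepDegree m := by
  induction l with
  | nil => exact fun _ _ => ⟨trivial, rfl, fun _ h => absurd h List.not_mem_nil⟩
  | cons a l ih =>
    intro s hl ha
    obtain ⟨ha1, ha2⟩ := ha a List.mem_cons_self
    obtain ⟨h1, h2⟩ := BState.legal_homogenize hm hl.1 ha1 ha2
    obtain ⟨h3, h4, h5⟩ := ih hl.2 fun b hb => ha b (List.mem_cons_of_mem _ hb)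
    rw [← BState.homogenized_apply s ha1] at h3 h4
    refine ⟨⟨h1, h3⟩, h4, fun b hb => ?_⟩
    rcases List.mem_cons.mp hb with rfl | hb
    exacts [h2, h5 b hb]

theorem IsRun.exists_of_homogenized (hm : IsGraded m) {l' : List (BAction (Option σ) K)} :
    ∀ {s : BState σ K}, IsRun (homogenizedOrder m) s.homogenized l' →
    (∀ a ∈ l', a.OnPairs ∧ a.NoFallHom (homogenizedOrder m)) →
    ∃ l : List (BAction σ K), l' = l.map (BAction.map SemiRegGB.homogenize) ∧ IsRun m s l ∧
      ∀ a ∈ l, a.OnPairs ∧ a.NoFall m := by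
  induction l' with
  | nil => exact fun _ _ => ⟨[], rfl, trivial, fun _ h => absurd h List.not_mem_nil⟩
  | cons a' l' ih =>
    intro s hl ha
    obtain ⟨ha1, ha2⟩ := ha a' List.mem_cons_self
    obtain ⟨a, rfl, h1, h2, h3⟩ := BState.exists_of_legal_homogenized hm hl.1 ha1 ha2
    have hl2 := hl.2
    rw [BState.homogenized_apply s h2] at hl2
    obtain ⟨l, rfl, h4, h5⟩ := ih hl2 fun b hb => ha b (List.mem_cons_of_mem _ hb)
    refine ⟨a :: l, rfl, ⟨h1, h4⟩, fun b hb => ?_⟩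
    rcases List.mem_cons.mp hb with rfl | hb
    exacts [⟨h2, h3⟩, h5 b hb]

/-- The inverse is homogenization: as long as no degree falls, every homogeneous state is the
homogenization of the affine one, and so is every operation. -/
theorem bijOn_dehomogenize (hm : IsGraded m) (s : BState σ K) (D : ℕ) :
    Set.BijOn (List.map (BAction.map dehomogenize))
      {l | IsRun (homogenizedOrder m) s.homogenized l ∧ ∀ a ∈ l, a.OnPairs ∧
        a.stepDegree (homogenizedOrder m) ≤ D ∧ a.NoFallHom (homogenizedOrder m)}
      {l | IsRun m s l ∧ ∀ a ∈ l, a.OnPairs ∧ a.stepDegree m ≤ D ∧ a.NoFall m} := by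
  have key : ∀ l', (IsRun (homogenizedOrder m) s.homogenized l' ∧ ∀ a ∈ l', a.OnPairs ∧
        a.stepDegree (homogenizedOrder m) ≤ D ∧ a.NoFallHom (homogenizedOrder m)) →
      ∃ l, l' = l.map (BAction.map homogenize) ∧ IsRun m s l ∧
        ∀ a ∈ l, a.OnPairs ∧ a.stepDegree m ≤ D ∧ a.NoFall m := by
    rintro l' ⟨hl', ha'⟩
    obtain ⟨l, rfl, hl, ha⟩ := hl'.exists_of_homogenized hm fun a h => ⟨(ha' a h).1, (ha' a h).2.2⟩
    refine ⟨l, rfl, hl, fun a h => ⟨(ha a h).1, ?_, (ha a h).2⟩⟩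
    rw [← ((hl.homogenize hm ha).2.2 a h).2.2]
    exact (ha' _ (List.mem_map_of_mem h)).2.1
  refine ⟨fun l' hl' => ?_, fun l₁ h₁ l₂ h₂ e => ?_, fun l hl => ?_⟩
  · obtain ⟨l, rfl, hl⟩ := key l' hl'
    rw [map_dehomogenize_map_homogenize]
    exact hl
  · obtain ⟨l₁, rfl, -⟩ := key l₁ h₁
    obtain ⟨l₂, rfl, -⟩ := key l₂ h₂
    rw [map_dehomogenize_map_homogenize, map_dehomogenize_map_homogenize] at e
    rw [e]
  · obtain ⟨h1, -, h2⟩ := hl.1.homogenize hm fun a h => ⟨(hl.2 a h).1, (hl.2 a h).2.2⟩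
    refine ⟨l.map (BAction.map homogenize), ⟨h1, fun a' h' => ?_⟩,
      map_dehomogenize_map_homogenize l⟩
    obtain ⟨a, ha, rfl⟩ := List.mem_map.mp h'
    obtain ⟨h3, h4, h5⟩ := h2 a ha
    exact ⟨h3, h5.le.trans (hl.2 a ha).2.1, h4⟩

/-- If there is no degree fall on the homogenized input, there is none on the input. -/
theorem noFall_of_noFallHom (hm : IsGraded m) {s : BState σ K} {D : ℕ}
    (H : ∀ l, IsRun (homogenizedOrder m) s.homogenized l →
      (∀ a ∈ l, a.OnPairs ∧ a.stepDegree (homogenizedOrder m) < D) →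
      ∀ a ∈ l, a.NoFallHom (homogenizedOrder m)) (l : List (BAction σ K)) :
    IsRun m s l → (∀ a ∈ l, a.OnPairs ∧ a.stepDegree m < D) → ∀ a ∈ l, a.NoFall m := by
  induction l using List.reverseRecOn with
  | nil => exact fun _ _ _ h => absurd h List.not_mem_nil
  | append_singleton l a ih =>
    intro hrun hl
    obtain ⟨h1, h2, -⟩ := isRun_append.mp hrun
    have hl' : ∀ b ∈ l, b.OnPairs ∧ b.stepDegree m < D := fun b hb =>
      hl b (List.mem_append_left _ hb)
    have hfall := ih h1 hl'
    obtain ⟨h3, h4, h5⟩ := h1.homogenize hm fun b hb => ⟨(hl' b hb).1, hfall b hb⟩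
    intro b hb
    rcases List.mem_append.mp hb with hb | hb
    · exact hfall b hb
    obtain rfl := List.mem_singleton.mp hb
    have hb' := hl b (List.mem_append_right _ (List.mem_singleton_self b))
    cases b with
    | discard f g => trivial
    | spair f g r =>
      intro hr
      have hrd : r.totalDegree ≤ pairDegree m f g :=
        (h2.2.2.totalDegree_le hm).trans (totalDegree_sPolynomial_le hm f g)
      -- The part of the run before the last operation has no fall and can be homogenized. The
      -- homogeneous counterpart of the last operation is legal, and its leading monomial is free of
      -- `y` by assumption.
      have := H (l.map (BAction.map homogenize) ++
          [.spair (homogenize f) (homogenize g) (homTo (pairDegree m f g) r)])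
        (isRun_append.mpr ⟨h3, by rw [h4]; exact BState.legal_spair_homTo hm h2, trivial⟩)
        (by
          intro c hc
          rcases List.mem_append.mp hc with hc | hc
          · obtain ⟨c', hc', rfl⟩ := List.mem_map.mp hc
            obtain ⟨h6, -, h7⟩ := h5 c' hc'
            exact ⟨h6, h7.trans_lt (hl' c' hc').2⟩
          · obtain rfl := List.mem_singleton.mp hc
            exact ⟨trivial, (pairDegree_homogenize hm f g).trans_lt hb'.2⟩)
        _ (List.mem_append_right _ (List.mem_singleton_self _))
        (fun e => hr (homTo_eq_zero.mp e))
      rw [degree_homTo hrd hr, homExp_none, hm.degree_degree] at this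
      omega
    | interreduce f r => exact absurd hb'.1 id

end Correspondence

/-! ### Homogeneous ideals, top parts and the degree of regularity -/

section HomogeneousIdeals

variable {τ K : Type*} [Field K]

theorem isHomogeneous_topPart (f : MvPolynomial τ K) : (topPart f).IsHomogeneous f.totalDegree :=
  homogeneousComponent_isHomogeneous _ _

theorem homogeneousComponent_add_mul {d : ℕ} {f : MvPolynomial τ K} (hf : f.IsHomogeneous d)
    (n : ℕ) (g : MvPolynomial τ K) :
    homogeneousComponent (n + d) (g * f) = homogeneousComponent n g * f := by
  have h : ∀ j, homogeneousComponent (n + d) (homogeneousComponent j g * f) =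
      if n = j then homogeneousComponent j g * f else 0 := by
    intro j
    rw [homogeneousComponent_of_mem ((homogeneousComponent_isHomogeneous j g).mul hf)]
    simp only [add_left_inj]
  conv_lhs => rw [← sum_homogeneousComponent g, Finset.sum_mul, map_sum]
  simp only [h]
  rw [Finset.sum_ite_eq]
  split_ifs with hn
  · rfl
  · rw [homogeneousComponent_eq_zero n g (by simpa using hn), zero_mul]

theorem homogeneousComponent_mul_of_lt {d e : ℕ} {f : MvPolynomial τ K} (hf : f.IsHomogeneous d)
    (h : e < d) (g : MvPolynomial τ K) : homogeneousComponent e (g * f) = 0 := by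
  rw [← sum_homogeneousComponent g, Finset.sum_mul, map_sum]
  refine Finset.sum_eq_zero fun j _ => ?_
  rw [homogeneousComponent_of_mem ((homogeneousComponent_isHomogeneous j g).mul hf),
    if_neg (by omega)]

theorem exists_coeffs_of_mem_span_image {ι : Type*} [Fintype ι] {f : ι → MvPolynomial τ K}
    {S : Set ι} {p : MvPolynomial τ K} (hp : p ∈ Ideal.span (f '' S)) :
    ∃ c : ι → MvPolynomial τ K, (∀ i ∉ S, c i = 0) ∧ p = ∑ i, c i * f i := by
  classical
  induction hp using Submodule.span_induction with
  | mem p hp =>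
    obtain ⟨i, hi, rfl⟩ := hp
    refine ⟨Pi.single i 1, fun j hj => Pi.single_eq_of_ne (by rintro rfl; exact hj hi) _, ?_⟩
    rw [Finset.sum_eq_single i (fun j _ hj => by rw [Pi.single_eq_of_ne hj, zero_mul])
      (fun h => absurd (Finset.mem_univ i) h), Pi.single_eq_same, one_mul]
  | zero => exact ⟨0, fun _ _ => rfl, by simp⟩
  | add p q _ _ hp hq =>
    obtain ⟨c, hc, rfl⟩ := hp
    obtain ⟨c', hc', rfl⟩ := hq
    refine ⟨c + c', fun i hi => by rw [Pi.add_apply, hc i hi, hc' i hi, add_zero], ?_⟩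
    simp only [Pi.add_apply, add_mul, Finset.sum_add_distrib]
  | smul a p _ hp =>
    obtain ⟨c, hc, rfl⟩ := hp
    refine ⟨fun i => a * c i, fun i hi => by simp only [hc i hi, mul_zero], ?_⟩
    rw [smul_eq_mul, Finset.mul_sum]
    exact Finset.sum_congr rfl fun i _ => (mul_assoc _ _ _).symm

/-- Take in each coefficient only the component of complementary degree. Generators of degree above
`e` get the coefficient zero, so no bound on their degrees is needed. -/
theorem exists_homogeneous_coeffs {ι : Type*} [Fintype ι] {f : ι → MvPolynomial τ K} {d : ι → ℕ}
    (hf : ∀ i, (f i).IsHomogeneous (d i)) {S : Set ι} {p : MvPolynomial τ K} {e : ℕ}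
    (hp : p.IsHomogeneous e) (hmem : p ∈ Ideal.span (f '' S)) :
    ∃ c : ι → MvPolynomial τ K, (∀ i ∉ S, c i = 0) ∧
      (∀ i, c i = 0 ∨ ∃ n, (c i).IsHomogeneous n ∧ n + d i = e) ∧ p = ∑ i, c i * f i := by
  obtain ⟨c, hc, hsum⟩ := exists_coeffs_of_mem_span_image hmem
  refine ⟨fun i => if d i ≤ e then homogeneousComponent (e - d i) (c i) else 0, fun i hi => ?_,
    fun i => ?_, ?_⟩
  · simp only [hc i hi, map_zero, ite_self]
  · by_cases h : d i ≤ e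
    · simp only [if_pos h]
      exact Or.inr ⟨_, homogeneousComponent_isHomogeneous _ _, by omega⟩
    · simp only [if_neg h, true_or]
  · rw [← homogeneousComponent_eq_self hp, hsum, map_sum]
    refine Finset.sum_congr rfl fun i _ => ?_
    beta_reduce
    by_cases h : d i ≤ e
    · rw [if_pos h, ← homogeneousComponent_add_mul (hf i), Nat.sub_add_cancel h]
    · rw [if_neg h, zero_mul, homogeneousComponent_mul_of_lt (hf i) (not_le.mp h)]

theorem homogeneousComponent_mem_span_range {ι : Type*} [Fintype ι] {f : ι → MvPolynomial τ K}
    {d : ι → ℕ} (hf : ∀ i, (f i).IsHomogeneous (d i)) {p : MvPolynomial τ K}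
    (hp : p ∈ Ideal.span (Set.range f)) (e : ℕ) :
    homogeneousComponent e p ∈ Ideal.span (Set.range f) := by
  rw [← Set.image_univ] at hp
  obtain ⟨c, -, rfl⟩ := exists_coeffs_of_mem_span_image hp
  rw [map_sum]
  refine sum_mem fun i _ => ?_
  rcases le_or_gt (d i) e with h | h
  · rw [← Nat.sub_add_cancel h, homogeneousComponent_add_mul (hf i)]
    exact Ideal.mul_mem_left _ _ (Ideal.subset_span ⟨i, rfl⟩)
  · rw [homogeneousComponent_mul_of_lt (hf i) h]
    exact zero_mem _

theorem sum_mem_boundedSpan {ι : Type*} [Fintype ι] {m : MonomialOrder τ} (hm : IsGraded m)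
    {f c : ι → MvPolynomial τ K} {e : ℕ}
    (hc : ∀ i, c i = 0 ∨ ∃ n, (c i).IsHomogeneous n ∧ n + (f i).totalDegree ≤ e) :
    ∑ i, c i * f i ∈ boundedSpan m (Set.range f) {t | (m.toSyn.symm t).degree ≤ e} := by
  refine sum_mem fun i _ => ?_
  rcases hc i with h | ⟨n, hn, hne⟩
  · rw [h, zero_mul]; exact zero_mem _
  · rw [(c i).as_sum, Finset.sum_mul]
    refine sum_mem fun a ha => monomial_mul_mem_boundedSpan (Set.mem_range_self i) ?_ _
    change (m.toSyn.symm (m.toSyn _)).degree ≤ e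
    rw [AddEquiv.symm_apply_apply, map_add, hm.degree_degree, isHomogeneous_iff_degree.mp hn a ha]
    exact hne

theorem totalDegree_le_of_mem_boundedSpan {m : MonomialOrder τ} (hm : IsGraded m)
    {B : Set (MvPolynomial τ K)} {e : ℕ} {p : MvPolynomial τ K}
    (hp : p ∈ boundedSpan m B {t | (m.toSyn.symm t).degree ≤ e}) : p.totalDegree ≤ e := by
  rw [totalDegree_le_iff]
  intro a ha
  have := support_subset_of_mem_boundedSpan (isLowerSet_degree_le hm e) hp a ha
  change (m.toSyn.symm (m.toSyn a)).degree ≤ e at this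
  rwa [AddEquiv.symm_apply_apply] at this

/-- The order compares degrees first, so the leading monomial lies in the top part and stays the
largest one there. -/
theorem degree_topPart {m : MonomialOrder τ} (hm : IsGraded m) {f : MvPolynomial τ K}
    (hf : f ≠ 0) : topPart f ≠ 0 ∧ m.degree (topPart f) = m.degree f := by
  have h1 : coeff (m.degree f) (topPart f) ≠ 0 := by
    rw [topPart, coeff_homogeneousComponent, if_pos (hm.degree_degree f)]
    exact mem_support_iff.mp (m.degree_mem_support hf)
  have h2 : topPart f ≠ 0 := fun e => h1 (by rw [e, coeff_zero])
  refine ⟨h2, m.toSyn.injective (le_antisymm ?_ (m.le_degree (mem_support_iff.mpr h1)))⟩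
  refine m.le_degree ?_
  have h3 := mem_support_iff.mp (m.degree_mem_support h2)
  rw [topPart, coeff_homogeneousComponent] at h3
  exact mem_support_iff.mpr fun e => h3 (by rw [topPart] at e; rw [e, ite_self])

theorem totalDegree_topPart {m : MonomialOrder τ} (hm : IsGraded m) (f : MvPolynomial τ K) :
    (topPart f).totalDegree = f.totalDegree := by
  by_cases hf : f = 0
  · rw [hf, topPart, map_zero]
  · rw [← hm.degree_degree, (degree_topPart hm hf).2, hm.degree_degree]

theorem mem_of_degReg_eq {I : Ideal (MvPolynomial τ K)} {D : ℕ} (h : degReg I = (D : ℕ∞))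
    {p : MvPolynomial τ K} (hp : p.IsHomogeneous D) : p ∈ I := by
  rw [degReg] at h
  split_ifs at h with hex
  · obtain ⟨N, hN⟩ := hex
    have hmem : sInf {d : ℕ | ∀ p : MvPolynomial τ K, p.IsHomogeneous d → p ∈ I} ∈
        {d : ℕ | ∀ p : MvPolynomial τ K, p.IsHomogeneous d → p ∈ I} :=
      Nat.sInf_mem ⟨N, hN N le_rfl⟩
    rw [Nat.cast_inj.mp h] at hmem
    exact hmem p hp
  · exact absurd h (ENat.natCast_ne_top D).symm

/-- In degree `0` the ideal would contain `1`, but generators of positive degree have no constant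
term. -/
theorem degReg_pos {ι : Type*} {f : ι → MvPolynomial τ K} {d : ι → ℕ}
    (hf : ∀ i, (f i).IsHomogeneous (d i)) (hd : ∀ i, 0 < d i) {D : ℕ}
    (h : degReg (Ideal.span (Set.range f)) = (D : ℕ∞)) : 0 < D := by
  rw [Nat.pos_iff_ne_zero]
  rintro rfl
  have h1 : (1 : MvPolynomial τ K) ∈ Ideal.span (Set.range f) :=
    mem_of_degReg_eq h (isHomogeneous_one τ K)
  have h2 : Ideal.span (Set.range f) ≤ RingHom.ker (constantCoeff (R := K) (σ := τ)) := by
    refine Ideal.span_le.mpr ?_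
    rintro _ ⟨i, rfl⟩
    refine (hf i).coeff_eq_zero ?_
    rw [map_zero]
    exact (hd i).ne
  have h3 := h2 h1
  rw [RingHom.mem_ker, map_one] at h3
  exact one_ne_zero h3

theorem isHomogeneous_of_X_mul {i : τ} {d : ℕ} {q : MvPolynomial τ K}
    (h : (X i * q).IsHomogeneous (d + 1)) : q.IsHomogeneous d := by
  rw [isHomogeneous_iff_degree] at h ⊢
  intro a ha
  have := h (Finsupp.single i 1 + a) (by
    rw [mem_support_iff, coeff_X_mul]
    exact mem_support_iff.mp ha)
  rw [map_add, Finsupp.degree_single] at this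
  omega

end HomogeneousIdeals

/-! ### Lifting syzygies: `y` as a non-zero-divisor below the degree of regularity -/

section Regularity

variable {σ K : Type*} [Field K] {k : ℕ} {F : Fin k → MvPolynomial σ K}

/-- Homogeneous elements of `⟨F^top⟩` are top parts of elements of `⟨F⟩` without cancellation. -/
theorem exists_lift_of_mem_span_topPart {m : MonomialOrder σ} (hm : IsGraded m)
    {q : MvPolynomial σ K} {e : ℕ} (hq : q.IsHomogeneous e)
    (hmem : q ∈ Ideal.span (Set.range fun i => topPart (F i))) :
    ∃ p ∈ boundedSpan m (Set.range F) {t | (m.toSyn.symm t).degree ≤ e},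
      homogeneousComponent e p = q ∧
        homTo e p ∈ Ideal.span (Set.range fun i => homogenize (F i)) := by
  rw [← Set.image_univ] at hmem
  obtain ⟨c, -, hc, rfl⟩ := exists_homogeneous_coeffs (fun i => isHomogeneous_topPart (F i)) hq hmem
  -- The same coefficients are used with `F i` in place of its top part. They are homogeneous of
  -- complementary degree, so the component of degree `e` is the given one and nothing of higher
  -- degree has to cancel.
  refine ⟨∑ i, c i * F i, sum_mem_boundedSpan hm fun i => (hc i).imp_right ?_, ?_, ?_⟩
  · rintro ⟨n, hn, hne⟩
    exact ⟨n, hn, hne.le⟩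
  · rw [map_sum]
    refine Finset.sum_congr rfl fun i _ => ?_
    rcases hc i with h | ⟨n, hn, rfl⟩
    · rw [h, zero_mul, zero_mul, map_zero]
    · rw [mul_comm, add_comm, homogeneousComponent_add_mul hn, mul_comm, topPart]
  · rw [map_sum]
    refine sum_mem fun i _ => ?_
    rcases hc i with h | ⟨n, hn, rfl⟩
    · rw [h, zero_mul, map_zero]; exact zero_mem _
    · rw [homTo_mul hn.totalDegree_le le_rfl, ← homogenize_eq_homTo]
      exact Ideal.mul_mem_left _ _ (Ideal.subset_span ⟨i, rfl⟩)

/-- The syzygies of `F^top` in degrees below the degree of regularity lift to syzygies of `F^h`. -/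
theorem exists_syzygy_lift {m : MonomialOrder σ} (hm : IsGraded m) {D : ℕ}
    (hreg : IsDRegular (fun i => topPart (F i)) (D : ℕ∞)) {e : ℕ} (he : e < D) (i : ℕ)
    (hi : i ≤ k) (h : Fin k → MvPolynomial σ K) (hzero : ∀ j : Fin k, i ≤ j → h j = 0)
    (hhom : ∀ j, h j = 0 ∨ ∃ n, (h j).IsHomogeneous n ∧ n + (F j).totalDegree = e)
    (hsum : ∑ j, h j * topPart (F j) = 0) :
    ∃ H : Fin k → MvPolynomial (Option σ) K, (∀ j, homTopPart (H j) = h j) ∧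
      ∑ j, H j * homogenize (F j) = 0 := by
  classical
  -- The coefficients vanish from index `i` on; each step eliminates the last one that may be
  -- nonzero.
  induction i generalizing h with
  | zero =>
    refine ⟨0, fun j => ?_, by simp⟩
    rw [hzero j (Nat.zero_le _), Pi.zero_apply, map_zero]
  | succ i ih =>
    set ι : Fin k := ⟨i, hi⟩ with hι
    rcases hhom ι with h0 | ⟨n, hn, hne⟩
    · refine ih (by omega) h (fun j hj => ?_) hhom hsum
      rcases Nat.eq_or_lt_of_le hj with e | hlt
      · rwa [← (Fin.ext e : ι = j)]
      · exact hzero j hlt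
    -- Solving the relation for its last term puts it into the ideal of the earlier top parts, which
    -- is where regularity applies.
    have hmem : h ι * topPart (F ι) ∈
        Ideal.span ((fun j => topPart (F j)) '' {j | j < ι}) := by
      have e1 : h ι * topPart (F ι) = -∑ j ∈ Finset.univ.erase ι, h j * topPart (F j) := by
        rw [eq_neg_iff_add_eq_zero,
        Finset.add_sum_erase _ (fun j => h j * topPart (F j)) (Finset.mem_univ ι), hsum]
      rw [e1]
      refine neg_mem (sum_mem fun j hj => ?_)
      rcases lt_or_gt_of_ne (Finset.ne_of_mem_erase hj) with hlt | hgt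
      · exact Ideal.mul_mem_left _ _ (Ideal.subset_span ⟨j, hlt, rfl⟩)
      · rw [hzero j (Nat.succ_le_of_lt hgt), zero_mul]
        exact zero_mem _
    have hmem2 := hreg ι n (h ι) hn
      (by simp only [totalDegree_topPart hm]; exact_mod_cast hne.trans_lt he) hmem
    obtain ⟨s, hs0, hs, hsum2⟩ :=
      exists_homogeneous_coeffs (fun j => isHomogeneous_topPart (F j)) hn hmem2
    have hsι : s ι = 0 := hs0 ι (lt_irrefl ι)
    -- With `h ι = ∑ s_j f_j^top`, subtracting the Koszul syzygies between `f_j` and `f_ι`, weighted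
    -- by `s_j`, kills the coefficient at `ι` and changes the earlier ones within the same degree.
    obtain ⟨H, hH, hHsum⟩ := ih (by omega)
      (fun j => h j + s j * topPart (F ι) - if j = ι then h ι else 0) (fun j hj => by
        by_cases hjι : j = ι
        · rw [hjι, hsι, zero_mul, add_zero, if_pos rfl, sub_self]
        · have hlt : i < j := lt_of_le_of_ne hj fun e => hjι (Fin.ext e.symm)
          rw [if_neg hjι, hzero j hlt, hs0 j (fun h => absurd (Fin.lt_def.mp h) (by
            simp only [hι]; omega)), zero_mul, add_zero, sub_zero])
      (fun j => by
        by_cases hjι : j = ι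
        · rw [hjι, hsι, zero_mul, add_zero, if_pos rfl, sub_self]
          exact Or.inl rfl
        · rw [if_neg hjι, sub_zero]
          rcases hs j with h1 | ⟨n', hn', hne'⟩
          · rw [h1, zero_mul, add_zero]; exact hhom j
          · have h2 : (s j * topPart (F ι)).IsHomogeneous (n' + (F ι).totalDegree) :=
              hn'.mul (isHomogeneous_topPart _)
            refine Or.inr ⟨n' + (F ι).totalDegree, ?_, by omega⟩
            rcases hhom j with h3 | ⟨n'', hn'', hne''⟩
            · rwa [h3, zero_add]
            · have : n'' = n' + (F ι).totalDegree := by omega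
              exact (this ▸ hn'').add h2)
      (by
        simp only [sub_mul, add_mul, ite_mul, zero_mul, Finset.sum_sub_distrib,
          Finset.sum_add_distrib, hsum, Finset.sum_ite_eq', Finset.mem_univ, if_true]
        rw [zero_add, sub_eq_zero, hsum2, Finset.sum_mul]
        exact Finset.sum_congr rfl fun j _ => by ring)
    -- The subtracted Koszul syzygies are added back on the homogenized side, with the `s_j`
    -- regarded as free of `y`; they are syzygies of any sequence.
    refine ⟨fun j => H j - rename some (s j) * homogenize (F ι) +
      if j = ι then ∑ l, rename some (s l) * homogenize (F l) else 0, fun j => ?_, ?_⟩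
    · rw [map_add, map_sub, hH, map_mul, homTopPart_rename, homTopPart_homogenize]
      by_cases hjι : j = ι
      · rw [if_pos hjι, if_pos hjι, map_sum, hjι, hsum2]
        simp only [map_mul, homTopPart_rename, homTopPart_homogenize]
        ring
      · rw [if_neg hjι, if_neg hjι, map_zero]
        ring
    · simp only [add_mul, sub_mul, ite_mul, zero_mul, Finset.sum_sub_distrib,
        Finset.sum_add_distrib, hHsum, Finset.sum_ite_eq', Finset.mem_univ, if_true]
      rw [zero_sub, neg_add_eq_zero, Finset.sum_mul]
      exact Finset.sum_congr rfl fun j _ => by ring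

/-- Below the degree of regularity, `y` is not a zero divisor modulo `⟨F^h⟩`. -/
theorem exists_eq_X_mul_of_homTopPart_eq_zero {m : MonomialOrder σ} (hm : IsGraded m) {D : ℕ}
    (hreg : IsDRegular (fun i => topPart (F i)) (D : ℕ∞)) {e : ℕ} (he : e < D)
    {p : MvPolynomial (Option σ) K} (hp : p.IsHomogeneous e)
    (hmem : p ∈ Ideal.span (Set.range fun i => homogenize (F i))) (htop : homTopPart p = 0) :
    ∃ q ∈ Ideal.span (Set.range fun i => homogenize (F i)), p = X none * q := by
  rw [← Set.image_univ] at hmem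
  obtain ⟨c, -, hc, rfl⟩ :=
    exists_homogeneous_coeffs (fun i => isHomogeneous_homogenize (F i)) hp hmem
  have hhom : ∀ {n : ℕ} {g : MvPolynomial (Option σ) K}, g.IsHomogeneous n →
      (homTopPart g).IsHomogeneous n := by
    intro n g hg
    rw [← homTo_dehomogenize hg, homTopPart_homTo (totalDegree_dehomogenize_le hg)]
    exact homogeneousComponent_isHomogeneous _ _
  -- At `y = 0` the representation of `p` becomes a syzygy of `F^top`. Subtracting its lift does not
  -- change `p` and makes all coefficients divisible by `y`.
  obtain ⟨H, hH, hHsum⟩ := exists_syzygy_lift hm hreg he k le_rfl (fun j => homTopPart (c j))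
    (fun j hj => absurd j.2 (not_lt.mpr hj))
    (fun j => (hc j).imp (fun h => by rw [h, map_zero]) fun ⟨n, hn, hne⟩ => ⟨n, hhom hn, hne⟩)
    (by simpa only [map_sum, map_mul, homTopPart_homogenize] using htop)
  choose c' hc' using fun j => X_none_dvd_of_homTopPart_eq_zero (p := c j - H j)
    (by rw [map_sub, hH, sub_self])
  refine ⟨∑ j, c' j * homogenize (F j),
    sum_mem fun j _ => Ideal.mul_mem_left _ _ (Ideal.subset_span ⟨j, rfl⟩), ?_⟩
  rw [Finset.mul_sum]
  have : ∀ j, X none * (c' j * homogenize (F j)) =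
      c j * homogenize (F j) - H j * homogenize (F j) := fun j => by
    rw [← mul_assoc, ← hc', sub_mul]
  simp only [this]
  rw [Finset.sum_sub_distrib, hHsum, sub_zero]

theorem homTopPart_mem {p : MvPolynomial (Option σ) K}
    (hp : p ∈ Ideal.span (Set.range fun i => homogenize (F i))) :
    homTopPart p ∈ Ideal.span (Set.range fun i => topPart (F i)) := by
  have := Ideal.mem_map_of_mem (homTopPart (σ := σ) (K := K)) hp
  rw [Ideal.map_span, ← Set.range_comp] at this
  simpa only [Function.comp_def, homTopPart_homogenize] using this

end Regularity

/-! ### Reduced Gröbner bases of homogeneous ideals -/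

section GroebnerBases

variable {τ K : Type*} [Field K] [Finite τ] {m : MonomialOrder τ}

/-- Leading monomials of the reduced basis are the minimal generators of the leading ideal. This
description refers to the ideal alone, so two bases can be compared through their ideals. -/
theorem mem_leadingExponents_reducedGroebnerBasis {I : Ideal (MvPolynomial τ K)} {d : ℕ}
    {a : τ →₀ ℕ} : a ∈ leadingExponents m (reducedGroebnerBasis m I) d ↔
      a.degree = d ∧ (∃ f ∈ I, f ≠ 0 ∧ m.degree f = a) ∧
        ∀ f ∈ I, f ≠ 0 → m.degree f ≤ a → m.degree f = a := by
  have hG := reducedGroebnerBasis_spec m I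
  constructor
  · rintro ⟨hd, g, hg, rfl⟩
    obtain ⟨h1, h2, h3, -⟩ := (hG.mem_iff g).mp hg
    exact ⟨hd, ⟨g, h1, h2.ne_zero, rfl⟩, h3⟩
  · rintro ⟨hd, ⟨f, hf, hf0, rfl⟩, hmin⟩
    obtain ⟨g, hg, hg0, hle⟩ := hG.1.2 f hf hf0
    exact ⟨hd, g, hg, hmin g (hG.1.1 hg) hg0 hle⟩

/-- The part of `g` below its top part lies in the ideal too. If it were nonzero, its leading
monomial would be a tail monomial of `g` that is reducible. -/
theorem isHomogeneous_of_mem_reducedGroebnerBasis (hm : IsGraded m) {ι : Type*} [Fintype ι]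
    {f : ι → MvPolynomial τ K} {d : ι → ℕ} (hf : ∀ i, (f i).IsHomogeneous (d i))
    {g : MvPolynomial τ K} (hg : g ∈ reducedGroebnerBasis m (Ideal.span (Set.range f))) :
    g.IsHomogeneous g.totalDegree := by
  classical
  obtain ⟨hgI, hgm, -, htail⟩ := ((reducedGroebnerBasis_spec m _).mem_iff g).mp hg
  suffices h : g - topPart g = 0 by
    rw [sub_eq_zero] at h
    have := isHomogeneous_topPart g
    rwa [← h] at this
  by_contra hne
  have hs := m.degree_mem_support hne
  have hc := mem_support_iff.mp hs
  rw [coeff_sub, topPart, coeff_homogeneousComponent] at hc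
  split_ifs at hc with hdeg
  · exact hc (sub_self _)
  · rw [sub_zero] at hc
    refine htail _ (mem_support_iff.mpr hc) (fun e => hdeg ?_) (g - topPart g)
      (sub_mem hgI (homogeneousComponent_mem_span_range hf hgI _)) hne le_rfl
    rw [e, hm.degree_degree]

end GroebnerBases

/-! ### Degrees up to the degree of regularity -/

section Conclusions

variable {σ K : Type*} [Field K] {m : MonomialOrder σ} {k : ℕ}
  {F : Fin k → MvPolynomial σ K} {D : ℕ}

/-- The monomial itself lies in `⟨F^top⟩`, and its lift has it as the whole component of degree `D`;
everything else has smaller degree. -/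
theorem exists_of_degree_eq_degReg (hm : IsGraded m)
    (hD : degReg (Ideal.span (Set.range fun i => topPart (F i))) = (D : ℕ∞)) {a : σ →₀ ℕ}
    (ha : a.degree = D) :
    ∃ p ∈ boundedSpan m (Set.range F) {t | (m.toSyn.symm t).degree ≤ D},
      p ≠ 0 ∧ m.degree p = a ∧ homTo D p ∈ Ideal.span (Set.range fun i => homogenize (F i)) := by
  classical
  have hhom : (monomial a (1 : K)).IsHomogeneous D := isHomogeneous_monomial 1 ha
  obtain ⟨p, hp, hpc, hph⟩ := exists_lift_of_mem_span_topPart hm hhom (mem_of_degReg_eq hD hhom)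
  have hcoeff : ∀ b : σ →₀ ℕ, b.degree = D → coeff b p = if a = b then 1 else 0 := by
    intro b hb
    rw [← coeff_monomial, ← hpc, coeff_homogeneousComponent, if_pos hb]
  have hap : coeff a p ≠ 0 := by rw [hcoeff a ha, if_pos rfl]; exact one_ne_zero
  have hp0 : p ≠ 0 := fun e => hap (by rw [e, coeff_zero])
  have hdeg := totalDegree_le_iff.mp (totalDegree_le_of_mem_boundedSpan hm hp)
  refine ⟨p, hp, hp0, ?_, hph⟩
  have h1 := m.degree_mem_support hp0
  have h2 : (m.degree p).degree = D :=
    le_antisymm (hdeg _ h1) (ha ▸ hm _ _ (m.le_degree (mem_support_iff.mpr hap)))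
  by_contra hne
  exact mem_support_iff.mp h1 (by rw [hcoeff _ h2, if_neg (fun e => hne e.symm)])

theorem monomial_embDomain (a : σ →₀ ℕ) (c : K) :
    rename some (monomial a c) =
      (monomial (a.embDomain Function.Embedding.some) c : MvPolynomial (Option σ) K) := by
  rw [rename_monomial, Finsupp.embDomain_eq_mapDomain]
  rfl

theorem isFullInDegree_of_degReg (hm : IsGraded m)
    (hD : degReg (Ideal.span (Set.range fun i => topPart (F i))) = (D : ℕ∞)) :
    IsFullInDegree m (Set.range F) D := fun _ ha =>
  let ⟨p, hp, hp0, hpa, _⟩ := exists_of_degree_eq_degReg hm hD ha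
  ⟨p, hp, hp0, hpa⟩

theorem homogenized_init_range (F : Fin k → MvPolynomial σ K) :
    (BState.init (Set.range F)).homogenized =
      BState.init (Set.range fun i => homogenize (F i)) := by
  rw [BState.homogenized_init, ← Set.range_comp]
  rfl

variable [Finite σ]

/-- A leading monomial of degree above `D` would have a proper divisor of degree `D`, itself a
leading monomial of the ideal, against minimality. -/
theorem maxGBDegree_le (hm : IsGraded m)
    (hD : degReg (Ideal.span (Set.range fun i => topPart (F i))) = (D : ℕ∞)) :
    maxGBDegree m (Ideal.span (Set.range F)) ≤ D := by
  refine iSup₂_le fun g hg => Nat.cast_le.mpr ?_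
  by_contra hlt
  obtain ⟨-, -, hmin, -⟩ := ((reducedGroebnerBasis_spec m _).mem_iff g).mp hg
  have hdeg := hm.degree_degree g
  obtain ⟨c, hcg, hc⟩ := Finsupp.exists_le_degree_eq (m.degree g) D (by omega)
  obtain ⟨p, hp, hp0, rfl, -⟩ := exists_of_degree_eq_degReg hm hD hc
  have := hmin p (boundedSpan_le_span _ _ hp) hp0 hcg
  rw [this] at hc
  omega

/-- Monomials of degree `D` in `x_1, …, x_n` are leading monomials of `⟨F^h⟩`. -/
theorem exists_mem_span_homogenize_degree_eq (hm : IsGraded m)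
    (hD : degReg (Ideal.span (Set.range fun i => topPart (F i))) = (D : ℕ∞)) {a : σ →₀ ℕ}
    (ha : a.degree = D) :
    ∃ p ∈ Ideal.span (Set.range fun i => homogenize (F i)), p ≠ 0 ∧
      (homogenizedOrder m).degree p = a.embDomain Function.Embedding.some := by
  obtain ⟨p, hp, hp0, rfl, hph⟩ := exists_of_degree_eq_degReg hm hD ha
  refine ⟨_, hph, fun e => hp0 (homTo_eq_zero.mp e), ?_⟩
  rw [degree_homTo (totalDegree_le_of_mem_boundedSpan hm hp) hp0, homExp_of_degree_eq ha.ge]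

theorem span_leadingMonomials_inter (hm : IsGraded m)
    (hD : degReg (Ideal.span (Set.range fun i => topPart (F i))) = (D : ℕ∞)) :
    (Ideal.span {t : MvPolynomial (Option σ) K | ∃ g ∈ reducedGroebnerBasis (homogenizedOrder m)
          (Ideal.span (Set.range fun i => homogenize (F i))), g.totalDegree ≤ D ∧
          t = monomial ((homogenizedOrder m).degree g) 1} : Set (MvPolynomial (Option σ) K)) ∩
        rename some '' {p : MvPolynomial σ K | p.IsHomogeneous D} =
      rename some '' {p : MvPolynomial σ K | p.IsHomogeneous D} := by
  refine Set.inter_eq_right.mpr ?_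
  rintro _ ⟨p, hp, rfl⟩
  rw [SetLike.mem_coe, p.as_sum, map_sum]
  refine sum_mem fun a ha => ?_
  have haD := isHomogeneous_iff_degree.mp hp a ha
  obtain ⟨q, hq, hq0, hqa⟩ := exists_mem_span_homogenize_degree_eq hm hD haD
  obtain ⟨g, hg, -, hle⟩ := (reducedGroebnerBasis_spec (homogenizedOrder m) _).1.2 q hq hq0
  rw [hqa] at hle
  have hgD : g.totalDegree ≤ D := by
    rw [← (isGraded_homogenizedOrder m).degree_degree, ← haD, ← degree_embDomain a]
    exact Finsupp.degree_mono hle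
  rw [monomial_embDomain, ← tsub_add_cancel_of_le hle, ← mul_one (coeff a p), ← monomial_mul]
  exact Ideal.mul_mem_left _ _ (Ideal.subset_span ⟨g, hg, hgD, rfl⟩)

theorem rename_homTopPart_eq_leadingTerm (hm : IsGraded m)
    (hD : degReg (Ideal.span (Set.range fun i => topPart (F i))) = (D : ℕ∞))
    {g : MvPolynomial (Option σ) K} (hg : g ∈ reducedGroebnerBasis (homogenizedOrder m)
      (Ideal.span (Set.range fun i => homogenize (F i)))) (hgD : g.totalDegree = D)
    (htop : homTopPart g ≠ 0) :
    rename some (homTopPart g) = (homogenizedOrder m).leadingTerm g := by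
  classical
  have hhom := isHomogeneous_of_mem_reducedGroebnerBasis (isGraded_homogenizedOrder m)
    (fun i => isHomogeneous_homogenize (F i)) hg
  rw [hgD] at hhom
  obtain ⟨-, -, -, htail⟩ := ((reducedGroebnerBasis_spec (homogenizedOrder m) _).mem_iff g).mp hg
  have hf := totalDegree_dehomogenize_le hhom
  have hgf := homTo_dehomogenize hhom
  generalize dehomogenize g = f at hf hgf
  subst hgf
  rw [homTopPart_homTo hf] at htop ⊢
  -- A monomial of the top part has degree `D` and no `y`, so it is a leading monomial of the ideal;
  -- in a reduced basis element this is possible only for the leading monomial.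
  have key : ∀ a ∈ (homogeneousComponent D f).support,
      (homogenizedOrder m).degree (homTo D f) = a.embDomain Function.Embedding.some ∧
        coeff a (homogeneousComponent D f) = (homogenizedOrder m).leadingCoeff (homTo D f) := by
    intro a ha
    rw [mem_support_iff, coeff_homogeneousComponent] at ha
    split_ifs at ha with haD
    · have h1 : homExp D a = a.embDomain Function.Embedding.some := homExp_of_degree_eq haD.ge
      have h2 : (homogenizedOrder m).degree (homTo D f) = a.embDomain Function.Embedding.some := by
        by_contra hne
        obtain ⟨p, hp, hp0, hpa⟩ := exists_mem_span_homogenize_degree_eq hm hD haD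
        refine htail _ (mem_support_homTo.mpr (mem_support_iff.mpr ha)) ?_ p hp hp0 ?_
        · rw [h1]; exact fun e => hne e.symm
        · rw [hpa, h1]
      refine ⟨h2, ?_⟩
      rw [MonomialOrder.leadingCoeff, h2, ← h1, coeff_homTo, coeff_homogeneousComponent,
        if_pos haD]
    · exact absurd rfl ha
  obtain ⟨a, ha⟩ := support_nonempty.mpr htop
  have hsupp : (homogeneousComponent D f).support = {a} := by
    refine Finset.eq_singleton_iff_unique_mem.mpr ⟨ha, fun b hb => ?_⟩
    exact Finsupp.embDomain_injective _ ((key b hb).1.symm.trans (key a ha).1)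
  rw [(homogeneousComponent D f).as_sum, hsupp, Finset.sum_singleton, monomial_embDomain,
    (key a ha).2, ← (key a ha).1]
  rfl

theorem degree_X_mul_ge {τ : Type*} {M : MonomialOrder τ} {i : τ} {q : MvPolynomial τ K}
    (hq : q ≠ 0) : M.degree q ≤ M.degree (X i * q) := by
  rw [MonomialOrder.degree_mul (X_ne_zero i) hq]
  exact le_add_self

/-- A homogeneous polynomial of degree `d` with nonzero top part is the homogenization of its
dehomogenization, which has full degree `d`; its leading monomial is that of the top part. -/
theorem degree_eq_of_homTopPart_ne_zero (hm : IsGraded m) {d : ℕ} {p : MvPolynomial (Option σ) K}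
    (hp : p.IsHomogeneous d) (htop : homTopPart p ≠ 0) :
    (homogenizedOrder m).degree p =
      (m.degree (homTopPart p)).embDomain Function.Embedding.some := by
  have hf := totalDegree_dehomogenize_le hp
  have hpf := homTo_dehomogenize hp
  generalize dehomogenize p = f at hf hpf
  subst hpf
  rw [homTopPart_homTo hf] at htop ⊢
  have hf0 : f ≠ 0 := fun e => htop (by rw [e, map_zero])
  obtain rfl : f.totalDegree = d := le_antisymm hf
    (not_lt.mp fun hlt => htop (homogeneousComponent_eq_zero _ _ hlt))
  rw [degree_homTo hf hf0, homExp_of_degree_eq (hm.degree_degree f).ge]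
  exact congrArg _ (degree_topPart hm hf0).2.symm

theorem homTopPart_ne_zero (hm : IsGraded m) {d : ℕ} {p : MvPolynomial (Option σ) K}
    (hp : p.IsHomogeneous d) (hp0 : p ≠ 0) (h : (homogenizedOrder m).degree p none = 0) :
    homTopPart p ≠ 0 := by
  have hf := totalDegree_dehomogenize_le hp
  have hpf := homTo_dehomogenize hp
  generalize dehomogenize p = f at hf hpf
  subst hpf
  have hf0 : f ≠ 0 := fun e => hp0 (by rw [e, map_zero])
  rw [degree_homTo hf hf0, homExp_none, hm.degree_degree] at h
  obtain rfl : f.totalDegree = d := by omega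
  rw [homTopPart_homTo hf]
  exact (degree_topPart hm hf0).1

/-- Divide by `y` inside `⟨F^h⟩` as long as the top part vanishes; each division lowers the degree,
and the surviving top part supplies `q`. -/
theorem exists_embDomain_degree_le (hm : IsGraded m)
    (hreg : IsDRegular (fun i => topPart (F i)) (D : ℕ∞)) {d : ℕ} (hd : d < D)
    {p : MvPolynomial (Option σ) K} (hp : p.IsHomogeneous d) (hp0 : p ≠ 0)
    (hmem : p ∈ Ideal.span (Set.range fun i => homogenize (F i))) :
    ∃ q ∈ Ideal.span (Set.range fun i => topPart (F i)), q ≠ 0 ∧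
      (m.degree q).embDomain Function.Embedding.some ≤ (homogenizedOrder m).degree p := by
  induction d generalizing p with
  | zero =>
    refine ⟨_, homTopPart_mem hmem, ?_⟩
    have h : homTopPart p ≠ 0 := by
      refine homTopPart_ne_zero hm hp hp0 ?_
      have h1 := (isGraded_homogenizedOrder m).degree_degree p
      rw [hp.totalDegree hp0, Finsupp.degree_eq_zero_iff] at h1
      rw [h1, Finsupp.zero_apply]
    exact ⟨h, (degree_eq_of_homTopPart_ne_zero hm hp h).ge⟩
  | succ d ih =>
    by_cases htop : homTopPart p = 0
    · obtain ⟨q, hq, rfl⟩ := exists_eq_X_mul_of_homTopPart_eq_zero hm hreg hd hp hmem htop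
      have hq0 : q ≠ 0 := right_ne_zero_of_mul hp0
      obtain ⟨r, hr, hr0, hle⟩ := ih (by omega) (isHomogeneous_of_X_mul hp) hq0 hq
      exact ⟨r, hr, hr0, hle.trans (degree_X_mul_ge hq0)⟩
    · exact ⟨_, homTopPart_mem hmem, htop, (degree_eq_of_homTopPart_ne_zero hm hp htop).ge⟩

theorem leadingExponents_eq (hm : IsGraded m)
    (hreg : IsDRegular (fun i => topPart (F i)) (D : ℕ∞)) {d : ℕ} (hd : d < D) :
    leadingExponents (homogenizedOrder m) (reducedGroebnerBasis (homogenizedOrder m)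
        (Ideal.span (Set.range fun i => homogenize (F i)))) d =
      (fun a => a.embDomain Function.Embedding.some) '' leadingExponents m
        (reducedGroebnerBasis m (Ideal.span (Set.range fun i => topPart (F i)))) d := by
  have hM := isGraded_homogenizedOrder m
  -- Leading monomials of `⟨F^top⟩` are leading monomials of `⟨F^h⟩` in every degree, by lifting;
  -- regularity is needed only for the converse.
  have hA : ∀ q ∈ Ideal.span (Set.range fun i => topPart (F i)), q ≠ 0 →
      ∃ p ∈ Ideal.span (Set.range fun i => homogenize (F i)), p ≠ 0 ∧
        (homogenizedOrder m).degree p = (m.degree q).embDomain Function.Embedding.some := by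
    intro q hq hq0
    obtain ⟨hq0', hqdeg⟩ := degree_topPart hm hq0
    obtain ⟨p, hp, hpc, hph⟩ := exists_lift_of_mem_span_topPart hm (isHomogeneous_topPart q)
      (homogeneousComponent_mem_span_range (fun i => isHomogeneous_topPart (F i)) hq _)
    have hpd := totalDegree_le_of_mem_boundedSpan hm hp
    rw [← homTopPart_homTo hpd] at hpc
    refine ⟨_, hph, fun e => hq0' (by rw [← hpc, e, map_zero]), ?_⟩
    rw [degree_eq_of_homTopPart_ne_zero hm (isHomogeneous_homTo hpd) (hpc ▸ hq0'), hpc, hqdeg]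
  have htopI : ∀ p ∈ Ideal.span (Set.range fun i => homogenize (F i)),
      topPart p ∈ Ideal.span (Set.range fun i => homogenize (F i)) := fun p hp =>
    homogeneousComponent_mem_span_range (fun i => isHomogeneous_homogenize (F i)) hp _
  ext a
  rw [mem_leadingExponents_reducedGroebnerBasis]
  constructor
  · rintro ⟨rfl, ⟨p, hp, hp0, rfl⟩, hmin⟩
    obtain ⟨hp0', hpdeg⟩ := degree_topPart hM hp0
    rw [hM.degree_degree] at hd
    obtain ⟨q, hq, hq0, hle⟩ := exists_embDomain_degree_le hm hreg hd
      (isHomogeneous_topPart p) hp0' (htopI p hp)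
    rw [hpdeg] at hle
    -- The `y`-free divisor is itself a leading monomial of `⟨F^h⟩`, so minimality turns
    -- divisibility into equality.
    have heq : (m.degree q).embDomain Function.Embedding.some = (homogenizedOrder m).degree p := by
      obtain ⟨p', hp', hp0', hpe⟩ := hA q hq hq0
      rw [← hpe] at hle ⊢
      exact hmin p' hp' hp0' hle
    refine ⟨m.degree q, mem_leadingExponents_reducedGroebnerBasis.mpr
      ⟨by rw [← heq, degree_embDomain], ⟨q, hq, hq0, rfl⟩, fun q' hq' hq0' hle' => ?_⟩, heq⟩
    obtain ⟨p', hp', hp0', hpe⟩ := hA q' hq' hq0'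
    have := hmin p' hp' hp0' (by rw [hpe, ← heq]; exact embDomain_le_embDomain.mpr hle')
    rw [hpe, ← heq] at this
    exact Finsupp.embDomain_injective _ this
  · rintro ⟨b, hb, rfl⟩
    obtain ⟨rfl, ⟨q, hq, hq0, rfl⟩, hmin⟩ := mem_leadingExponents_reducedGroebnerBasis.mp hb
    refine ⟨degree_embDomain _, hA q hq hq0, fun p hp hp0 hle => ?_⟩
    obtain ⟨hp0', hpdeg⟩ := degree_topPart hM hp0
    -- A divisor of a `y`-free monomial is free of `y`, so the top part at `y = 0` keeps the leading
    -- term of `p`.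
    have htop : homTopPart (topPart p) ≠ 0 := by
      refine homTopPart_ne_zero hm (isHomogeneous_topPart p) hp0' ?_
      have := hle none
      rw [Finsupp.embDomain_some_none] at this
      rw [hpdeg]
      exact Nat.le_zero.mp this
    have hdeg := degree_eq_of_homTopPart_ne_zero hm (isHomogeneous_topPart p) htop
    rw [hpdeg] at hdeg
    rw [hdeg] at hle ⊢
    rw [hmin _ (homTopPart_mem (htopI p hp)) htop (embDomain_le_embDomain.mp hle)]

/-- In a semi-regular system no degree falls below the degree of regularity. -/
theorem noFallHom_of_isDRegular (hm : IsGraded m) (hF : ∀ i, F i ≠ 0)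
    (hreg : IsDRegular (fun i => topPart (F i)) (D : ℕ∞)) (l : List (BAction (Option σ) K)) :
    IsRun (homogenizedOrder m) (BState.init (Set.range fun i => homogenize (F i))) l →
    (∀ a ∈ l, a.OnPairs ∧ a.stepDegree (homogenizedOrder m) < D) →
    ∀ a ∈ l, a.NoFallHom (homogenizedOrder m) := by
  have hM := isGraded_homogenizedOrder m
  induction l using List.reverseRecOn with
  | nil => exact fun _ _ _ h => absurd h List.not_mem_nil
  | append_singleton l a ih =>
    intro hrun hl
    obtain ⟨h1, h2, -⟩ := isRun_append.mp hrun
    have hl' : ∀ b ∈ l, b.OnPairs ∧ b.stepDegree (homogenizedOrder m) < D := fun b hb =>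
      hl b (List.mem_append_left _ hb)
    have hfall := ih h1 hl'
    intro b hb
    rcases List.mem_append.mp hb with hb | hb
    · exact hfall b hb
    obtain rfl := List.mem_singleton.mp hb
    have hb' := hl b (List.mem_append_right _ (List.mem_singleton_self b))
    have hinv := (BState.invariant_init (m := homogenizedOrder m)
      (F := Set.range fun i => homogenize (F i))
      (fun ⟨i, hi⟩ => hF i (homogenize_eq_zero.mp hi))).finalState h1
    cases b with
    | discard f g => trivial
    | interreduce f r => exact absurd hb'.1 id
    | spair f' g' q =>
      intro hq0
      obtain ⟨hp', hmin, hnf⟩ := h2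
      obtain ⟨hf', hg', -⟩ := hinv.of_mem_pairs f' g' hp'
      have hqI : q ∈ Ideal.span (Set.range fun i => homogenize (F i)) := by
        have e1 := Ideal.span_le.mpr hinv.subset_span hnf.sub_mem_span
        have e2 := sub_mem (sPolynomial_mem (m := homogenizedOrder m) (hinv.subset_span hf')
          (hinv.subset_span hg')) e1
        rwa [sub_sub_cancel] at e2
      -- The preceding operations have no fall, so the current state is the homogenization of an
      -- affine state, and the normal form is a homogenization to the pair degree.
      have hqhom : q.IsHomogeneous (pairDegree (homogenizedOrder m) f' g') := by
        rw [← homogenized_init_range] at h1 hp' hnf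
        obtain ⟨l, rfl, h3, h4⟩ := h1.exists_of_homogenized hm fun b hb =>
          ⟨(hl' b hb).1, hfall b hb⟩
        rw [(h3.homogenize hm h4).2.1] at hp' hnf
        obtain ⟨f, g, rfl, rfl, -⟩ := exists_of_mem_homogenized_pairs hp'
        rw [sPolynomial_homogenize hm] at hnf
        obtain ⟨r, rfl, hr, -⟩ :=
          IsNormalForm.exists_of_homTo hm (totalDegree_sPolynomial_le hm f g) hnf
        rw [pairDegree_homogenize hm]
        exact isHomogeneous_homTo hr
      by_contra hne
      have htop : homTopPart q = 0 := by
        by_contra htop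
        rw [degree_eq_of_homTopPart_ne_zero hm hqhom htop, Finsupp.embDomain_some_none] at hne
        exact hne rfl
      obtain ⟨p, hpI, rfl⟩ := exists_eq_X_mul_of_homTopPart_eq_zero hm hreg hb'.2 hqhom hqI htop
      have hp0 : p ≠ 0 := right_ne_zero_of_mul hq0
      -- The step degree is positive because `y` divides the leading monomial of the normal form.
      obtain ⟨e, he⟩ : ∃ e, pairDegree (homogenizedOrder m) f' g' = e + 1 := by
        refine Nat.exists_eq_succ_of_ne_zero fun h0 => ?_
        have e1 := hM.degree_degree (X none * p)
        rw [hqhom.totalDegree hq0, h0, Finsupp.degree_eq_zero_iff] at e1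
        rw [e1] at hne
        exact hne rfl
      rw [he] at hqhom
      have hphom := isHomogeneous_of_X_mul hqhom
      have hspan : p ∈ boundedSpan (homogenizedOrder m) (Set.range fun i => homogenize (F i))
          {t | ((homogenizedOrder m).toSyn.symm t).degree ≤ e} := by
        rw [← Set.image_univ] at hpI
        obtain ⟨c, -, hc, rfl⟩ :=
          exists_homogeneous_coeffs (fun i => isHomogeneous_homogenize (F i)) hphom hpI
        refine sum_mem_boundedSpan hM fun i => (hc i).imp_right ?_
        rintro ⟨n, hn, hne⟩
        exact ⟨n, hn, (Nat.add_le_add_left (isHomogeneous_homogenize (F i)).totalDegree_le n).trans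
          hne.le⟩
      -- The treated pair has lowest degree `e + 1`, so nothing of degree at most `e` is pending and
      -- the leading monomial of `p` is reducible. Hence so is that of `y p`, which contradicts its
      -- being a normal form.
      obtain ⟨b, hb, hle⟩ := hinv.exists_degree_le hM (D := e)
        (fun f g hfg => by have := hmin f g hfg; omega) hspan hp0
      exact hnf.not_degree_le hq0 hb (fun e => hinv.zero_notMem (e ▸ hb))
        (hle.trans (degree_X_mul_ge hp0))

end Conclusions

end

end SemiRegGB

/-! ### The main theorem -/

open SemiRegGB

theorem mainTheorem3 {K : Type*} [Field K] {σ : Type*} [Finite σ] [LinearOrder σ] :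
    (∀ (k : ℕ) (F : Fin k → MvPolynomial σ K) (D : ℕ),
      (∀ i, 0 < (F i).totalDegree) →
      degReg (Ideal.span (Set.range fun i => topPart (F i))) = (D : ℕ∞) →
      let Gtop := reducedGroebnerBasis (drl σ) (Ideal.span (Set.range fun i => topPart (F i)))
      let Ghom := reducedGroebnerBasis (homogenizedOrder (drl σ))
        (Ideal.span (Set.range fun i => homogenize (F i)))
      let S := BState.init (Set.range F)
      let Shom := BState.init (Set.range fun i => homogenize (F i))
      -- (1)
      (IsAffineCryptoSemiRegular F → ∀ d < D,
        leadingExponents (homogenizedOrder (drl σ)) Ghom d =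
          (fun a => a.embDomain Function.Embedding.some) '' leadingExponents (drl σ) Gtop d) ∧
      -- (2)
      ((Ideal.span {t : MvPolynomial (Option σ) K | ∃ g ∈ Ghom, g.totalDegree ≤ D ∧
            t = MvPolynomial.monomial ((homogenizedOrder (drl σ)).degree g) 1} :
          Set (MvPolynomial (Option σ) K)) ∩
          MvPolynomial.rename some '' {p : MvPolynomial σ K | p.IsHomogeneous D} =
        MvPolynomial.rename some '' {p : MvPolynomial σ K | p.IsHomogeneous D}) ∧
      (∀ g ∈ Ghom, g.totalDegree = D → homTopPart g ≠ 0 →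
        MvPolynomial.rename some (homTopPart g) = (homogenizedOrder (drl σ)).leadingTerm g) ∧
      -- (3), step degrees less than `D`: there is no degree fall
      (IsAffineCryptoSemiRegular F →
        (∀ l, IsRun (homogenizedOrder (drl σ)) Shom l →
          (∀ a ∈ l, a.OnPairs ∧ a.stepDegree (homogenizedOrder (drl σ)) < D) →
          ∀ a ∈ l, a.NoFallHom (homogenizedOrder (drl σ))) ∧
        (∀ l, IsRun (drl σ) S l → (∀ a ∈ l, a.OnPairs ∧ a.stepDegree (drl σ) < D) →
          ∀ a ∈ l, a.NoFall (drl σ))) ∧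
      -- (3), step degrees at most `D`: the computations correspond as long as no degree falls
      Set.BijOn (List.map (BAction.map dehomogenize))
        {l | IsRun (homogenizedOrder (drl σ)) Shom l ∧ ∀ a ∈ l, a.OnPairs ∧
          a.stepDegree (homogenizedOrder (drl σ)) ≤ D ∧ a.NoFallHom (homogenizedOrder (drl σ))}
        {l | IsRun (drl σ) S l ∧ ∀ a ∈ l, a.OnPairs ∧
          a.stepDegree (drl σ) ≤ D ∧ a.NoFall (drl σ)} ∧
      -- (3), after step degree `D`: all monomials of degree at least `D` are leading monomials
      (∀ l, IsRun (drl σ) S l →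
        (∀ f g, s(f, g) ∈ (finalState S l).pairs → D < pairDegree (drl σ) f g) →
        ∀ a : σ →₀ ℕ, D ≤ a.degree →
          ∃ g ∈ (finalState S l).basis, g ≠ 0 ∧ (drl σ).degree g ≤ a) ∧
      -- (4), first half
      ((∀ i, (F i).totalDegree ≤ D) →
        maxGBDegree (drl σ) (Ideal.span (Set.range F)) ≤ D)) ∧
    -- (4), second half
    ∃ A : BuchbergerProcedure K (drl σ), A.ComputesGroebnerBases ∧
      ∀ (k : ℕ) (F : Fin k → MvPolynomial σ K) (D : ℕ),
        (∀ i, 0 < (F i).totalDegree) →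
        degReg (Ideal.span (Set.range fun i => topPart (F i))) = (D : ℕ∞) →
        (∀ i, (F i).totalDegree ≤ D) →
        A.solvingDegree (Set.range F) ≤ ((2 * D - 1 : ℕ) : ℕ∞) ∧
        A.strictSolvingDegree (Set.range F) ≤ ((2 * D - 2 : ℕ) : ℕ∞) := by
  have hm := isGraded_drl σ
  refine ⟨fun k F D hF hD => ?_, interreducingProcedure K (drl σ),
    interreducingProcedure_computesGroebnerBases hm, fun k F D hF hD hFD => ?_⟩
  · have hF0 : ∀ i, F i ≠ 0 := fun i e => by
      have := hF i
      rw [e, totalDegree_zero] at this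
      exact lt_irrefl _ this
    intro Gtop Ghom S Shom
    -- Semi-regularity is regularity up to the degree of regularity, which the hypothesis identifies
    -- with `D`.
    have hreg : IsAffineCryptoSemiRegular F → IsDRegular (fun i => topPart (F i)) (D : ℕ∞) :=
      fun h => hD ▸ h
    have hnoFall : IsAffineCryptoSemiRegular F → ∀ l, IsRun (homogenizedOrder (drl σ)) Shom l →
        (∀ a ∈ l, a.OnPairs ∧ a.stepDegree (homogenizedOrder (drl σ)) < D) →
        ∀ a ∈ l, a.NoFallHom (homogenizedOrder (drl σ)) := fun h =>
      noFallHom_of_isDRegular hm hF0 (hreg h)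
    have hS : S.homogenized = Shom := homogenized_init_range F
    refine ⟨fun h d hd => leadingExponents_eq hm (hreg h) hd, span_leadingMonomials_inter hm hD,
      fun g hg hgD htop => rename_homTopPart_eq_leadingTerm hm hD hg hgD htop,
      fun h => ⟨hnoFall h, noFall_of_noFallHom hm (hS ▸ hnoFall h)⟩,
      hS ▸ bijOn_dehomogenize hm S D, fun l hl hpairs a ha => ?_, fun _ => maxGBDegree_le hm hD⟩
    have hinv := (BState.invariant_init (m := drl σ) (F := Set.range F)
      (fun ⟨i, hi⟩ => hF0 i hi)).finalState hl
    obtain ⟨b, hb, hb0, hle, -⟩ :=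
      hinv.exists_degree_le_of_isFull hm (isFullInDegree_of_degReg hm hD) hpairs ha
    exact ⟨b, hb, hb0, hle⟩
  · refine interreducingProcedure_solvingDegree_le hm ?_
      (degReg_pos (fun i => isHomogeneous_topPart (F i)) hF hD) (isFullInDegree_of_degReg hm hD) ?_
    · rintro ⟨i, hi⟩
      have := hF i
      rw [hi, totalDegree_zero] at this
      exact lt_irrefl _ this
    · rintro _ ⟨i, rfl⟩
      exact hFD i
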